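/- Let $n\ge 3$ and let $\overline{\mathcal M}{}_0^n(\mathbb R)$ be the compactification of $\big((\mathbb{RP}^1)^n\setminus\Delta\big)/PGL_2(\mathbb R)$ ($\Delta$ the thick diagonal) by stable real $n$-pointed curves of genus zero, that is, the closure of this quotient in the product of projective lines $\mathbb{RP}^1$ in which it is embedded by the cross-ratios of all quadruples of distinct labels. For every labelling of the sides of an $n$-gon by $1,\dots,n$, the closure in $\overline{\mathcal M}{}_0^n(\mathbb R)$ of the set of configurations whose points occur on $\mathbb{RP}^1$ in the cyclic order given by the labelling is a copy of the associahedron $K_{n-1}$; these copies tessellate $\overline{\mathcal M}{}_0^n(\mathbb R)$. For every set of $k$ pairwise non-crossing diagonals of the labelled $n$-gon, the points of this associahedron whose double points (nodes) separate the labels exactly as the $k$ diagonals do form an open face; the subsets of $\overline{\mathcal M}{}_0^n(\mathbb R)$ obtained in this way are the (open) cells of codimension $k$ (faces of different associahedra that coincide as subsets are one cell). The boundary of a cell is its closure minus the cell itself. Let $1\le t\le k$. Then every cell of codimension $k$ of $\overline{\mathcal M}{}_0^n(\mathbb R)$ is contained in the boundary of exactly $$2^t\binom{k}{t}$$ cells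 of codimension $k-t$. -/

import Mathlib

open scoped Matrix

noncomputable section

namespace RealModuli

/-! ### The open moduli space and its compactification -/

/-- The real projective line `ℝℙ¹ = ℝ ∪ {∞}`. -/
abbrev RP1 : Type := OnePoint ℝ

/-- Homogeneous coordinates of a point of `ℝℙ¹`: `x ↦ (x : 1)` and `∞ ↦ (1 : 0)`. -/
def homCoord (p : RP1) : ℝ × ℝ := p.elim (1, 0) (fun x => (x, 1))

/-- The determinant of the homogeneous coordinates of two points
(it is `x - y` for two finite points `x`, `y`). -/
def bracket (p q : RP1) : ℝ :=
  (homCoord p).1 * (homCoord q).2 - (homCoord p).2 * (homCoord q).1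

/-- The cross-ratio `(p - r)(q - s) / ((p - s)(q - r))`, also when one of the points is `∞`.
For four distinct points it is a real number different from `0` and `1`. -/
def crossRatio (p q r s : RP1) : ℝ :=
  (bracket p r * bracket q s) / (bracket p s * bracket q r)

/-- Configurations of `n` distinct labelled points on `ℝℙ¹`, i.e. `(ℝℙ¹)ⁿ - Δ`
with `Δ` the thick diagonal. -/
def Config (n : ℕ) : Type := {x : Fin n → RP1 // Function.Injective x}

/-- Two configurations are equivalent if a projective transformation of `ℝℙ¹`, acting on all
points simultaneously, carries one to the other. -/
instance configSetoid (n : ℕ) : Setoid (Config n) where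
  r x y := ∃ g : GL (Fin 2) ℝ, ∀ i, y.1 i = g • x.1 i
  iseqv :=
    { refl := fun x => ⟨1, fun i => (one_smul _ _).symm⟩
      symm := by
        rintro x y ⟨g, h⟩
        exact ⟨g⁻¹, fun i => by rw [h i, inv_smul_smul]⟩
      trans := by
        rintro x y z ⟨g, h⟩ ⟨g', h'⟩
        exact ⟨g' * g, fun i => by rw [h' i, h i, mul_smul]⟩ }

/-- The open moduli space `((ℝℙ¹)ⁿ - Δ) / PGL₂(ℝ)`. -/
def OpenModuli (n : ℕ) : Type := Quotient (configSetoid n)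

/-- Ordered quadruples of distinct labels. -/
abbrev Quad (n : ℕ) : Type := Fin 4 ↪ Fin n

theorem homCoord_smul (g : GL (Fin 2) ℝ) (p : RP1) :
    ∃ c : ℝ, c ≠ 0 ∧
      g 0 0 * (homCoord p).1 + g 0 1 * (homCoord p).2 = c * (homCoord (g • p)).1 ∧
      g 1 0 * (homCoord p).1 + g 1 1 * (homCoord p).2 = c * (homCoord (g • p)).2 := by
  have hdet : g 0 0 * g 1 1 - g 0 1 * g 1 0 ≠ 0 := by
    have := g.det_ne_zero
    rwa [Matrix.det_fin_two] at this
  induction p using OnePoint.rec with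
  | infty =>
    rw [OnePoint.smul_infty_eq_ite]
    by_cases h : g 1 0 = 0
    · refine ⟨g 0 0, ?_, ?_, ?_⟩
      · intro h0
        simp [h, h0] at hdet
      · simp [homCoord, h]
      · simp [homCoord, h]
    · refine ⟨g 1 0, h, ?_, ?_⟩
      · simp [homCoord, h]
        field_simp
      · simp [homCoord, h]
  | coe x =>
    rw [OnePoint.smul_some_eq_ite]
    by_cases h : g 1 0 * x + g 1 1 = 0
    · refine ⟨g 0 0 * x + g 0 1, ?_, ?_, ?_⟩
      · intro h0
        apply hdet
        linear_combination g 0 0 * h - g 1 0 * h0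
      · simp [homCoord, h]
      · simp [homCoord, h]
    · refine ⟨g 1 0 * x + g 1 1, h, ?_, ?_⟩
      · simp [homCoord, h, mul_div_cancel₀]
      · simp [homCoord, h]

theorem crossRatio_smul (g : GL (Fin 2) ℝ) (p q r s : RP1) :
    crossRatio (g • p) (g • q) (g • r) (g • s) = crossRatio p q r s := by
  have hdet : g 0 0 * g 1 1 - g 0 1 * g 1 0 ≠ 0 := by
    have := g.det_ne_zero
    rwa [Matrix.det_fin_two] at this
  obtain ⟨a, ha, ha1, ha2⟩ := homCoord_smul g p
  obtain ⟨b, hb, hb1, hb2⟩ := homCoord_smul g q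
  obtain ⟨c, hc, hc1, hc2⟩ := homCoord_smul g r
  obtain ⟨d, hd, hd1, hd2⟩ := homCoord_smul g s
  have key : ∀ {u v : RP1} {a b : ℝ},
      g 0 0 * (homCoord u).1 + g 0 1 * (homCoord u).2 = a * (homCoord (g • u)).1 →
      g 1 0 * (homCoord u).1 + g 1 1 * (homCoord u).2 = a * (homCoord (g • u)).2 →
      g 0 0 * (homCoord v).1 + g 0 1 * (homCoord v).2 = b * (homCoord (g • v)).1 →
      g 1 0 * (homCoord v).1 + g 1 1 * (homCoord v).2 = b * (homCoord (g • v)).2 →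
      (g 0 0 * g 1 1 - g 0 1 * g 1 0) * bracket u v = a * b * bracket (g • u) (g • v) := by
    intro u v a b h1 h2 h3 h4
    have e : a * b * bracket (g • u) (g • v) =
        (a * (homCoord (g • u)).1) * (b * (homCoord (g • v)).2) -
        (a * (homCoord (g • u)).2) * (b * (homCoord (g • v)).1) := by
      unfold bracket; ring
    rw [e, ← h1, ← h2, ← h3, ← h4]
    unfold bracket; ring
  have e1 := key ha1 ha2 hc1 hc2
  have e2 := key hb1 hb2 hd1 hd2
  have e3 := key ha1 ha2 hd1 hd2
  have e4 := key hb1 hb2 hc1 hc2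
  unfold crossRatio
  set D := g 0 0 * g 1 1 - g 0 1 * g 1 0 with hD
  have hk : a * b * c * d ≠ 0 := by positivity
  have hn : (a * b * c * d) * (bracket (g • p) (g • r) * bracket (g • q) (g • s)) =
      (D * D) * (bracket p r * bracket q s) := by
    linear_combination -(D * bracket q s) * e1 - (a * c * bracket (g • p) (g • r)) * e2
  have hm : (a * b * c * d) * (bracket (g • p) (g • s) * bracket (g • q) (g • r)) =
      (D * D) * (bracket p s * bracket q r) := by
    linear_combination -(D * bracket q r) * e3 - (a * d * bracket (g • p) (g • s)) * e4
  rw [← mul_div_mul_left _ _ hk, hn, hm, mul_div_mul_left _ _ (mul_ne_zero hdet hdet)]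

/-- The map sending the class of a configuration to the family of all its cross-ratios. -/
def crossRatioMap (n : ℕ) : OpenModuli n → (Quad n → RP1) :=
  Quotient.lift
    (fun x : Config n => fun q : Quad n =>
      ((crossRatio (x.1 (q 0)) (x.1 (q 1)) (x.1 (q 2)) (x.1 (q 3)) : ℝ) : RP1))
    (by
      rintro x y ⟨g, h⟩
      funext q
      simp only [h, crossRatio_smul])

/-- The compactified moduli space `M̄₀ⁿ(ℝ)`: the closure of the open moduli space in the product of
projective lines in which it is embedded by the cross-ratios of all quadruples of labels.
(This is the space of real points of the moduli space of stable `n`-pointed curves of genus zero: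
a stable curve is determined by its cross-ratios, and the smooth curves are dense.) -/
def ModuliBar (n : ℕ) : Type := closure (Set.range (crossRatioMap n))

instance (n : ℕ) : TopologicalSpace (ModuliBar n) :=
  inferInstanceAs (TopologicalSpace (closure (Set.range (crossRatioMap n))))

/-- The inclusion of the open moduli space in its compactification. -/
def OpenModuli.toBar {n : ℕ} (a : OpenModuli n) : ModuliBar n :=
  ⟨crossRatioMap n a, subset_closure ⟨a, rfl⟩⟩

/-- The value at a point of `M̄₀ⁿ(ℝ)` of the cross-ratio of four distinct labels. -/
def ModuliBar.cr {n : ℕ} (p : ModuliBar n) (q : Quad n) : RP1 := p.1 q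

/-! ### Double points, labelled polygons and the tessellation -/

/-- A point `p` of `M̄₀ⁿ(ℝ)` has a double point (node) separating the labels in `S` from the
remaining labels: both parts have at least two labels, and whenever `i, j` lie in one part and
`k, l` in the other, the cross-ratio of `i, j; k, l` has the value `1` which it takes when `i, j`
have collided relative to `k, l`. -/
def ModuliBar.HasNode {n : ℕ} (p : ModuliBar n) (S : Set (Fin n)) : Prop :=
  2 ≤ S.ncard ∧ 2 ≤ Sᶜ.ncard ∧
    ∀ q : Quad n, q 0 ∈ S → q 1 ∈ S → q 2 ∉ S → q 3 ∉ S → p.cr q = ((1 : ℝ) : RP1)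

/-- A diagonal of the `n`-gon with sides `0, …, n - 1` in cyclic order; vertex `i` is the one at
which side `i` begins and side `i - 1` ends. A diagonal joins two non-adjacent
vertices `fst < snd`. -/
structure Diagonal (n : ℕ) where
  fst : Fin n
  snd : Fin n
  gap : fst.val + 2 ≤ snd.val
  not_last : ¬ (fst.val = 0 ∧ snd.val + 1 = n)

/-- The sides of the `n`-gon on one side of a diagonal. -/
def Diagonal.sides {n : ℕ} (d : Diagonal n) : Set (Fin n) :=
  {i | d.fst ≤ i ∧ i < d.snd}

/-- Two diagonals cross (meet in the interior of the polygon). -/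
def Diagonal.Cross {n : ℕ} (d e : Diagonal n) : Prop :=
  (d.fst < e.fst ∧ e.fst < d.snd ∧ d.snd < e.snd) ∨
  (e.fst < d.fst ∧ d.fst < e.snd ∧ e.snd < d.snd)

/-- An `n`-gon with labelled sides (`label i` is the label of side `i`), marked with
`k` non-intersecting diagonals. -/
structure MarkedPolygon (n k : ℕ) where
  label : Equiv.Perm (Fin n)
  diagonals : Finset (Diagonal n)
  card_diagonals : diagonals.card = k
  noncrossing : ∀ d ∈ diagonals, ∀ e ∈ diagonals, ¬ d.Cross e

/-- The open cell of configurations whose points lie on `ℝℙ¹` in the cyclic order given by the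
labelling `σ` of the sides of a polygon (each such configuration is projectively equivalent to one
in which all points are real and increasing in that order). -/
def chamber {n : ℕ} (σ : Equiv.Perm (Fin n)) : Set (ModuliBar n) :=
  {p | ∃ x : Config n, ∃ y : Fin n → ℝ, StrictMono y ∧ (∀ i, x.1 (σ i) = ((y i : ℝ) : RP1)) ∧
    p = OpenModuli.toBar (Quotient.mk (configSetoid n) x)}

/-- The copy of the associahedron `K_{n-1}` in `M̄₀ⁿ(ℝ)` that belongs to a labelling. -/
def associahedron {n : ℕ} (σ : Equiv.Perm (Fin n)) : Set (ModuliBar n) := closure (chamber σ)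

/-- The open face of an associahedron in `M̄₀ⁿ(ℝ)` represented by a labelled polygon with marked
diagonals: the points of the associahedron whose double points are exactly those
given by the marked diagonals. -/
def MarkedPolygon.openFace {n k : ℕ} (G : MarkedPolygon n k) : Set (ModuliBar n) :=
  {p | p ∈ associahedron G.label ∧
    ∀ S : Set (Fin n), p.HasNode S ↔
      ∃ d ∈ G.diagonals, S = G.label '' d.sides ∨ S = (G.label '' d.sides)ᶜ}

/-- The (open) cells of codimension `k` of the tessellation of `M̄₀ⁿ(ℝ)` by associahedra, as subsets
of `M̄₀ⁿ(ℝ)`; faces of associahedra that coincide in `M̄₀ⁿ(ℝ)` are the same cell. -/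
def codimCells (n k : ℕ) : Set (Set (ModuliBar n)) :=
  {C | ∃ G : MarkedPolygon n k, C = G.openFace}

/-- The boundary of an open cell. -/
def cellBoundary {n : ℕ} (C : Set (ModuliBar n)) : Set (ModuliBar n) := closure C \ C

end RealModuli

end

noncomputable section

namespace RealModuli

open Hyperreal ArchimedeanClass Filter Topology

/-! Near a node separating the labels `S` from the rest, a stable curve looks like `x * y = η` with
`η → 0`. Over the reals the node opens in exactly two ways, `η > 0` and `η < 0`, and the two
resulting cyclic orders differ by the reversal of `S`. A cell of codimension `k` has `k` nodes. A
cell of codimension `k - t` with it in its boundary arises by choosing the `t` nodes to smooth and,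
for each of them, one of the two ways, which gives `2 ^ t * k.choose t`.

To make this precise, points are represented by configurations over the hyperreals whose
cross-ratios reduce to those of the point. The points of an associahedron are exactly those
represented by a configuration in its cyclic order (`exists_rep_of_mem_associahedron`,
`Agree.exists_point`). Relative to an initial segment `S` such a configuration takes a normal form
with one parameter `η` (`Agree.exists_glue`). The set `S` is a node if and only if `η` is
infinitesimal (`IsGlue.nodeX_self_iff`), and the other nodes do not depend on `η`
(`IsGlue.nodeX_of_nodeX`). Replacing `η` by a real `t → 0` smooths the node (`exists_smoothing`);
replacing it by an infinitesimal creates one (`exists_pinch`).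

The delicate point is that cells are subsets, so one face comes from many labellings. By induction
on the number of nodes, an associahedron is cut out by the weak inequalities `0 ≤ cr ≤ 1` for its
cyclic order (`mem_associahedron_of_weakAgree`). With `weakAgree_of_nodes_eq` it follows that two
faces with the same nodes coincide as soon as they share a point. Hence smoothing one node of a face
leads to exactly two faces (`exists_twist`). Iterating this over the smoothed nodes gives `2 ^ t`
(`card_facesAt`), and summing over the sets of remaining nodes gives the binomial coefficient. -/

/-! ### Infinitesimal and bounded hyperreals -/

/-- A hyperreal is negligible if it is infinitesimal. -/
def Negl (x : ℝ*) : Prop := 0 < ArchimedeanClass.mk x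

/-- A hyperreal is bounded if it is bounded by a real number. -/
def Bdd (x : ℝ*) : Prop := 0 ≤ ArchimedeanClass.mk x

theorem bdd_coe (r : ℝ) : Bdd (r : ℝ*) := archimedeanClassMk_coe_nonneg r

theorem bdd_one : Bdd (1 : ℝ*) := by simp [Bdd]

theorem negl_zero : Negl (0 : ℝ*) := by simp [Negl]

theorem Negl.bdd {x : ℝ*} (h : Negl x) : Bdd x := le_of_lt h

theorem bdd_of_abs_le {x y : ℝ*} (h : |x| ≤ |y|) (hy : Bdd y) : Bdd x :=
  le_trans hy (mk_le_mk_of_abs h)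

theorem negl_of_abs_le {x y : ℝ*} (h : |x| ≤ |y|) (hy : Negl y) : Negl x :=
  lt_of_lt_of_le hy (mk_le_mk_of_abs h)

theorem bdd_of_abs_le_coe {x : ℝ*} {C : ℝ} (h : |x| ≤ C) : Bdd x :=
  bdd_of_abs_le (h.trans (le_abs_self _)) (bdd_coe C)

theorem bdd_of_mem_Icc {x : ℝ*} (h0 : 0 ≤ x) (h1 : x ≤ 1) : Bdd x :=
  bdd_of_abs_le_coe (C := 1) (by rw [abs_of_nonneg h0]; simpa using h1)

theorem Bdd.add {x y : ℝ*} (hx : Bdd x) (hy : Bdd y) : Bdd (x + y) :=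
  le_trans (le_min hx hy) (min_le_mk_add x y)

theorem Bdd.neg {x : ℝ*} (hx : Bdd x) : Bdd (-x) := by simpa [Bdd] using hx

theorem Bdd.sub {x y : ℝ*} (hx : Bdd x) (hy : Bdd y) : Bdd (x - y) := by
  rw [sub_eq_add_neg]; exact hx.add hy.neg

theorem Bdd.mul {x y : ℝ*} (hx : Bdd x) (hy : Bdd y) : Bdd (x * y) := by
  unfold Bdd at *; rw [mk_mul]; exact add_nonneg hx hy

theorem Negl.add {x y : ℝ*} (hx : Negl x) (hy : Negl y) : Negl (x + y) :=
  lt_of_lt_of_le (lt_min hx hy) (min_le_mk_add x y)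

theorem Negl.neg {x : ℝ*} (hx : Negl x) : Negl (-x) := by simpa [Negl] using hx

theorem Negl.sub {x y : ℝ*} (hx : Negl x) (hy : Negl y) : Negl (x - y) := by
  rw [sub_eq_add_neg]; exact hx.add hy.neg

theorem Negl.mul_bdd {x y : ℝ*} (hx : Negl x) (hy : Bdd y) : Negl (x * y) := by
  unfold Bdd Negl at *; rw [mk_mul]; exact lt_of_lt_of_le hx (le_add_of_nonneg_right hy)

theorem Bdd.mul_negl {x y : ℝ*} (hx : Bdd x) (hy : Negl y) : Negl (x * y) := by
  rw [mul_comm]; exact hy.mul_bdd hx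

theorem negl_neg_iff {x : ℝ*} : Negl (-x) ↔ Negl x := by simp [Negl]

theorem negl_sub_comm {x y : ℝ*} : Negl (x - y) ↔ Negl (y - x) := by
  rw [← negl_neg_iff, neg_sub]

theorem negl_coe_iff {r : ℝ} : Negl (r : ℝ*) ↔ r = 0 := by
  constructor
  · intro h
    by_contra hr
    exact absurd h (by unfold Negl; rw [archimdeanClassMk_coe hr]; exact lt_irrefl _)
  · rintro rfl; simpa using negl_zero

theorem not_negl_one : ¬ Negl (1 : ℝ*) := by
  have := negl_coe_iff (r := 1); simpa using this

/-- `ArchimedeanClass.mk` is an additive valuation with valuation ring `Bdd` and maximal ideal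
`Negl`; the values of `x` and `x⁻¹` add up to `0`. -/
theorem negl_inv_iff {x : ℝ*} (hx : x ≠ 0) : Negl x⁻¹ ↔ ¬ Bdd x := by
  have h1 : ArchimedeanClass.mk x + ArchimedeanClass.mk x⁻¹ = 0 := by
    rw [← mk_mul, mul_inv_cancel₀ hx, mk_one]
  constructor
  · intro h hb
    have : 0 < ArchimedeanClass.mk x + ArchimedeanClass.mk x⁻¹ :=
      lt_of_lt_of_le h (le_add_of_nonneg_left hb)
    exact absurd h1 this.ne'
  · intro h
    by_contra hn
    unfold Negl Bdd at *
    have hn := not_lt.1 hn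
    have h := not_le.1 h
    have : ArchimedeanClass.mk x + ArchimedeanClass.mk x⁻¹ ≤ ArchimedeanClass.mk x + 0 := by
      gcongr
    rw [add_zero, h1] at this
    exact absurd h (not_lt.2 this)

theorem bdd_inv_iff {x : ℝ*} (hx : x ≠ 0) : Bdd x⁻¹ ↔ ¬ Negl x := by
  have := negl_inv_iff (inv_ne_zero hx)
  rw [inv_inv] at this
  rw [this, not_not]

theorem bdd_inv_of_le {x : ℝ*} {c : ℝ} (hc : 0 < c) (h : (c : ℝ*) ≤ |x|) : Bdd x⁻¹ := by
  have hc' : (0 : ℝ*) < c := by exact_mod_cast hc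
  apply bdd_of_abs_le_coe (C := c⁻¹)
  rw [abs_inv, coe_inv]
  exact inv_anti₀ hc' h

/-- For the converse: if `x` is not infinitesimal, then `x⁻¹` is bounded by some natural number `m`,
and `δ = 1 / m` fails. -/
theorem negl_iff {x : ℝ*} : Negl x ↔ ∀ δ : ℝ, 0 < δ → |x| ≤ δ := by
  constructor
  · intro h δ hδ
    by_contra hn
    have hn := (not_le.1 hn).le
    have : Negl (δ : ℝ*) := negl_of_abs_le (by
      rw [abs_of_pos (by exact_mod_cast hδ)]; exact hn) h
    exact hδ.ne' (negl_coe_iff.1 this)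
  · intro h
    by_contra hn
    by_cases hx : x = 0
    · subst hx; exact hn negl_zero
    have hb : Bdd x⁻¹ := (bdd_inv_iff hx).2 hn
    obtain ⟨m, hm⟩ := exists_nat_gt_of_mk_nonneg (x := |x⁻¹|) (by rw [mk_abs]; exact hb)
    have hm0 : (0 : ℝ*) < m := lt_of_le_of_lt (abs_nonneg _) hm
    have hm0' : 0 < m := by exact_mod_cast hm0
    have := h ((m : ℝ)⁻¹) (by positivity)
    rw [abs_inv, inv_lt_comm₀ (abs_pos.2 hx) hm0] at hm
    rw [coe_inv] at this
    have e : ((m : ℝ) : ℝ*) = (m : ℝ*) := rfl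
    rw [e] at this
    exact absurd this (not_le.2 hm)

theorem bdd_iff {x : ℝ*} : Bdd x ↔ ∃ C : ℝ, |x| ≤ C := by
  constructor
  · intro h
    obtain ⟨m, hm⟩ := exists_nat_gt_of_mk_nonneg (x := |x|) (by rw [mk_abs]; exact h)
    exact ⟨m, hm.le⟩
  · rintro ⟨C, h⟩; exact bdd_of_abs_le_coe h

theorem Bdd.exists_st {x : ℝ*} (h : Bdd x) : ∃ r : ℝ, Negl (x - r) :=
  ⟨stdPart x, mk_sub_stdPart_pos coeRingHom h⟩

theorem eq_of_negl_sub {x : ℝ*} {r s : ℝ} (hr : Negl (x - r)) (hs : Negl (x - s)) : r = s := by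
  have : Negl ((r - s : ℝ) : ℝ*) := by
    have := hs.sub hr
    rw [coe_sub]; convert this using 1; ring
  have := negl_coe_iff.1 this
  linarith

theorem bdd_of_negl_sub {x : ℝ*} {r : ℝ} (h : Negl (x - r)) : Bdd x := by
  have := h.bdd.add (bdd_coe r)
  simpa using this

/-- The reduction of a hyperreal to a point of the projective line. -/
def red (x : ℝ*) : RP1 := open Classical in if Bdd x then ((stdPart x : ℝ) : RP1) else OnePoint.infty

theorem red_eq_coe {x : ℝ*} {r : ℝ} : red x = (r : RP1) ↔ Negl (x - r) := by
  unfold red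
  by_cases h : Bdd x
  · rw [if_pos h]
    have h1 : Negl (x - (stdPart x : ℝ)) := mk_sub_stdPart_pos coeRingHom h
    constructor
    · intro e
      rw [OnePoint.coe_eq_coe] at e
      rwa [← e]
    · intro e
      rw [eq_of_negl_sub h1 e]
  · rw [if_neg h]
    constructor
    · intro e; exact absurd e (OnePoint.infty_ne_coe _)
    · intro e; exact absurd (bdd_of_negl_sub e) h

theorem red_eq_infty {x : ℝ*} : red x = OnePoint.infty ↔ ¬ Bdd x := by
  unfold red
  by_cases h : Bdd x
  · simp [h]
  · simp [h]

theorem red_eq_one {x : ℝ*} : red x = ((1 : ℝ) : RP1) ↔ Negl (x - 1) := by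
  rw [red_eq_coe]; simp

theorem red_eq_zero {x : ℝ*} : red x = ((0 : ℝ) : RP1) ↔ Negl x := by
  rw [red_eq_coe]; simp

/-- Two hyperreals have the same reduction as soon as one of them is bounded or infinite at the
same time as the other, with negligible difference in the bounded case. -/
theorem red_congr_mul {x m : ℝ*} (hm : Negl (m - 1)) : red (x * m) = red x := by
  have hmb : Bdd m := by simpa using hm.bdd.add bdd_one
  have hm0 : ¬ Negl m := fun h => not_negl_one (by simpa using h.sub hm)
  have hmne : m ≠ 0 := fun h => hm0 (h ▸ negl_zero)
  have hmi : Bdd m⁻¹ := (bdd_inv_iff hmne).2 hm0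
  by_cases h : Bdd x
  · obtain ⟨r, hr⟩ := h.exists_st
    rw [red_eq_coe.2 hr, red_eq_coe]
    have := hr.add (h.mul_negl hm)
    convert this using 1; ring
  · rw [red_eq_infty.2 h, red_eq_infty]
    intro h'
    apply h
    have := h'.mul hmi
    rwa [mul_assoc, mul_inv_cancel₀ hmne, mul_one] at this

/-- Positive bounded hyperreals with bounded inverse. -/
def PosUnit (x : ℝ*) : Prop := 0 < x ∧ Bdd x ∧ Bdd x⁻¹

theorem PosUnit.mul {x y : ℝ*} (hx : PosUnit x) (hy : PosUnit y) : PosUnit (x * y) :=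
  ⟨mul_pos hx.1 hy.1, hx.2.1.mul hy.2.1, by rw [mul_inv]; exact hx.2.2.mul hy.2.2⟩

theorem PosUnit.inv {x : ℝ*} (hx : PosUnit x) : PosUnit x⁻¹ :=
  ⟨inv_pos.2 hx.1, hx.2.2, by rw [inv_inv]; exact hx.2.1⟩

theorem PosUnit.div {x y : ℝ*} (hx : PosUnit x) (hy : PosUnit y) : PosUnit (x / y) := by
  rw [div_eq_mul_inv]; exact hx.mul hy.inv

theorem posUnit_one : PosUnit 1 := ⟨one_pos, bdd_one, by simpa using bdd_one⟩

/-- A hyperreal is weakly nonnegative if it is nonnegative up to an infinitesimal. -/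
def WNonneg (x : ℝ*) : Prop := 0 ≤ x ∨ Negl x

theorem WNonneg.mul_posUnit {x m : ℝ*} (hx : WNonneg x) (hm : PosUnit m) : WNonneg (x * m) := by
  rcases hx with h | h
  · exact Or.inl (mul_nonneg h hm.1.le)
  · exact Or.inr (h.mul_bdd hm.2.1)

/-- Weak nonnegativity is the part of the sign that survives reduction, so it can be read off from
the standard part. -/
theorem wNonneg_iff {x : ℝ*} {r : ℝ} (h : Negl (x - r)) : WNonneg x ↔ 0 ≤ r := by
  constructor
  · rintro (h0 | h0)
    · by_contra hr
      have hr := not_le.1 hr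
      have h2 := negl_iff.1 h (-r / 2) (by linarith)
      have h3 : x - (r : ℝ*) ≤ ((-r / 2 : ℝ) : ℝ*) := (le_abs_self _).trans h2
      have h4 : -(r : ℝ*) ≤ ((-r / 2 : ℝ) : ℝ*) := by linarith
      have h5 : -r ≤ -r / 2 := by exact_mod_cast h4
      linarith
    · have : Negl (x - (0 : ℝ)) := by simpa using h0
      exact (eq_of_negl_sub h this).ge
  · intro hr
    rcases hr.eq_or_lt with hr | hr
    · right; subst hr; simpa using h
    · left
      have h2 := negl_iff.1 h r hr
      have := (abs_le.1 h2).1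
      linarith

/-! ### Hyperreal configurations and their cross-ratios -/

/-- The determinant of two hyperreal vectors. -/
def br (p q : ℝ* × ℝ*) : ℝ* := p.1 * q.2 - p.2 * q.1

/-- A hyperreal configuration: `n` vectors of homogeneous coordinates. -/
abbrev HConf (n : ℕ) : Type := Fin n → ℝ* × ℝ*

/-- The cross-ratio of four points of a hyperreal configuration. -/
def cr {n : ℕ} (X : HConf n) (i j k l : Fin n) : ℝ* :=
  (br (X i) (X k) * br (X j) (X l)) / (br (X i) (X l) * br (X j) (X k))

/-- The points of a nondegenerate configuration are pairwise distinct. -/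
def Nondeg {n : ℕ} (X : HConf n) : Prop := ∀ i j, i ≠ j → br (X i) (X j) ≠ 0

/-- A configuration represents a point of the compactified moduli space if its cross-ratios reduce
to the cross-ratios of the point. -/
def Rep {n : ℕ} (X : HConf n) (p : ModuliBar n) : Prop :=
  Nondeg X ∧ ∀ Q : Quad n, p.cr Q = red (cr X (Q 0) (Q 1) (Q 2) (Q 3))

theorem br_self (p : ℝ* × ℝ*) : br p p = 0 := by unfold br; ring

theorem br_swap (p q : ℝ* × ℝ*) : br q p = -br p q := by unfold br; ring

theorem br_plucker (p q r s : ℝ* × ℝ*) :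
    br p r * br q s - br p s * br q r = br p q * br r s := by unfold br; ring

section

variable {n : ℕ} {X : HConf n}

theorem cr_self_left (hX : Nondeg X) {i k l : Fin n} (hk : i ≠ k) (hl : i ≠ l) :
    cr X i i k l = 1 := by
  unfold cr
  rw [mul_comm]
  exact div_self (mul_ne_zero (hX _ _ hl) (hX _ _ hk))

theorem cr_self_right (hX : Nondeg X) {i j k : Fin n} (hi : i ≠ k) (hj : j ≠ k) :
    cr X i j k k = 1 :=
  div_self (mul_ne_zero (hX _ _ hi) (hX _ _ hj))

theorem cr_ne_zero (hX : Nondeg X) {i j k l : Fin n} (hik : i ≠ k) (hil : i ≠ l) (hjk : j ≠ k)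
    (hjl : j ≠ l) : cr X i j k l ≠ 0 :=
  div_ne_zero (mul_ne_zero (hX _ _ hik) (hX _ _ hjl)) (mul_ne_zero (hX _ _ hil) (hX _ _ hjk))

theorem cr_swap_right (i j k l : Fin n) : cr X i j l k = (cr X i j k l)⁻¹ := by
  unfold cr; rw [inv_div]

theorem cr_swap_pairs (i j k l : Fin n) : cr X k l i j = cr X i j k l := by
  unfold cr
  rw [br_swap (X i) (X k), br_swap (X j) (X l), br_swap (X j) (X k), br_swap (X i) (X l)]
  ring

/-- This is the Plücker relation. It converts a bound `cr ≤ 1` into a sign condition on another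
cross-ratio. -/
theorem one_sub_cr (hX : Nondeg X) {i j k l : Fin n} (hil : i ≠ l) (hjk : j ≠ k) :
    1 - cr X i j k l = cr X i k j l := by
  unfold cr
  have h1 := hX _ _ hil
  have h2 := hX _ _ hjk
  have h := br_plucker (X i) (X j) (X k) (X l)
  rw [br_swap (X j) (X k), one_sub_div (mul_ne_zero h1 h2), mul_neg, div_neg, ← h, ← neg_div]
  congr 1; ring

theorem cr_sub_one (hX : Nondeg X) {i j k l : Fin n} (hil : i ≠ l) (hjk : j ≠ k) :
    cr X i j k l - 1 = (br (X i) (X j) * br (X k) (X l)) / (br (X i) (X l) * br (X j) (X k)) := by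
  unfold cr
  have h1 := hX _ _ hil
  have h2 := hX _ _ hjk
  rw [← br_plucker (X i) (X j) (X k) (X l), div_sub_one (mul_ne_zero h1 h2)]

/-- Projective invariance: `κ` is the determinant of a linear map and `f` rescales the vectors.
Every label occurs once in the numerator and once in the denominator, so both cancel. -/
theorem cr_eq_of_scale {Y : HConf n} {κ : ℝ*} {f : Fin n → ℝ*} (hκ : κ ≠ 0) (hf : ∀ i, f i ≠ 0)
    (h : ∀ i j, br (Y i) (Y j) = κ * f i * f j * br (X i) (X j)) (i j k l : Fin n) :
    cr Y i j k l = cr X i j k l := by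
  unfold cr
  rw [h, h, h, h, ← mul_div_mul_left (br (X i) (X k) * _) _
    (mul_ne_zero (mul_ne_zero hκ hκ) (mul_ne_zero (mul_ne_zero (hf i) (hf j))
      (mul_ne_zero (hf k) (hf l))))]
  congr 1 <;> ring

end

/-! ### Cyclic orders of hyperreal configurations -/

/-- The cross-ratios of the labels in cyclic order all satisfy `P`. -/
def CyclicProp {n : ℕ} (P : ℝ* → Prop) (X : HConf n) (σ : Equiv.Perm (Fin n)) : Prop :=
  ∀ i j k l, i < j → j < k → k < l → P (cr X (σ i) (σ j) (σ l) (σ k))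

/-- The points of the configuration occur in the cyclic order given by `σ`. -/
def Agree {n : ℕ} (X : HConf n) (σ : Equiv.Perm (Fin n)) : Prop :=
  CyclicProp (fun d => 0 < d ∧ d < 1) X σ

/-- The points of the configuration occur in the cyclic order given by `σ`, up to infinitesimal
changes of the cross-ratios. -/
def WeakAgree {n : ℕ} (X : HConf n) (σ : Equiv.Perm (Fin n)) : Prop :=
  CyclicProp (fun d => ∃ r : ℝ, 0 ≤ r ∧ r ≤ 1 ∧ Negl (d - r)) X σ

theorem Agree.weakAgree {n : ℕ} {X : HConf n} {σ : Equiv.Perm (Fin n)} (h : Agree X σ) :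
    WeakAgree X σ := by
  intro i j k l hij hjk hkl
  obtain ⟨h0, h1⟩ := h i j k l hij hjk hkl
  obtain ⟨r, hr⟩ := (bdd_of_mem_Icc h0.le h1.le).exists_st
  refine ⟨r, (wNonneg_iff hr).1 (Or.inl h0.le), ?_, hr⟩
  have : Negl (1 - cr X (σ i) (σ j) (σ l) (σ k) - ((1 - r : ℝ) : ℝ*)) := by
    rw [← negl_neg_iff, coe_sub, coe_one]; convert hr using 1; ring
  have := (wNonneg_iff this).1 (Or.inl (sub_nonneg.2 h1.le))
  linarith

theorem finRotate_lt {m : ℕ} {i j : Fin (m + 1)} (h : i < j) (hj : j ≠ Fin.last m) :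
    finRotate (m + 1) i < finRotate (m + 1) j := by
  have hi : i ≠ Fin.last m := (h.trans_le (Fin.le_last j)).ne
  rw [Fin.lt_def, coe_finRotate_of_ne_last hi, coe_finRotate_of_ne_last hj]
  have : (i : ℕ) < j := h
  omega

theorem zero_lt_finRotate {m : ℕ} {i : Fin (m + 1)} (hi : i ≠ Fin.last m) :
    0 < finRotate (m + 1) i := by
  rw [Fin.lt_def, coe_finRotate_of_ne_last hi]
  exact Nat.succ_pos _

/-- A rotation disturbs the order of a quadruple only if its largest index wraps around to `0`; this
replaces the cross-ratio `d` by `1 - d`. -/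
theorem CyclicProp.rotate {m : ℕ} {P : ℝ* → Prop} (hP : ∀ x, P x → P (1 - x)) {X : HConf (m + 1)}
    (hX : Nondeg X) {σ : Equiv.Perm (Fin (m + 1))} (h : CyclicProp P X σ) :
    CyclicProp P X (σ * finRotate (m + 1)) := by
  intro i j k l hij hjk hkl
  simp only [Equiv.Perm.mul_apply]
  have hk : k ≠ Fin.last m := (hkl.trans_le (Fin.le_last l)).ne
  have hj : j ≠ Fin.last m := (hjk.trans_le (Fin.le_last k)).ne
  have hi : i ≠ Fin.last m := (hij.trans_le (Fin.le_last j)).ne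
  by_cases hl : l = Fin.last m
  · subst hl
    rw [finRotate_last]
    have h1 := zero_lt_finRotate hi
    have h2 := finRotate_lt hij hj
    have h3 := finRotate_lt hjk hk
    have := hP _ (h _ _ _ _ h1 h2 h3)
    rw [one_sub_cr hX (fun e => (h1.trans h2).ne (σ.injective e))
      (fun e => (h2.trans h3).ne (σ.injective e)), cr_swap_pairs] at this
    exact this
  · exact h _ _ _ _ (finRotate_lt hij hj) (finRotate_lt hjk hk) (finRotate_lt hkl hl)

theorem Agree.rotate {m : ℕ} {X : HConf (m + 1)} (hX : Nondeg X) {σ : Equiv.Perm (Fin (m + 1))}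
    (h : Agree X σ) (r : ℕ) : Agree X (σ * finRotate (m + 1) ^ r) := by
  induction r with
  | zero => simpa using h
  | succ r ih =>
    rw [pow_succ, ← mul_assoc]
    exact CyclicProp.rotate (fun x hx => ⟨sub_pos.2 hx.2, by linarith [hx.1]⟩) hX ih

theorem WeakAgree.rotate {m : ℕ} {X : HConf (m + 1)} (hX : Nondeg X)
    {σ : Equiv.Perm (Fin (m + 1))}
    (h : WeakAgree X σ) (r : ℕ) : WeakAgree X (σ * finRotate (m + 1) ^ r) := by
  induction r with
  | zero => simpa using h
  | succ r ih =>
    rw [pow_succ, ← mul_assoc]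
    refine CyclicProp.rotate ?_ hX ih
    rintro x ⟨r, h0, h1, hr⟩
    refine ⟨1 - r, by linarith, by linarith, ?_⟩
    rw [← negl_neg_iff, coe_sub, coe_one]; convert hr using 1; ring

/-- A sufficient condition for the cyclic order of a configuration: after a change of signs of the
homogeneous coordinates all determinants have the same sign. -/
theorem agree_of_sign {n : ℕ} {X : HConf n} {σ : Equiv.Perm (Fin n)} (κ : ℝ*) (f : Fin n → ℝ*)
    (h : ∀ i j, i < j → 0 < κ * f i * f j * br (X (σ i)) (X (σ j))) : Nondeg X ∧ Agree X σ := by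
  have hX : Nondeg X := by
    intro i j hij
    rcases lt_or_gt_of_ne (fun e => hij (σ.symm.injective e) : σ.symm i ≠ σ.symm j) with hl | hl
    · have := h _ _ hl
      simp only [Equiv.apply_symm_apply] at this
      intro e; rw [e] at this; simp at this
    · have := h _ _ hl
      simp only [Equiv.apply_symm_apply] at this
      intro e; rw [br_swap, e] at this; simp at this
  refine ⟨hX, ?_⟩
  intro i j k l hij hjk hkl
  have hil := hij.trans (hjk.trans hkl)
  -- Multiplying numerator and denominator by the same `F` turns each of them into a product of two
  -- of the positive scaled determinants.
  have key : ∀ a b c d e f' g' h' F : ℝ*, 0 < a → 0 < b → 0 < c → 0 < d →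
      a * b = F * (e * f') → c * d = F * (g' * h') → 0 < (e * f') / (g' * h') := by
    intro a b c d e f' g' h' F ha hb hc hd h1 h2
    have hF : F ≠ 0 := by
      rintro rfl
      rw [zero_mul] at h1
      exact (mul_pos ha hb).ne' h1
    rw [← mul_div_mul_left _ _ hF, ← h1, ← h2]
    positivity
  have hne : ∀ {a b}, a < b → σ a ≠ σ b := fun hab e => hab.ne (σ.injective e)
  constructor
  · exact key _ _ _ _ _ _ _ _ (κ * κ * (f i * f j * f k * f l)) (h i l hil) (h j k hjk)
      (h i k (hij.trans hjk)) (h j l (hjk.trans hkl)) (by ring) (by ring)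
  · rw [← sub_pos, one_sub_cr hX (hne (hij.trans hjk)) (hne (hjk.trans hkl))]
    unfold cr
    rw [br_swap (X (σ k)) (X (σ l)), br_swap (X (σ j)) (X (σ l)), mul_neg, mul_neg, neg_div_neg_eq]
    exact key _ _ _ _ _ _ _ _ (κ * κ * (f i * f j * f k * f l)) (h i j hij) (h k l hkl)
      (h i k (hij.trans hjk)) (h j l (hjk.trans hkl)) (by ring) (by ring)

/-- A configuration in cyclic order `σ` has representatives with increasing finite coordinates. -/
theorem Agree.exists_strictMono {m : ℕ} {X : HConf (m + 1)} (hX : Nondeg X)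
    {σ : Equiv.Perm (Fin (m + 1))} (h : Agree X σ) :
    ∃ x : Fin (m + 1) → ℝ*, StrictMono (x ∘ σ) ∧
      ∀ i j k l, cr (fun i => (x i, 1)) i j k l = cr X i j k l := by
  rcases Nat.eq_zero_or_pos m with rfl | hm
  · refine ⟨fun _ => 0, fun i j hij => absurd hij (by omega), fun i j k l => ?_⟩
    have : ∀ a : Fin 1, a = 0 := fun a => Subsingleton.elim _ _
    rw [this i, this j, this k, this l]
    simp [cr, br_self]
  set L := σ (Fin.last m) with hL
  set M := σ 0 with hM
  have h0last : (0 : Fin (m + 1)) ≠ Fin.last m := by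
    intro e; have := congrArg Fin.val e; simp at this; omega
  have hML : br (X M) (X L) ≠ 0 := hX _ _ (fun e => h0last (σ.injective e))
  -- The affine coordinate in which the first label `M` is at `0` and the last label `L` at
  -- infinity.
  set z : Fin (m + 1) → ℝ* := fun i => br (X i) (X M) / br (X i) (X L) with hz
  have hiL : ∀ i, i ≠ L → br (X i) (X L) ≠ 0 := fun i hi => hX _ _ hi
  have hzsub : ∀ i j, i ≠ L → j ≠ L →
      z i - z j = br (X i) (X j) * br (X M) (X L) / (br (X i) (X L) * br (X j) (X L)) := by
    intro i j hi hj
    simp only [hz]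
    rw [div_sub_div _ _ (hiL i hi) (hiL j hj)]
    congr 1
    linear_combination br_plucker (X i) (X j) (X M) (X L)
  set g : Fin m → ℝ* := fun a => z (σ a.castSucc) with hg
  have hcs : ∀ a : Fin m, σ a.castSucc ≠ L := fun a e =>
    (Fin.castSucc_lt_last a).ne (σ.injective e)
  have hginj : Function.Injective g := by
    intro a b hab
    by_contra hne
    have h1 : g a - g b = 0 := sub_eq_zero.2 hab
    rw [hg] at h1
    simp only at h1
    rw [hzsub _ _ (hcs a) (hcs b)] at h1
    refine div_ne_zero (mul_ne_zero (hX _ _ ?_) hML)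
      (mul_ne_zero (hiL _ (hcs a)) (hiL _ (hcs b))) h1
    intro e
    exact hne (Fin.castSucc_injective _ (σ.injective e))
  have hbtw : ∀ a b c : Fin m, a < b → b < c →
      0 < (g b - g c) / (g a - g c) ∧ (g b - g c) / (g a - g c) < 1 := by
    intro a b c hab hbc
    have := h a.castSucc b.castSucc c.castSucc (Fin.last m) hab hbc (Fin.castSucc_lt_last c)
    have e : cr X (σ a.castSucc) (σ b.castSucc) (σ (Fin.last m)) (σ c.castSucc) =
        (g b - g c) / (g a - g c) := by
      rw [hg]
      simp only
      rw [hzsub _ _ (hcs b) (hcs c), hzsub _ _ (hcs a) (hcs c)]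
      have h1 := hiL _ (hcs a)
      have h2 := hiL _ (hcs b)
      have h3 := hiL _ (hcs c)
      have h4 : br (X (σ a.castSucc)) (X (σ c.castSucc)) ≠ 0 := by
        apply hX
        intro e
        exact (hab.trans hbc).ne (Fin.castSucc_injective _ (σ.injective e))
      unfold cr
      rw [← hL]
      field_simp
    rw [e] at this
    exact this
  -- With `L` at infinity the cyclic condition says that the middle of three labels lies between the
  -- other two. So `g` is monotone or antitone, and the sign `s = ±1` makes it increasing.
  obtain ⟨s, hs, hsg⟩ : ∃ s : ℝ*, s ≠ 0 ∧ StrictMono (fun a => s * g a) := by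
    have hma : Monotone g ∨ Antitone g := by
      by_contra hcon
      rw [not_or] at hcon
      obtain ⟨a, b, c, hab, hbc, hh⟩ := not_monotone_not_antitone_iff_exists_lt_lt.1 hcon
      obtain ⟨h0, h1⟩ := hbtw a b c hab hbc
      rcases hh with ⟨h2, h3⟩ | ⟨h2, h3⟩
      · have h4 : 0 < g a - g c := by
          by_contra hn
          exact absurd h0 (not_lt.2 (div_nonpos_of_nonneg_of_nonpos (by linarith) (not_lt.1 hn)))
        rw [div_lt_one h4] at h1
        linarith
      · have h4 : g a - g c < 0 := by
          by_contra hn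
          exact absurd h0 (not_lt.2 (div_nonpos_of_nonpos_of_nonneg (by linarith) (not_lt.1 hn)))
        rw [div_lt_one_of_neg h4] at h1
        linarith
    rcases hma with hma | hma
    · exact ⟨1, one_ne_zero, by simpa using hma.strictMono_of_injective hginj⟩
    · refine ⟨-1, by norm_num, ?_⟩
      have := (hma.strictAnti_of_injective hginj)
      intro a b hab
      have := this hab
      simp only
      linarith
  have hs0 : ∀ a, 0 ≤ s * g a := by
    intro a
    have e : g ⟨0, hm⟩ = 0 := by
      rw [hg]
      have : (Fin.castSucc ⟨0, hm⟩ : Fin (m + 1)) = 0 := rfl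
      simp [this, hz, ← hM, br_self]
    have := hsg.monotone (show (⟨0, hm⟩ : Fin m) ≤ a from Nat.zero_le _)
    simp only [e, mul_zero] at this
    exact this
  -- The final coordinate is `-1 / (s * z + 1)`: it is increasing where `s * z ≥ 0`, and it moves
  -- `L` from infinity to the largest value `0`.
  set den : Fin (m + 1) → ℝ* := fun i => s * br (X i) (X M) + br (X i) (X L) with hden
  have hdenc : ∀ a, den (σ (Fin.castSucc a)) =
      br (X (σ (Fin.castSucc a))) (X L) * (s * g a + 1) := by
    intro a
    have := hiL _ (hcs a)
    simp only [hden, hg, hz]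
    field_simp
  have hdenL : den L ≠ 0 := by
    simp only [hden, br_self, add_zero]
    rw [br_swap]
    exact mul_ne_zero hs (neg_ne_zero.2 hML)
  have hden0 : ∀ i, den i ≠ 0 := by
    intro i
    obtain ⟨a, rfl⟩ := σ.surjective i
    induction a using Fin.lastCases with
    | last => exact hdenL
    | cast a =>
      rw [hdenc]
      exact mul_ne_zero (hiL _ (hcs a)) (by have := hs0 a; positivity)
  refine ⟨fun i => -br (X i) (X L) / den i, ?_, ?_⟩
  · have hxa : ∀ a, -br (X (σ (Fin.castSucc a))) (X L) / den (σ (Fin.castSucc a)) =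
        -(s * g a + 1)⁻¹ := by
      intro a
      have h1 := hiL _ (hcs a)
      have h2 : s * g a + 1 ≠ 0 := by have := hs0 a; positivity
      rw [hdenc]
      field_simp
    intro a b hab
    simp only [Function.comp]
    induction a using Fin.lastCases with
    | last => exact absurd hab (not_lt.2 (Fin.le_last b))
    | cast a =>
      rw [hxa]
      have h2 := hs0 a
      induction b using Fin.lastCases with
      | last =>
        rw [← hL, br_self, neg_zero, zero_div]
        have : 0 < (s * g a + 1)⁻¹ := by positivity
        linarith
      | cast b =>
        rw [hxa]
        have h3 : s * g a < s * g b := hsg (by simpa using hab)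
        have : (s * g b + 1)⁻¹ < (s * g a + 1)⁻¹ := inv_strictAnti₀ (by positivity) (by linarith)
        linarith
  · apply cr_eq_of_scale (κ := s * br (X M) (X L)) (f := fun i => (den i)⁻¹)
      (mul_ne_zero hs hML) (fun i => inv_ne_zero (hden0 i))
    intro i j
    have h1 := hden0 i
    have h2 := hden0 j
    have h3 := br_plucker (X i) (X j) (X M) (X L)
    have e : br ((fun i => (-br (X i) (X L) / den i, (1 : ℝ*))) i)
        ((fun i => (-br (X i) (X L) / den i, (1 : ℝ*))) j) =
        -br (X i) (X L) / den i - -br (X j) (X L) / den j := by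
      simp [br]
    rw [e]
    field_simp
    simp only [hden]
    linear_combination s * h3

/-! ### Reductions as limits -/

theorem abs_le_of_negl_sub {x : ℝ*} {r C : ℝ} (h : Negl (x - r)) (hC : |x| ≤ C) : |r| ≤ C := by
  refine le_of_forall_pos_le_add fun δ hδ => ?_
  have h1 := negl_iff.1 h δ hδ
  have h2 : |(r : ℝ*)| ≤ |x| + |x - r| := by
    have := abs_sub_abs_le_abs_sub (r : ℝ*) x
    rw [abs_sub_comm] at this
    linarith
  have h3 : ((|r| : ℝ) : ℝ*) ≤ ((C + δ : ℝ) : ℝ*) := by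
    rw [coe_abs, coe_add]
    linarith
  exact_mod_cast h3

/-- If `|c| ≤ C`, the factor `μ t` moves the standard part by at most `C * δ t`. If `c` is
unbounded, so is `c * μ t` once `|μ t| ≥ 1 / 2`, and the reduction is constantly infinite. -/
theorem tendsto_red_mul {ι : Type*} {l : Filter ι} {c : ℝ*} {μ : ι → ℝ*} {δ : ι → ℝ}
    (hδ : Tendsto δ l (𝓝 0)) (h : ∀ᶠ t in l, |μ t - 1| ≤ δ t) :
    Tendsto (fun t => red (c * μ t)) l (𝓝 (red c)) := by
  by_cases hc : Bdd c
  · obtain ⟨r, hr⟩ := hc.exists_st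
    obtain ⟨C, hC⟩ := bdd_iff.1 hc
    have hC0 : (0 : ℝ*) ≤ C := (abs_nonneg _).trans hC
    have key : ∀ᶠ t in l, ∃ s : ℝ, red (c * μ t) = (s : RP1) ∧ |s - r| ≤ C * δ t := by
      filter_upwards [h] with t ht
      have hb : Bdd (c * μ t) := by
        have : Bdd (μ t - 1) := bdd_of_abs_le_coe ht
        have := hc.mul (this.add bdd_one)
        simpa using this
      obtain ⟨s, hs⟩ := hb.exists_st
      refine ⟨s, red_eq_coe.2 hs, ?_⟩
      have h1 : Negl (c * (μ t - 1) - ((s - r : ℝ) : ℝ*)) := by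
        rw [coe_sub]
        convert hs.sub hr using 1; ring
      refine abs_le_of_negl_sub h1 ?_
      rw [abs_mul, coe_mul]
      exact mul_le_mul hC ht (abs_nonneg _) hC0
    rw [red_eq_coe.2 hr]
    have hs : ∃ s : ι → ℝ, ∀ᶠ t in l, red (c * μ t) = (s t : RP1) ∧ |s t - r| ≤ C * δ t := by
      classical
      -- The default `0` occurs only outside the eventual set and does not affect the limit.
      refine ⟨fun t => if h : ∃ s : ℝ, red (c * μ t) = (s : RP1) ∧ |s - r| ≤ C * δ t
        then h.choose else 0, ?_⟩
      filter_upwards [key] with t ht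
      rw [dif_pos ht]
      exact ht.choose_spec
    obtain ⟨s, hs⟩ := hs
    have ht : Tendsto s l (𝓝 r) := by
      rw [tendsto_iff_norm_sub_tendsto_zero]
      refine squeeze_zero' (Eventually.of_forall fun t => norm_nonneg _)
        (hs.mono fun t ht => ht.2) ?_
      simpa using hδ.const_mul C
    have := (OnePoint.continuous_coe.tendsto r).comp ht
    exact this.congr' (hs.mono fun t ht => ht.1.symm)
  · rw [red_eq_infty.2 hc]
    refine tendsto_const_nhds.congr' ?_
    have h2 : ∀ᶠ t in l, δ t < 1 / 2 := hδ.eventually (gt_mem_nhds (by norm_num))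
    filter_upwards [h, h2] with t ht ht2
    symm
    rw [red_eq_infty]
    intro hb
    apply hc
    have hle : ((1 / 2 : ℝ) : ℝ*) ≤ |μ t| := by
      have h3 : |μ t - 1| ≤ ((1 / 2 : ℝ) : ℝ*) := ht.trans (by exact_mod_cast ht2.le)
      have h4 := (abs_le.1 h3).1
      have h5 := le_abs_self (μ t)
      have h6 : ((1 / 2 : ℝ) : ℝ*) + ((1 / 2 : ℝ) : ℝ*) = 1 := by
        rw [← coe_add, ← coe_one]; norm_num
      linarith
    have hi := bdd_inv_of_le (by norm_num) hle
    have hne : μ t ≠ 0 := by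
      intro e
      rw [e, abs_zero] at hle
      have : (1 / 2 : ℝ) ≤ 0 := by exact_mod_cast hle
      norm_num at this
    have := hb.mul hi
    rwa [mul_assoc, mul_inv_cancel₀ hne, mul_one] at this

theorem tendsto_red_zero {ι : Type*} {l : Filter ι} {c : ι → ℝ*} {δ : ι → ℝ}
    (hδ : Tendsto δ l (𝓝 0)) (h : ∀ᶠ t in l, |c t| ≤ δ t) :
    Tendsto (fun t => red (c t)) l (𝓝 ((0 : ℝ) : RP1)) := by
  have h1 : ∀ᶠ t in l, red (c t) = ((stdPart (c t) : ℝ) : RP1) ∧ |stdPart (c t)| ≤ δ t := by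
    filter_upwards [h] with t ht
    have hb : Bdd (c t) := bdd_of_abs_le_coe ht
    have : Negl (c t - (stdPart (c t) : ℝ)) := mk_sub_stdPart_pos coeRingHom hb
    exact ⟨red_eq_coe.2 this, abs_le_of_negl_sub this ht⟩
  have ht : Tendsto (fun t => stdPart (c t)) l (𝓝 0) :=
    squeeze_zero_norm' (h1.mono fun t ht => ht.2) hδ
  exact ((OnePoint.continuous_coe.tendsto (0 : ℝ)).comp ht).congr' (h1.mono fun t ht => ht.1.symm)

theorem tendsto_red_infty {ι : Type*} {l : Filter ι} {c : ι → ℝ*} {δ : ι → ℝ}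
    (hδ : Tendsto δ l (𝓝 0)) (h : ∀ᶠ t in l, c t ≠ 0 ∧ |(c t)⁻¹| ≤ δ t) :
    Tendsto (fun t => red (c t)) l (𝓝 OnePoint.infty) := by
  rw [OnePoint.hasBasis_nhds_infty.tendsto_right_iff]
  rintro s ⟨-, hs⟩
  obtain ⟨R, hR⟩ := hs.isBounded.exists_norm_le
  have hpos : (0 : ℝ) < (max R 0 + 1)⁻¹ := by positivity
  filter_upwards [h, hδ.eventually (gt_mem_nhds hpos)] with t ht ht2
  by_cases hb : Bdd (c t)
  · left
    obtain ⟨r, hr⟩ := hb.exists_st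
    refine ⟨r, ?_, (red_eq_coe.2 hr).symm⟩
    intro hrs
    have h1 := hR r hrs
    rw [Real.norm_eq_abs] at h1
    have h2 := negl_iff.1 hr 1 one_pos
    have h3 : |c t| ≤ ((max R 0 + 1 : ℝ) : ℝ*) := by
      have h4 : |c t| ≤ |c t - r| + |(r : ℝ*)| := by
        have := abs_add_le (c t - r) (r : ℝ*)
        simpa using this
      have h5 : |(r : ℝ*)| ≤ ((max R 0 : ℝ) : ℝ*) := by
        rw [← coe_abs]
        exact_mod_cast h1.trans (le_max_left _ _)
      rw [coe_add]
      linarith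
    have h6 : (((max R 0 + 1)⁻¹ : ℝ) : ℝ*) ≤ |(c t)⁻¹| := by
      rw [abs_inv, coe_inv]
      exact inv_anti₀ (abs_pos.2 ht.1) h3
    have h7 : (((max R 0 + 1)⁻¹ : ℝ) : ℝ*) ≤ δ t := h6.trans ht.2
    exact absurd (coe_le_coe.1 h7) (not_le.2 ht2)
  · right
    exact red_eq_infty.2 hb

/-- The bridge from hyperreals to topology: reducing a germ is taking the limit in the compact line
along the ultrafilter. If `C ≤ |f a|` does not hold eventually, the ultrafilter property gives `|f
a| < C` eventually, and the germ is bounded. -/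
theorem tendsto_red_ofSeq (f : ℕ → ℝ) :
    Tendsto (fun a => (f a : RP1)) (hyperfilter ℕ) (𝓝 (red (ofSeq f))) := by
  by_cases h : Bdd (ofSeq f)
  · obtain ⟨r, hr⟩ := h.exists_st
    rw [red_eq_coe.2 hr]
    refine (OnePoint.continuous_coe.tendsto r).comp ?_
    rw [Metric.tendsto_nhds]
    intro δ hδ
    have h1 := negl_iff.1 hr (δ / 2) (by linarith)
    rw [abs_le] at h1
    have h2 : ofSeq (fun _ => -(δ / 2) + r) ≤ ofSeq f := by
      have e : ofSeq (fun _ => -(δ / 2) + r) = ((-(δ / 2) + r : ℝ) : ℝ*) := rfl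
      rw [e, coe_add, coe_neg]
      linarith
    have h3 : ofSeq f ≤ ofSeq (fun _ => δ / 2 + r) := by
      have e : ofSeq (fun _ => δ / 2 + r) = ((δ / 2 + r : ℝ) : ℝ*) := rfl
      rw [e, coe_add]
      linarith
    filter_upwards [ofSeq_le_ofSeq.1 h2, ofSeq_le_ofSeq.1 h3] with a ha hb
    rw [Real.dist_eq, abs_lt]
    constructor <;> linarith
  · rw [red_eq_infty.2 h]
    refine OnePoint.tendsto_coe_infty.comp ?_
    rw [coclosedCompact_eq_cocompact, cocompact_eq_atBot_atTop, ← comap_abs_atTop,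
      tendsto_comap_iff, tendsto_atTop]
    intro C
    by_contra hcon
    rw [Filter.not_eventually] at hcon
    have h1 : ∀ᶠ a in (hyperfilter ℕ : Filter ℕ), ¬ C ≤ |f a| :=
      Ultrafilter.frequently_iff_eventually.1 hcon
    apply h
    apply bdd_of_abs_le_coe (C := C)
    rw [abs_le]
    have e1 : (C : ℝ*) = ofSeq (fun _ => C) := rfl
    have e2 : -(C : ℝ*) = ofSeq (fun _ => -C) := rfl
    rw [e2, e1, ofSeq_le_ofSeq, ofSeq_le_ofSeq]
    constructor <;> filter_upwards [h1] with a ha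
    · have := (abs_lt.1 (not_le.1 ha)).1
      linarith
    · have := (abs_lt.1 (not_le.1 ha)).2
      linarith

theorem red_eq_of_tendsto {f : ℕ → ℝ} {c : RP1}
    (h : Tendsto (fun a => (f a : RP1)) (hyperfilter ℕ) (𝓝 c)) : c = red (ofSeq f) :=
  tendsto_nhds_unique h (tendsto_red_ofSeq f)

/-- First countability makes closure points limits of sequences, whose germs are hyperreal
configurations. The projective line inherits it from the circle. -/
instance : FirstCountableTopology (OnePoint ℝ) :=
  (onePointEquivSphereOfFinrankEq (ι := Fin 2) (V := ℝ)
    (by simp)).isInducing.firstCountableTopology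

instance (n : ℕ) : FirstCountableTopology (ModuliBar n) :=
  inferInstanceAs (FirstCountableTopology (closure (Set.range (crossRatioMap n))))

theorem ModuliBar.ext_cr {n : ℕ} {p q : ModuliBar n} (h : ∀ Q, p.cr Q = q.cr Q) : p = q :=
  Subtype.ext (funext h)

theorem Rep.unique {n : ℕ} {X : HConf n} {p q : ModuliBar n} (hp : Rep X p) (hq : Rep X q) :
    p = q := ModuliBar.ext_cr fun Q => (hp.2 Q).trans (hq.2 Q).symm

theorem tendsto_moduliBar {n : ℕ} {ι : Type*} {l : Filter ι} {p : ι → ModuliBar n}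
    {q : ModuliBar n} : Tendsto p l (𝓝 q) ↔ ∀ Q, Tendsto (fun t => (p t).cr Q) l (𝓝 (q.cr Q)) := by
  have : Tendsto p l (𝓝 q) ↔ Tendsto (fun t => (p t).1) l (𝓝 q.1) := tendsto_subtype_rng
  rw [this, tendsto_pi_nhds]
  rfl

/-! ### Associahedra in terms of hyperreal configurations -/

/-- The real cross-ratio of four real numbers. -/
def rcr (a b c d : ℝ) : ℝ := ((a - c) * (b - d)) / ((a - d) * (b - c))

theorem crossRatio_coe (a b c d : ℝ) :
    crossRatio (a : RP1) (b : RP1) (c : RP1) (d : RP1) = rcr a b c d := by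
  simp [crossRatio, bracket, homCoord, rcr]

theorem cr_ofSeq {n : ℕ} (f : Fin n → ℕ → ℝ) (i j k l : Fin n) :
    cr (fun i => (ofSeq (f i), 1)) i j k l =
      ofSeq (fun a => rcr (f i a) (f j a) (f k a) (f l a)) := by
  have h : ∀ i j, br (ofSeq (f i), 1) (ofSeq (f j), 1) = ofSeq (f i) - ofSeq (f j) := by
    intro i j; simp [br]
  unfold cr
  rw [h, h, h, h]
  rfl

/-- The representative is the germ of a sequence of ordered real configurations converging to `p`.
-/
theorem exists_rep_of_mem_associahedron {n : ℕ} {σ : Equiv.Perm (Fin n)} {p : ModuliBar n}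
    (hp : p ∈ associahedron σ) : ∃ X : HConf n, Rep X p ∧ Agree X σ := by
  obtain ⟨q, hq, hlim⟩ := mem_closure_iff_seq_limit.1 hp
  choose x y hy hxy hqx using hq
  have hsig : Nondeg (fun i => (ofSeq (fun a => y a (σ.symm i)), (1 : ℝ*))) ∧
      Agree (fun i => (ofSeq (fun a => y a (σ.symm i)), (1 : ℝ*))) σ := by
    apply agree_of_sign (-1) (fun _ => 1)
    intro i j hij
    have : ofSeq (fun a => y a i) < ofSeq (fun a => y a j) :=
      ofSeq_lt_ofSeq.2 (Eventually.of_forall fun a => hy a hij)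
    simp only [br, Equiv.symm_apply_apply]
    linarith
  refine ⟨_, ⟨hsig.1, fun Q => ?_⟩, hsig.2⟩
  rw [cr_ofSeq]
  apply red_eq_of_tendsto
  have h1 := (tendsto_moduliBar.1 hlim Q).mono_left Nat.hyperfilter_le_atTop
  refine h1.congr fun a => ?_
  have h2 : ∀ i, (x a).1 i = (y a (σ.symm i) : RP1) := by
    intro i; rw [← hxy, Equiv.apply_symm_apply]
  rw [hqx]
  change ((crossRatio _ _ _ _ : ℝ) : RP1) = _
  rw [h2, h2, h2, h2, crossRatio_coe]

/-- With increasing finite coordinates, `X` is the germ of real configurations that are in order `σ`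
for almost all indices; their cross-ratios converge along the ultrafilter to the reductions. -/
theorem Agree.exists_point {m : ℕ} {X : HConf (m + 1)} {σ : Equiv.Perm (Fin (m + 1))}
    (hX : Nondeg X) (h : Agree X σ) : ∃ p ∈ associahedron σ, Rep X p := by
  obtain ⟨x, hx, hcr⟩ := h.exists_strictMono hX
  choose f hf using fun i => ofSeq_surjective (x i)
  have hmono : ∀ᶠ a in (hyperfilter ℕ : Filter ℕ), StrictMono fun i => f (σ i) a := by
    have : ∀ᶠ a in (hyperfilter ℕ : Filter ℕ), ∀ i j, i < j → f (σ i) a < f (σ j) a := by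
      rw [eventually_all]; intro i
      rw [eventually_all]; intro j
      by_cases hij : i < j
      · have := hx hij
        simp only [Function.comp, ← hf] at this
        filter_upwards [ofSeq_lt_ofSeq.1 this] with a ha
        exact fun _ => ha
      · exact Eventually.of_forall fun a h => absurd h hij
    filter_upwards [this] with a ha
    exact fun i j hij => ha i j hij
  have hcr' : ∀ i j k l, cr X i j k l =
      ofSeq (fun a => rcr (f i a) (f j a) (f k a) (f l a)) := by
    intro i j k l
    rw [← cr_ofSeq, ← hcr]
    simp only [hf]
  set v : Quad (m + 1) → RP1 := fun Q => red (cr X (Q 0) (Q 1) (Q 2) (Q 3)) with hv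
  set w : ℕ → Quad (m + 1) → RP1 :=
    fun a Q => (rcr (f (Q 0) a) (f (Q 1) a) (f (Q 2) a) (f (Q 3) a) : RP1) with hw
  have hlim : Tendsto w (hyperfilter ℕ) (𝓝 v) := by
    rw [tendsto_pi_nhds]
    intro Q
    simp only [hv, hcr']
    exact tendsto_red_ofSeq _
  have hmem : ∀ᶠ a in (hyperfilter ℕ : Filter ℕ),
      w a ∈ (Subtype.val : closure (Set.range (crossRatioMap (m + 1))) → _) '' chamber σ := by
    filter_upwards [hmono] with a ha
    have hinj : Function.Injective fun i => ((f i a : ℝ) : RP1) := by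
      intro i j hij
      have h1 : f i a = f j a := OnePoint.coe_injective hij
      have h2 := ha.injective (a₁ := σ.symm i) (a₂ := σ.symm j) (by simpa using h1)
      exact σ.symm.injective h2
    refine ⟨OpenModuli.toBar (Quotient.mk (configSetoid (m + 1)) ⟨_, hinj⟩),
      ⟨⟨_, hinj⟩, fun i => f (σ i) a, ha, fun i => rfl, rfl⟩, ?_⟩
    funext Q
    change ((crossRatio _ _ _ _ : ℝ) : RP1) = _
    rw [crossRatio_coe]
  have hcl := mem_closure_of_tendsto hlim hmem
  have hv' : v ∈ closure (Set.range (crossRatioMap (m + 1))) := by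
    refine closure_minimal ?_ isClosed_closure hcl
    rintro _ ⟨p, -, rfl⟩
    exact p.2
  refine ⟨⟨v, hv'⟩, ?_, hX, fun Q => rfl⟩
  exact closure_subtype.2 hcl

/-! ### Double points in terms of hyperreal configurations -/

/-- Hyperreals infinitely close to `1`. -/
def NearOne (x : ℝ*) : Prop := Negl (x - 1)

theorem nearOne_one : NearOne 1 := by simpa [NearOne] using negl_zero

theorem NearOne.bdd {x : ℝ*} (h : NearOne x) : Bdd x := by
  simpa using Negl.bdd h |>.add bdd_one

theorem NearOne.not_negl {x : ℝ*} (h : NearOne x) : ¬ Negl x := fun h' =>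
  not_negl_one (by simpa using h'.sub h)

theorem NearOne.ne_zero {x : ℝ*} (h : NearOne x) : x ≠ 0 := fun e =>
  h.not_negl (e ▸ negl_zero)

theorem NearOne.mul {x y : ℝ*} (hx : NearOne x) (hy : NearOne y) : NearOne (x * y) := by
  have := (Negl.mul_bdd hx hy.bdd).add hy
  unfold NearOne
  convert this using 1; ring

theorem NearOne.inv {x : ℝ*} (hx : NearOne x) : NearOne x⁻¹ := by
  have := (Negl.mul_bdd hx ((bdd_inv_iff hx.ne_zero).2 hx.not_negl)).neg
  unfold NearOne
  convert this using 1
  rw [sub_mul, mul_inv_cancel₀ hx.ne_zero]; ring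

theorem NearOne.div {x y : ℝ*} (hx : NearOne x) (hy : NearOne y) : NearOne (x / y) := by
  rw [div_eq_mul_inv]; exact hx.mul hy.inv

theorem nearOne_one_sub {x : ℝ*} (hx : Negl x) : NearOne (1 - x) := by
  unfold NearOne; convert hx.neg using 1; ring

theorem negl_one_sub {x : ℝ*} (hx : NearOne x) : Negl (1 - x) := by
  rw [negl_sub_comm]; exact hx

/-- A hyperreal configuration has a node separating `S` from its complement. -/
def NodeX {n : ℕ} (X : HConf n) (S : Set (Fin n)) : Prop :=
  2 ≤ S.ncard ∧ 2 ≤ Sᶜ.ncard ∧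
    ∀ i ∈ S, ∀ j ∈ S, ∀ k, k ∉ S → ∀ l, l ∉ S → NearOne (cr X i j k l)

theorem exists_quad {n : ℕ} {i j k l : Fin n} (hij : i ≠ j) (hik : i ≠ k) (hil : i ≠ l)
    (hjk : j ≠ k) (hjl : j ≠ l) (hkl : k ≠ l) :
    ∃ Q : Quad n, Q 0 = i ∧ Q 1 = j ∧ Q 2 = k ∧ Q 3 = l := by
  refine ⟨⟨![i, j, k, l], ?_⟩, rfl, rfl, rfl, rfl⟩
  intro a b hab
  fin_cases a <;> fin_cases b <;> simp_all

theorem Rep.hasNode_iff {n : ℕ} {X : HConf n} {p : ModuliBar n} (h : Rep X p) (S : Set (Fin n)) :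
    p.HasNode S ↔ NodeX X S := by
  unfold ModuliBar.HasNode NodeX
  refine and_congr_right fun _ => and_congr_right fun _ => ?_
  constructor
  · intro H i hi j hj k hk l hl
    have hne : ∀ {a b}, a ∈ S → b ∉ S → a ≠ b := fun ha hb e => hb (e ▸ ha)
    by_cases hij : i = j
    · subst hij
      rw [cr_self_left h.1 (hne hi hk) (hne hi hl)]; exact nearOne_one
    by_cases hkl : k = l
    · subst hkl
      rw [cr_self_right h.1 (hne hi hk) (hne hj hk)]; exact nearOne_one
    obtain ⟨Q, rfl, rfl, rfl, rfl⟩ := exists_quad hij (hne hi hk) (hne hi hl) (hne hj hk)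
      (hne hj hl) hkl
    have := H Q hi hj hk hl
    rwa [h.2, red_eq_one] at this
  · intro H Q h0 h1 h2 h3
    rw [h.2, red_eq_one]
    exact H _ h0 _ h1 _ h2 _ h3

theorem NodeX.compl {n : ℕ} {X : HConf n} {S : Set (Fin n)} (h : NodeX X S) : NodeX X Sᶜ := by
  refine ⟨h.2.1, by rw [compl_compl]; exact h.1, ?_⟩
  intro i hi j hj k hk l hl
  rw [← cr_swap_pairs]
  exact h.2.2 _ (not_not.1 hk) _ (not_not.1 hl) _ hi _ hj

theorem two_le_ncard_of_ne {α : Type*} [Finite α] {S : Set α} {a b : α} (ha : a ∈ S) (hb : b ∈ S)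
    (hab : a ≠ b) : 2 ≤ S.ncard := by
  rw [← Set.ncard_pair hab]
  exact Set.ncard_le_ncard (by intro x hx; rcases hx with rfl | rfl <;> assumption) (Set.toFinite _)

/-- A single degenerate cross-ratio forces a node. In the coordinate `cr X x j i l` of `x`, which
places `i`, `j`, `l` at `0`, `1`, infinity, the label `k` is infinitely large. The node separates
the labels with bounded coordinate from those with unbounded coordinate. -/
theorem exists_nodeX {n : ℕ} {X : HConf n} (hX : Nondeg X) {i j k l : Fin n} (hij : i ≠ j)
    (hik : i ≠ k) (hil : i ≠ l) (hjk : j ≠ k) (hjl : j ≠ l) (hkl : k ≠ l)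
    (h : NearOne (cr X i j k l)) : ∃ T, NodeX X T ∧ i ∈ T ∧ j ∈ T ∧ k ∉ T ∧ l ∉ T := by
  set T : Set (Fin n) := {x | x = i ∨ (x ≠ l ∧ Bdd (cr X x j i l))} with hT
  have hi : i ∈ T := Or.inl rfl
  have hj : j ∈ T := Or.inr ⟨hjl, by rw [cr_self_left hX hij.symm hjl]; exact bdd_one⟩
  have hl : l ∉ T := by
    rintro (e | ⟨e, -⟩)
    · exact hil e.symm
    · exact e rfl
  have hk : k ∉ T := by
    rintro (e | ⟨-, e⟩)
    · exact hik e.symm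
    · have h1 : cr X k j i l * cr X i k j l = -cr X i j k l := by
        have h1 := hX _ _ hil
        have h2 := hX _ _ hjk
        have h3 := hX _ _ hkl
        have h4 := hX _ _ hij
        unfold cr
        rw [br_swap (X i) (X k), br_swap (X i) (X j), br_swap (X j) (X k)]
        field_simp
      have h2 : Negl (cr X k j i l * cr X i k j l) := by
        apply e.mul_negl
        rw [← one_sub_cr hX hil hjk]
        exact negl_one_sub h
      rw [h1, negl_neg_iff] at h2
      exact h.not_negl h2
  have hxl : ∀ x ∈ T, x ≠ l := fun x hx e => hl (e ▸ hx)
  have hzi : ∀ z, z ∉ T → z ≠ i := fun z hz e => hz (e ▸ hi)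
  -- Away from the degenerate cases this is the coordinate of `x` divided by that of `z`, bounded
  -- over unbounded.
  have key : ∀ x ∈ T, ∀ z, z ∉ T → Negl (cr X x z i l) := by
    intro x hx z hz
    rcases hx with rfl | ⟨hx, hxb⟩
    · have : cr X x z x l = 0 := by simp [cr, br_self]
      rw [this]; exact negl_zero
    by_cases hzl : z = l
    · subst hzl
      have : cr X x z i z = 0 := by simp [cr, br_self]
      rw [this]; exact negl_zero
    have hzb : ¬ Bdd (cr X z j i l) := fun hb => hz (Or.inr ⟨hzl, hb⟩)
    have hz0 : cr X z j i l ≠ 0 := fun e => hzb (e ▸ negl_zero.bdd)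
    have e : cr X x z i l = cr X x j i l * (cr X z j i l)⁻¹ := by
      have h1 := hX _ _ hzl
      have h2 := hX _ _ (hzi z hz)
      have h3 := hX _ _ hjl
      have h4 := hX _ _ hij.symm
      have h5 := hX _ _ hx
      unfold cr
      field_simp
    rw [e]
    exact hxb.mul_negl ((negl_inv_iff hz0).2 hzb)
  refine ⟨T, ⟨two_le_ncard_of_ne hi hj hij, two_le_ncard_of_ne hk hl hkl, ?_⟩, hi, hj, hk, hl⟩
  intro x hx x' hx' z hz w hw
  have hne : ∀ {a b}, a ∈ T → b ∉ T → a ≠ b := fun ha hb e => hb (e ▸ ha)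
  -- Up to the factor `1 - cr X x z i l`, which is near `1`, the determinant splits into a part
  -- depending on `x` and a part depending on `z`; both parts cancel in a cross-ratio.
  have e : ∀ x ∈ T, ∀ z, z ∉ T → br (X x) (X z) =
      (1 - cr X x z i l) * (br (X x) (X l) * br (X i) (X z) / br (X i) (X l)) := by
    intro x hx z hz
    rw [one_sub_cr hX (hxl x hx) (hzi z hz)]
    have h1 := hX _ _ (hxl x hx)
    have h2 := hX _ _ (hzi z hz).symm
    have h3 := hX _ _ hil
    unfold cr
    field_simp
  have e2 : cr X x x' z w = ((1 - cr X x z i l) * (1 - cr X x' w i l)) /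
      ((1 - cr X x w i l) * (1 - cr X x' z i l)) := by
    have h1 := hX _ _ (hxl x hx)
    have h2 := hX _ _ (hxl x' hx')
    have h3 := hX _ _ hil
    have h4 := hX _ _ (hzi z hz).symm
    have h5 := hX _ _ (hzi w hw).symm
    have h6 := (nearOne_one_sub (key x hx w hw)).ne_zero
    have h7 := (nearOne_one_sub (key x' hx' z hz)).ne_zero
    have e1 : cr X x x' z w =
      (br (X x) (X z) * br (X x') (X w)) / (br (X x) (X w) * br (X x') (X z)) := rfl
    rw [e1, e x hx z hz, e x' hx' w hw, e x hx w hw, e x' hx' z hz]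
    field_simp
  rw [e2]
  exact ((nearOne_one_sub (key x hx z hz)).mul (nearOne_one_sub (key x' hx' w hw))).div
    ((nearOne_one_sub (key x hx w hw)).mul (nearOne_one_sub (key x' hx' z hz)))

/-- Crossing nodes would put both `cr X i j k l` and `cr X i k j l = 1 - cr X i j k l` near `1`. -/
theorem NodeX.not_cross {n : ℕ} {X : HConf n} (hX : Nondeg X) {S T : Set (Fin n)}
    (hS : NodeX X S) (hT : NodeX X T) {i j k l : Fin n} (hi : i ∈ S ∧ i ∈ T) (hj : j ∈ S ∧ j ∉ T)
    (hk : k ∉ S ∧ k ∈ T) (hl : l ∉ S ∧ l ∉ T) : False := by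
  have h1 := hS.2.2 i hi.1 j hj.1 k hk.1 l hl.1
  have h2 := hT.2.2 i hi.2 k hk.2 j hj.2 l hl.2
  have hil : i ≠ l := fun e => hl.1 (e ▸ hi.1)
  have hjk : j ≠ k := fun e => hk.1 (e ▸ hj.1)
  rw [← one_sub_cr hX hil hjk] at h2
  exact h2.not_negl (negl_one_sub h1)

/-- Alternation would make the cross-ratio that weak agreement bounds the inverse of an
infinitesimal. Hence the labels on one side of a node are consecutive. -/
theorem NodeX.not_alternate {n : ℕ} {X : HConf n} (hX : Nondeg X) {σ : Equiv.Perm (Fin n)}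
    (hσ : WeakAgree X σ) {S : Set (Fin n)} (hS : NodeX X S) {i j k l : Fin n} (hij : i < j)
    (hjk : j < k) (hkl : k < l) (hi : σ i ∈ S) (hj : σ j ∉ S) (hk : σ k ∈ S) (hl : σ l ∉ S) :
    False := by
  have hne : ∀ {a b}, a < b → σ a ≠ σ b := fun hab e => hab.ne (σ.injective e)
  obtain ⟨r, -, -, hr⟩ := hσ i j k l hij hjk hkl
  have h1 := hS.2.2 _ hi _ hk _ hj _ hl
  rw [← one_sub_cr hX (hne (hij.trans (hjk.trans hkl))) (hne hjk), cr_swap_right] at h1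
  have h2 := (bdd_of_negl_sub hr).mul_negl (negl_one_sub h1)
  rw [sub_sub_cancel, mul_inv_cancel₀ (cr_ne_zero hX (hne (hij.trans (hjk.trans hkl)))
    (hne (hij.trans hjk)) (hne (hjk.trans hkl)) (hne hjk))] at h2
  exact not_negl_one h2

theorem NodeX.ncard_bounds {n : ℕ} {X : HConf n} {S : Set (Fin n)} (hS : NodeX X S) :
    2 ≤ S.ncard ∧ S.ncard + 2 ≤ n := by
  refine ⟨hS.1, ?_⟩
  have := Set.ncard_add_ncard_compl S
  rw [Nat.card_eq_fintype_card, Fintype.card_fin] at this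
  have := hS.2.1
  omega

/-! ### Nodes as initial segments of rotated labellings -/

/-- The label sets of initial segments of a labelling. -/
def IsInitial {n : ℕ} (σ : Equiv.Perm (Fin n)) (S : Set (Fin n)) : Prop :=
  ∀ a, σ a ∈ S ↔ a.val < S.ncard

theorem isInitial_of_iff {n s : ℕ} {σ : Equiv.Perm (Fin n)} {S : Set (Fin n)} (hs : s ≤ n)
    (h : ∀ a, σ a ∈ S ↔ a.val < s) : IsInitial σ S := by
  have : S.ncard = s := by
    have e : S = σ '' {a | a.val < s} := by
      ext x
      obtain ⟨a, rfl⟩ := σ.surjective x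
      simp [h]
    rw [e, Set.ncard_image_of_injective _ σ.injective]
    have e2 : {a : Fin n | a.val < s} = ((Finset.univ.filter fun a : Fin n => a.val < s) : Set _) := by
      ext; simp
    rw [e2, Set.ncard_coe_finset, Fin.card_filter_val_lt, min_eq_right hs]
  intro a
  rw [h, this]

/-- After a rotation of the labelling, a node separates an initial segment. -/
theorem NodeX.exists_rotate {m : ℕ} {X : HConf (m + 1)} (hX : Nondeg X)
    {σ : Equiv.Perm (Fin (m + 1))} (hσ : WeakAgree X σ) {S : Set (Fin (m + 1))} (hS : NodeX X S) :
    ∃ r : ℕ, IsInitial (σ * finRotate (m + 1) ^ r) S := by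
  have hb := hS.ncard_bounds
  set ρ := finRotate (m + 1) with hρ
  have horb : ∀ a : Fin (m + 1), (ρ ^ a.val) 0 = a := by
    have : ∀ b : ℕ, (hb' : b < m + 1) → (ρ ^ b) 0 = (⟨b, hb'⟩ : Fin (m + 1)) := by
      intro b
      induction b with
      | zero => intro _; rfl
      | succ b ih =>
        intro hb'
        rw [pow_succ', Equiv.Perm.mul_apply, ih (by omega)]
        exact finRotate_of_lt (by omega)
    exact fun a => this a.val a.2
  have hlast : ρ (Fin.last m) = 0 := finRotate_last
  obtain ⟨x, hx⟩ : S.Nonempty := by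
    rw [← Set.ncard_pos]; omega
  obtain ⟨y, hy⟩ : Sᶜ.Nonempty := by
    rw [← Set.ncard_pos]; have := hS.2.1; omega
  -- Going around the polygon from `y ∉ S`, some step must enter `S`, since otherwise `x ∈ S` would
  -- never be reached.
  obtain ⟨g, hg0, hg1⟩ : ∃ g : ℕ, σ ((ρ ^ g) 0) ∉ S ∧ σ ((ρ ^ (g + 1)) 0) ∈ S := by
    by_contra hcon
    push Not at hcon
    have h1 : ∀ g, σ ((ρ ^ ((σ.symm y).val + g)) 0) ∉ S := by
      intro g
      induction g with
      | zero => rw [add_zero, horb, Equiv.apply_symm_apply]; exact hy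
      | succ g ih => exact hcon _ ih
    have hper : ρ ^ (m + 1) = 1 := by
      ext a
      have h3 : (ρ ^ (m + 1)) 0 = 0 := by
        rw [pow_succ', Equiv.Perm.mul_apply]
        have := horb (Fin.last m)
        rw [Fin.val_last] at this
        rw [this, hlast]
      rw [← horb a, ← Equiv.Perm.mul_apply, ← pow_add, add_comm (m + 1) a.val, pow_add, Equiv.Perm.mul_apply, h3]
      rfl
    -- The exponent is chosen so that the total rotation is a number of full turns followed by
    -- `σ.symm x` steps.
    have h2 := h1 ((m + 1) * (σ.symm y).val - (σ.symm y).val + (σ.symm x).val)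
    have e : (σ.symm y).val + ((m + 1) * (σ.symm y).val - (σ.symm y).val + (σ.symm x).val) =
        (m + 1) * (σ.symm y).val + (σ.symm x).val := by
      have : (σ.symm y).val ≤ (m + 1) * (σ.symm y).val := Nat.le_mul_of_pos_left _ (by omega)
      omega
    rw [e, pow_add, pow_mul, hper, one_pow, one_mul, horb, Equiv.apply_symm_apply] at h2
    exact h2 hx
  refine ⟨g + 1, ?_⟩
  have hw := hσ.rotate hX (g + 1)
  rw [← hρ] at hw
  set τ := σ * ρ ^ (g + 1) with hτ
  have hτ0 : τ 0 ∈ S := hg1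
  have hτl : τ (Fin.last m) ∉ S := by
    rw [hτ, Equiv.Perm.mul_apply, pow_succ, Equiv.Perm.mul_apply, hlast]; exact hg0
  -- Otherwise the positions `0 < i < j < last` would alternate between `S` and its complement.
  have hdown : ∀ i j : Fin (m + 1), i < j → τ j ∈ S → τ i ∈ S := by
    intro i j hij hj
    by_contra hi
    have h0 : 0 < i := Fin.pos_iff_ne_zero.2 (fun e => hi (e ▸ hτ0))
    have hl : j < Fin.last m := Fin.lt_last_iff_ne_last.2 (fun e => hτl (e ▸ hj))
    exact hS.not_alternate hX hw h0 hij hl hτ0 hi hj hτl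
  obtain ⟨c, hc, hcmin⟩ : ∃ c : ℕ, c ≤ m + 1 ∧ ∀ a : Fin (m + 1), τ a ∈ S ↔ a.val < c := by
    classical
    have hex : ∃ c : ℕ, ∃ h : c < m + 1, τ ⟨c, h⟩ ∉ S := ⟨m, by omega, hτl⟩
    refine ⟨Nat.find hex, (Nat.find_spec hex).1.le, fun a => ⟨fun ha => ?_, fun ha => ?_⟩⟩
    · by_contra hle
      obtain ⟨h1, h2⟩ := Nat.find_spec hex
      rcases (not_lt.1 hle).eq_or_lt with e | e
      · apply h2
        have : (⟨Nat.find hex, h1⟩ : Fin (m + 1)) = a := Fin.ext e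
        rwa [this]
      · exact h2 (hdown _ a e ha)
    · have := Nat.find_min hex ha
      push Not at this
      exact this a.2
  exact isInitial_of_iff hc hcmin

/-! ### Weak agreement with a cyclic order -/

/-- Two configurations in the same cyclic order have cross-ratios of the same sign. -/
theorem Agree.cr_mul_pos {m : ℕ} {X Y : HConf (m + 1)} (hX : Nondeg X) (hY : Nondeg Y)
    {σ : Equiv.Perm (Fin (m + 1))} (h : Agree X σ) (h' : Agree Y σ) {i j k l : Fin (m + 1)}
    (hik : i ≠ k) (hil : i ≠ l) (hjk : j ≠ k) (hjl : j ≠ l) :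
    0 < cr X i j k l * cr Y i j k l := by
  obtain ⟨x, hx, hxc⟩ := h.exists_strictMono hX
  obtain ⟨y, hy, hyc⟩ := h'.exists_strictMono hY
  rw [← hxc, ← hyc]
  have key : ∀ a b, a ≠ b → 0 < br (x a, 1) (x b, 1) * br (y a, 1) (y b, 1) := by
    intro a b hab
    simp only [br, mul_one, one_mul]
    rcases lt_or_gt_of_ne (fun e => hab (σ.symm.injective e) : σ.symm a ≠ σ.symm b) with hl | hl
    · have h1 := hx hl
      have h2 := hy hl
      simp only [Function.comp, Equiv.apply_symm_apply] at h1 h2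
      exact mul_pos_of_neg_of_neg (by linarith) (by linarith)
    · have h1 := hx hl
      have h2 := hy hl
      simp only [Function.comp, Equiv.apply_symm_apply] at h1 h2
      exact mul_pos (by linarith) (by linarith)
  unfold cr
  rw [div_mul_div_comm]
  have h1 := mul_pos (key i k hik) (key j l hjl)
  have h2 := mul_pos (key i l hil) (key j k hjk)
  apply div_pos
  · convert h1 using 1; ring
  · convert h2 using 1; ring

/-- The cross-ratios of a point weakly agree with a cyclic order. -/
def ModuliBar.WeakAgree {n : ℕ} (p : ModuliBar n) (σ : Equiv.Perm (Fin n)) : Prop :=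
  ∀ i j k l, i < j → j < k → k < l → ∀ Q : Quad n, Q 0 = σ i → Q 1 = σ j → Q 2 = σ l →
    Q 3 = σ k → ∃ r : ℝ, 0 ≤ r ∧ r ≤ 1 ∧ p.cr Q = (r : RP1)

theorem Rep.weakAgree_iff {n : ℕ} {X : HConf n} {p : ModuliBar n} (h : Rep X p)
    {σ : Equiv.Perm (Fin n)} : p.WeakAgree σ ↔ WeakAgree X σ := by
  constructor
  · intro H i j k l hij hjk hkl
    have hne : ∀ {a b}, a < b → σ a ≠ σ b := fun hab e => hab.ne (σ.injective e)
    obtain ⟨Q, h0, h1, h2, h3⟩ := exists_quad (hne hij) (hne (hij.trans (hjk.trans hkl)))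
      (hne (hij.trans hjk)) (hne (hjk.trans hkl)) (hne hjk) (hne hkl).symm
    obtain ⟨r, hr0, hr1, hr⟩ := H i j k l hij hjk hkl Q h0 h1 h2 h3
    refine ⟨r, hr0, hr1, ?_⟩
    rw [h.2, red_eq_coe, h0, h1, h2, h3] at hr
    exact hr
  · intro H i j k l hij hjk hkl Q h0 h1 h2 h3
    obtain ⟨r, hr0, hr1, hr⟩ := H i j k l hij hjk hkl
    refine ⟨r, hr0, hr1, ?_⟩
    rw [h.2, red_eq_coe, h0, h1, h2, h3]
    exact hr

/-- The splittings of the labels at the nodes of a point. -/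
def nodes {n : ℕ} (p : ModuliBar n) : Set (Set (Fin n)) := {S | p.HasNode S}

/-- A cross-ratio with limit `0` or `1` comes from a node, which `p` and `q` share. A cross-ratio
with limit strictly between `0` and `1` is governed by the signs of `d` and `1 - d`, which `p` and
`q` share because both are in order `σ`. -/
theorem weakAgree_of_nodes_eq {m : ℕ} {p q : ModuliBar (m + 1)} {σ τ : Equiv.Perm (Fin (m + 1))}
    (hp : p ∈ associahedron σ) (hq : q ∈ associahedron σ) (hn : nodes p = nodes q)
    (hw : p.WeakAgree τ) : q.WeakAgree τ := by
  obtain ⟨X, hXp, hX⟩ := exists_rep_of_mem_associahedron hp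
  obtain ⟨Y, hYq, hY⟩ := exists_rep_of_mem_associahedron hq
  rw [hXp.weakAgree_iff] at hw
  rw [hYq.weakAgree_iff]
  have hnode : ∀ T, NodeX X T → NodeX Y T := by
    intro T hT
    rw [← hYq.hasNode_iff]
    rw [← hXp.hasNode_iff] at hT
    have : T ∈ nodes p := hT
    rw [hn] at this
    exact this
  intro i j k l hij hjk hkl
  have hne : ∀ {a b}, a < b → τ a ≠ τ b := fun hab e => hab.ne (τ.injective e)
  have nij := hne hij
  have njk := hne hjk
  have nkl := hne hkl
  have nik := hne (hij.trans hjk)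
  have njl := hne (hjk.trans hkl)
  have nil := hne (hij.trans (hjk.trans hkl))
  obtain ⟨r, hr0, hr1, hr⟩ := hw i j k l hij hjk hkl
  have e1 : 1 - cr X (τ i) (τ j) (τ l) (τ k) = cr X (τ i) (τ l) (τ j) (τ k) :=
    one_sub_cr hXp.1 nik njl
  have e2 : 1 - cr Y (τ i) (τ j) (τ l) (τ k) = cr Y (τ i) (τ l) (τ j) (τ k) :=
    one_sub_cr hYq.1 nik njl
  rcases hr0.eq_or_lt with h0 | h0
  · subst h0
    rw [coe_zero, sub_zero] at hr
    have h1 := nearOne_one_sub hr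
    rw [e1] at h1
    obtain ⟨T, hT, hTi, hTl, hTj, hTk⟩ := exists_nodeX hXp.1 nil nij nik njl.symm nkl.symm njk h1
    have h2 := (hnode T hT).2.2 _ hTi _ hTl _ hTj _ hTk
    rw [← e2] at h2
    refine ⟨0, le_rfl, zero_le_one, ?_⟩
    have := negl_one_sub h2
    rw [sub_sub_cancel] at this
    simpa using this
  rcases hr1.eq_or_lt with h1 | h1
  · subst h1
    rw [coe_one] at hr
    obtain ⟨T, hT, hTi, hTj, hTl, hTk⟩ := exists_nodeX hXp.1 nij nil nik njl njk nkl.symm hr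
    have h2 := (hnode T hT).2.2 _ hTi _ hTj _ hTl _ hTk
    exact ⟨1, zero_le_one, le_rfl, by rw [coe_one]; exact h2⟩
  have hr' : Negl (1 - cr X (τ i) (τ j) (τ l) (τ k) - ((1 - r : ℝ) : ℝ*)) := by
    rw [← negl_neg_iff, coe_sub, coe_one]; convert hr using 1; ring
  have pos : ∀ {x : ℝ*} {r : ℝ}, 0 < r → Negl (x - r) → 0 < x := by
    intro x r hr h
    rcases (wNonneg_iff h).2 hr.le with h2 | h2
    · refine lt_of_le_of_ne h2 ?_
      rintro rfl
      rw [zero_sub, negl_neg_iff, negl_coe_iff] at h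
      exact hr.ne' h
    · have := eq_of_negl_sub h (s := 0) (by simpa using h2)
      exact absurd this hr.ne'
  have hx0 := pos h0 hr
  have hx1 := pos (by linarith) hr'
  rw [e1] at hx1
  have hy0 := (mul_pos_iff_of_pos_left hx0).1 (hX.cr_mul_pos hXp.1 hYq.1 hY nil nik njl njk)
  have hy1 := (mul_pos_iff_of_pos_left hx1).1
    (hX.cr_mul_pos hXp.1 hYq.1 hY nij nik njl.symm nkl.symm)
  rw [← e2] at hy1
  obtain ⟨s, hs⟩ := (bdd_of_mem_Icc hy0.le (sub_nonneg.1 hy1.le)).exists_st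
  refine ⟨s, (wNonneg_iff hs).1 (Or.inl hy0.le), ?_, hs⟩
  have hs' : Negl (1 - cr Y (τ i) (τ j) (τ l) (τ k) - ((1 - s : ℝ) : ℝ*)) := by
    rw [← negl_neg_iff, coe_sub, coe_one]; convert hs using 1; ring
  have := (wNonneg_iff hs').1 (Or.inl hy1.le)
  linarith

theorem weakAgree_of_mem_associahedron {n : ℕ} {p : ModuliBar n} {σ : Equiv.Perm (Fin n)}
    (h : p ∈ associahedron σ) : p.WeakAgree σ := by
  obtain ⟨X, hXp, hX⟩ := exists_rep_of_mem_associahedron h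
  exact hXp.weakAgree_iff.2 hX.weakAgree

theorem Agree.mem_associahedron {m : ℕ} {X : HConf (m + 1)} {σ : Equiv.Perm (Fin (m + 1))}
    {p : ModuliBar (m + 1)} (hp : Rep X p) (h : Agree X σ) : p ∈ associahedron σ := by
  obtain ⟨q, hq, hqX⟩ := h.exists_point hp.1
  rwa [hp.unique hqX]

theorem associahedron_rotate_subset {m : ℕ} {σ : Equiv.Perm (Fin (m + 1))} (r : ℕ) :
    associahedron σ ⊆ associahedron (σ * finRotate (m + 1) ^ r) := by
  intro p hp
  obtain ⟨X, hXp, hX⟩ := exists_rep_of_mem_associahedron hp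
  exact (hX.rotate hXp.1 r).mem_associahedron hXp

theorem associahedron_rotate {m : ℕ} {σ : Equiv.Perm (Fin (m + 1))} (r : ℕ) :
    associahedron (σ * finRotate (m + 1) ^ r) = associahedron σ := by
  refine subset_antisymm ?_ (associahedron_rotate_subset r)
  have hk : 0 < orderOf (finRotate (m + 1)) := orderOf_pos _
  -- Rotating on by this amount completes a multiple of the order of `finRotate`.
  have h := associahedron_rotate_subset (σ := σ * finRotate (m + 1) ^ r)
    (orderOf (finRotate (m + 1)) * r - r)
  have h1 : r ≤ orderOf (finRotate (m + 1)) * r := Nat.le_mul_of_pos_left _ hk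
  rwa [mul_assoc, ← pow_add, Nat.add_sub_cancel' h1, pow_mul, pow_orderOf_eq_one, one_pow,
    mul_one] at h

/-! ### Gluing two configurations at a point -/

open Classical in
/-- The configuration in which the points with labels in `S` have the coordinate `w i` and those
with the remaining labels the inverse coordinate `η * w i`. As `η` becomes infinitesimal, the
labels in `S` split off at a node. -/
def glue {n : ℕ} (S : Set (Fin n)) (w : Fin n → ℝ*) (η : ℝ*) : HConf n :=
  fun i => if i ∈ S then (w i, 1) else (1, η * w i)

/-- Normalised coordinates for gluing: all of them lie in the unit interval, and on both sides of
the node the values `0` and `1` are attained. -/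
structure IsGlue {n : ℕ} (S : Set (Fin n)) (w : Fin n → ℝ*) : Prop where
  nonneg : ∀ i, 0 ≤ w i
  le_one : ∀ i, w i ≤ 1
  injOn : Set.InjOn w S
  injOn_compl : Set.InjOn w Sᶜ
  zero : ∃ i ∈ S, w i = 0
  one : ∃ i ∈ S, w i = 1
  zero_compl : ∃ i ∈ Sᶜ, w i = 0
  one_compl : ∃ i ∈ Sᶜ, w i = 1

/-- Admissible gluing parameters. -/
def GoodParam (η : ℝ*) : Prop := η ≠ 0 ∧ ∃ c : ℝ, 0 < c ∧ |η| ≤ ((1 - c : ℝ) : ℝ*)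

theorem Negl.goodParam {η : ℝ*} (h : Negl η) (h0 : η ≠ 0) : GoodParam η :=
  ⟨h0, 1 / 2, by norm_num, negl_iff.1 h _ (by norm_num)⟩

theorem goodParam_coe {t : ℝ} (h0 : t ≠ 0) (h1 : |t| < 1) : GoodParam (t : ℝ*) :=
  ⟨by exact_mod_cast h0, 1 - |t|, by linarith, by rw [sub_sub_cancel, coe_abs]⟩

theorem goodParam_of_not_nearOne {η : ℝ*} (h0 : 0 < η) (h1 : η < 1) (h : ¬ NearOne η) :
    GoodParam η := by
  obtain ⟨r, hr⟩ := (bdd_of_mem_Icc h0.le h1.le).exists_st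
  have hr1 : 0 ≤ 1 - r := by
    refine (wNonneg_iff (x := 1 - η) ?_).1 (Or.inl (by linarith))
    rw [← negl_neg_iff, coe_sub, coe_one]; convert hr using 1; ring
  have hr2 : r ≠ 1 := by
    rintro rfl
    exact h (by unfold NearOne; simpa using hr)
  have hr3 : 0 < 1 - r := lt_of_le_of_ne hr1 (fun e => hr2 (by linarith))
  refine ⟨h0.ne', (1 - r) / 2, by linarith, ?_⟩
  have := negl_iff.1 hr ((1 - r) / 2) (by linarith)
  have h3 := (abs_le.1 this).2
  rw [abs_of_pos h0]
  have e : ((1 - (1 - r) / 2 : ℝ) : ℝ*) = (r : ℝ*) + (((1 - r) / 2 : ℝ) : ℝ*) := by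
    rw [← coe_add]; congr 1; ring
  rw [e]; linarith

section

variable {n : ℕ} {S : Set (Fin n)} {w : Fin n → ℝ*} {η : ℝ*}

theorem br_glue_mem_mem {i j : Fin n} (hi : i ∈ S) (hj : j ∈ S) :
    br (glue S w η i) (glue S w η j) = w i - w j := by simp [glue, hi, hj, br]

theorem br_glue_mem_notMem {i j : Fin n} (hi : i ∈ S) (hj : j ∉ S) :
    br (glue S w η i) (glue S w η j) = -(1 - η * w i * w j) := by
  simp [glue, hi, hj, br]; ring

theorem br_glue_notMem_mem {i j : Fin n} (hi : i ∉ S) (hj : j ∈ S) :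
    br (glue S w η i) (glue S w η j) = 1 - η * w i * w j := by
  simp [glue, hi, hj, br]

theorem br_glue_notMem_notMem {i j : Fin n} (hi : i ∉ S) (hj : j ∉ S) :
    br (glue S w η i) (glue S w η j) = η * (w j - w i) := by
  simp [glue, hi, hj, br]; ring

theorem IsGlue.compl (h : IsGlue S w) : IsGlue Sᶜ w :=
  ⟨h.nonneg, h.le_one, h.injOn_compl, by rw [compl_compl]; exact h.injOn, h.zero_compl,
    h.one_compl, by rw [compl_compl]; exact h.zero, by rw [compl_compl]; exact h.one⟩

/-- The symmetry between the two sides of the node: an inversion of the line exchanges them. -/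
theorem cr_glue_compl (hη : η ≠ 0) (i j k l : Fin n) :
    cr (glue Sᶜ w η) i j k l = cr (glue S w η) i j k l := by
  classical
  apply cr_eq_of_scale (κ := -η) (f := fun i => if i ∈ S then 1 else η⁻¹) (neg_ne_zero.2 hη)
  · intro i; split_ifs
    · exact one_ne_zero
    · exact inv_ne_zero hη
  intro i j
  by_cases hi : i ∈ S <;> by_cases hj : j ∈ S
  · rw [br_glue_notMem_notMem (not_not.2 hi) (not_not.2 hj), br_glue_mem_mem hi hj]
    simp only [hi, hj, if_true]; ring
  · rw [br_glue_notMem_mem (not_not.2 hi) hj, br_glue_mem_notMem hi hj]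
    simp only [hi, hj, if_true, if_false]; field_simp
  · rw [br_glue_mem_notMem hi (not_not.2 hj), br_glue_notMem_mem hi hj]
    simp only [hi, hj, if_true, if_false]; field_simp
  · rw [br_glue_mem_mem hi hj, br_glue_notMem_notMem hi hj]
    simp only [hi, hj, if_false]; field_simp; ring

theorem IsGlue.bdd (h : IsGlue S w) (i : Fin n) : Bdd (w i) := bdd_of_mem_Icc (h.nonneg i) (h.le_one i)

theorem IsGlue.abs_mul_le (h : IsGlue S w) (η : ℝ*) (i j : Fin n) : |η * w i * w j| ≤ |η| := by
  rw [abs_mul, abs_mul, abs_of_nonneg (h.nonneg i), abs_of_nonneg (h.nonneg j), mul_assoc]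
  exact mul_le_of_le_one_right (abs_nonneg _)
    (mul_le_one₀ (h.le_one i) (h.nonneg j) (h.le_one j))

/-- Since `w` lies in the unit interval and `|η|` stays below `1` by a standard amount, determinants
across the node are units: they affect neither signs nor orders of magnitude. -/
theorem IsGlue.posUnit (h : IsGlue S w) (hη : GoodParam η) (i j : Fin n) :
    PosUnit (1 - η * w i * w j) := by
  obtain ⟨-, c, hc, hcη⟩ := hη
  have h1 := h.abs_mul_le η i j
  have h2 : (c : ℝ*) ≤ 1 - η * w i * w j := by
    have := le_abs_self (η * w i * w j)
    rw [coe_sub, coe_one] at hcη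
    linarith
  have hc' : (0 : ℝ*) < c := by exact_mod_cast hc
  refine ⟨hc'.trans_le h2, ?_, bdd_inv_of_le hc (h2.trans (le_abs_self _))⟩
  have : Bdd (η * w i * w j) := bdd_of_abs_le_coe (h1.trans hcη)
  exact bdd_one.sub this

theorem IsGlue.nondeg (h : IsGlue S w) (hη : GoodParam η) : Nondeg (glue S w η) := by
  intro i j hij
  by_cases hi : i ∈ S <;> by_cases hj : j ∈ S
  · rw [br_glue_mem_mem hi hj]
    exact sub_ne_zero.2 fun e => hij (h.injOn hi hj e)
  · rw [br_glue_mem_notMem hi hj]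
    exact neg_ne_zero.2 (h.posUnit hη i j).1.ne'
  · rw [br_glue_notMem_mem hi hj]
    exact (h.posUnit hη i j).1.ne'
  · rw [br_glue_notMem_notMem hi hj]
    exact mul_ne_zero hη.1 (sub_ne_zero.2 fun e => hij (h.injOn_compl hi hj e.symm))

theorem PosUnit.not_negl {x : ℝ*} (h : PosUnit x) : ¬ Negl x := (bdd_inv_iff h.1.ne').1 h.2.2

/-- For such labels `cr - 1` is, up to sign, a quotient of determinants across the node, hence a
unit. -/
theorem IsGlue.not_nodeX_of_cross (h : IsGlue S w) (hη : GoodParam η) {T : Set (Fin n)}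
    {i j k l : Fin n} (hi : i ∈ S ∧ i ∈ T) (hj : j ∉ S ∧ j ∈ T) (hk : k ∈ S ∧ k ∉ T)
    (hl : l ∉ S ∧ l ∉ T) : ¬ NodeX (glue S w η) T := by
  intro hT
  have h1 := hT.2.2 i hi.2 j hj.2 k hk.2 l hl.2
  have hil : i ≠ l := fun e => hl.1 (e ▸ hi.1)
  have hjk : j ≠ k := fun e => hj.1 (e ▸ hk.1)
  unfold NearOne at h1
  rw [cr_sub_one (h.nondeg hη) hil hjk, br_glue_mem_notMem hi.1 hj.1, br_glue_mem_notMem hk.1 hl.1,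
    br_glue_mem_notMem hi.1 hl.1, br_glue_notMem_mem hj.1 hk.1, neg_mul_neg, neg_mul,
    div_neg, negl_neg_iff] at h1
  exact (((h.posUnit hη _ _).mul (h.posUnit hη _ _)).div
    ((h.posUnit hη _ _).mul (h.posUnit hη _ _))).not_negl h1

theorem nearOne_div_of_negl_sub {x y : ℝ*} (h : Negl (x - y)) (hy0 : y ≠ 0) (hy : Bdd y⁻¹) :
    NearOne (x / y) := by
  unfold NearOne
  rw [div_sub_one hy0, div_eq_mul_inv]
  exact h.mul_bdd hy

/-- A node inside `S` can be tested against the label `e` outside `S` with coordinate `0`, whose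
determinants with `S` are all `-1`. The resulting condition on the ratios of differences of `w` does
not involve `η`. It also forces the coordinates in `T` to be infinitely close, which settles the
determinants across `S`. -/
theorem IsGlue.nodeX_of_subset (h : IsGlue S w) {η' : ℝ*} (hη' : GoodParam η')
    {T : Set (Fin n)} (hTS : T ⊆ S) (hne : T ≠ S) (hT : NodeX (glue S w η) T) :
    NodeX (glue S w η') T := by
  obtain ⟨e, he, hwe⟩ := h.zero_compl
  have hratio : ∀ i ∈ T, ∀ j ∈ T, ∀ k ∈ S, k ∉ T → NearOne ((w i - w k) / (w j - w k)) := by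
    intro i hi j hj k hkS hk
    have h1 := hT.2.2 i hi j hj k hk e (fun h => he (hTS h))
    unfold cr at h1
    rw [br_glue_mem_mem (hTS hi) hkS, br_glue_mem_mem (hTS hj) hkS,
      br_glue_mem_notMem (hTS hi) he, br_glue_mem_notMem (hTS hj) he, hwe] at h1
    simpa only [mul_zero, sub_zero, mul_neg, mul_one, neg_mul, one_mul, neg_div_neg_eq] using h1
  obtain ⟨k₀, hk₀, hk₀T⟩ : ∃ k ∈ S, k ∉ T := by
    by_contra hcon
    push Not at hcon
    exact hne (subset_antisymm hTS hcon)
  have hTne : ∀ {a b}, a ∈ T → b ∉ T → a ≠ b := fun ha hb e => hb (e ▸ ha)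
  have hclose : ∀ i ∈ T, ∀ j ∈ T, Negl (w i - w j) := by
    intro i hi j hj
    have h1 := hratio i hi j hj k₀ hk₀ hk₀T
    have h2 := Negl.mul_bdd h1 ((h.bdd j).sub (h.bdd k₀))
    have h3 : w j - w k₀ ≠ 0 := sub_ne_zero.2 fun e => hTne hj hk₀T (h.injOn (hTS hj) hk₀ e)
    rw [sub_mul, div_mul_cancel₀ _ h3] at h2
    convert h2 using 1; ring
  have hb : ∀ i ∈ T, ∀ j ∈ T, ∀ k, k ∉ T →
      NearOne (br (glue S w η' i) (glue S w η' k) / br (glue S w η' j) (glue S w η' k)) := by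
    intro i hi j hj k hk
    by_cases hkS : k ∈ S
    · rw [br_glue_mem_mem (hTS hi) hkS, br_glue_mem_mem (hTS hj) hkS]
      exact hratio i hi j hj k hkS hk
    · rw [br_glue_mem_notMem (hTS hi) hkS, br_glue_mem_notMem (hTS hj) hkS, neg_div_neg_eq]
      have hp := h.posUnit hη' j k
      refine nearOne_div_of_negl_sub ?_ hp.1.ne' hp.2.2
      have hηb : Bdd η' := by
        obtain ⟨-, c, -, hc⟩ := hη'
        exact bdd_of_abs_le_coe hc
      have := (hηb.mul (h.bdd k)).mul_negl (hclose j hj i hi)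
      convert this using 1; ring
  refine ⟨hT.1, hT.2.1, fun i hi j hj k hk l hl => ?_⟩
  have := (hb i hi j hj k hk).div (hb i hi j hj l hl)
  unfold cr
  rw [div_div_div_eq] at this
  convert this using 2; ring

theorem NodeX.congr {X Y : HConf n} (h : ∀ i j k l, cr X i j k l = cr Y i j k l) {T : Set (Fin n)} :
    NodeX X T ↔ NodeX Y T := by
  unfold NodeX; simp only [h]

/-- A node cannot cross `S`, so it or its complement lies on one side of `S`, where
`IsGlue.nodeX_of_subset` applies. -/
theorem IsGlue.nodeX_of_nodeX (h : IsGlue S w) {η' : ℝ*} (hη : GoodParam η) (hη' : GoodParam η')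
    {T : Set (Fin n)} (hne : T ≠ S) (hne' : T ≠ Sᶜ) (hT : NodeX (glue S w η) T) :
    NodeX (glue S w η') T := by
  have hsub : ∀ T : Set (Fin n), (T ⊆ S ∨ T ⊆ Sᶜ) → T ≠ S → T ≠ Sᶜ → NodeX (glue S w η) T →
      NodeX (glue S w η') T := by
    rintro T (hTS | hTS) hne hne' hT
    · exact h.nodeX_of_subset hη' hTS hne hT
    · rw [← NodeX.congr (cr_glue_compl hη'.1)]
      rw [← NodeX.congr (cr_glue_compl hη.1)] at hT
      exact h.compl.nodeX_of_subset hη' hTS hne' hT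
  by_cases h1 : T ⊆ S ∨ T ⊆ Sᶜ
  · exact hsub T h1 hne hne' hT
  by_cases h2 : Tᶜ ⊆ S ∨ Tᶜ ⊆ Sᶜ
  · rw [← compl_compl T]
    refine (hsub Tᶜ h2 ?_ ?_ hT.compl).compl
    · rintro rfl; exact hne' (compl_compl T).symm
    · intro e; exact hne (compl_injective e)
  simp only [not_or, Set.not_subset] at h1 h2
  obtain ⟨⟨j, hjT, hjS⟩, ⟨i, hiT, hiS⟩⟩ := h1
  obtain ⟨⟨l, hlT, hlS⟩, ⟨k, hkT, hkS⟩⟩ := h2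
  exact absurd hT (h.not_nodeX_of_cross hη ⟨not_not.1 hiS, hiT⟩ ⟨hjS, hjT⟩ ⟨not_not.1 hkS, hkT⟩
    ⟨hlS, hlT⟩)

/-- The labels with coordinates `0` and `1` on the two sides have the cross-ratio `(1 - η)⁻¹`;
conversely all determinants across `S` are near `±1` when `η` is infinitesimal. -/
theorem IsGlue.nodeX_self_iff (h : IsGlue S w) :
    NodeX (glue S w η) S ↔ Negl η := by
  obtain ⟨a, ha, hwa⟩ := h.zero
  obtain ⟨b, hb, hwb⟩ := h.one
  obtain ⟨e, he, hwe⟩ := h.zero_compl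
  obtain ⟨c, hc, hwc⟩ := h.one_compl
  constructor
  · intro hS
    have h1 := hS.2.2 a ha b hb c hc e he
    unfold cr at h1
    rw [br_glue_mem_notMem ha hc, br_glue_mem_notMem hb he, br_glue_mem_notMem ha he,
      br_glue_mem_notMem hb hc, hwa, hwb, hwc, hwe] at h1
    simp only [mul_zero, sub_zero, mul_one, neg_mul_neg, one_mul, one_div] at h1
    have h2 := negl_one_sub h1.inv
    rwa [inv_inv, sub_sub_cancel] at h2
  · intro hn
    have hab : a ≠ b := by rintro rfl; rw [hwa] at hwb; exact zero_ne_one hwb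
    have hec : e ≠ c := by rintro rfl; rw [hwe] at hwc; exact zero_ne_one hwc
    refine ⟨two_le_ncard_of_ne ha hb hab, two_le_ncard_of_ne he hc hec, ?_⟩
    intro i hi j hj k hk l hl
    unfold cr
    rw [br_glue_mem_notMem hi hk, br_glue_mem_notMem hj hl, br_glue_mem_notMem hi hl,
      br_glue_mem_notMem hj hk, neg_mul_neg, neg_mul_neg]
    have : ∀ i j, NearOne (1 - η * w i * w j) := fun i j =>
      nearOne_one_sub ((hn.mul_bdd (h.bdd i)).mul_bdd (h.bdd j))
    exact ((this _ _).mul (this _ _)).div ((this _ _).mul (this _ _))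

end

/-! ### Varying the gluing parameter -/

section

variable {n : ℕ} {S : Set (Fin n)} {w : Fin n → ℝ*} {η : ℝ*}

open Classical in
/-- The determinants of a glued configuration in the limit of an infinitesimal parameter. -/
def limBr (S : Set (Fin n)) (w : Fin n → ℝ*) (i j : Fin n) : ℝ* :=
  if i ∈ S then (if j ∈ S then w i - w j else -1) else (if j ∈ S then 1 else w j - w i)

open Classical in
/-- The correction factors for the determinants of points on different sides of the node. -/
def mixFactor (S : Set (Fin n)) (w : Fin n → ℝ*) (η : ℝ*) (i j : Fin n) : ℝ* :=
  if (i ∈ S ↔ j ∈ S) then 1 else 1 - η * w i * w j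

/-- The correction factor for the cross-ratio. -/
def crFactor (S : Set (Fin n)) (w : Fin n → ℝ*) (η : ℝ*) (i j k l : Fin n) : ℝ* :=
  (mixFactor S w η i k * mixFactor S w η j l) / (mixFactor S w η i l * mixFactor S w η j k)

open Classical in
theorem br_glue_eq (i j : Fin n) : br (glue S w η i) (glue S w η j) =
    (if i ∉ S ∧ j ∉ S then η else 1) * limBr S w i j * mixFactor S w η i j := by
  by_cases hi : i ∈ S <;> by_cases hj : j ∈ S
  · rw [br_glue_mem_mem hi hj]; simp [limBr, mixFactor, hi, hj]
  · rw [br_glue_mem_notMem hi hj]; simp [limBr, mixFactor, hi, hj]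
  · rw [br_glue_notMem_mem hi hj]; simp [limBr, mixFactor, hi, hj]
  · rw [br_glue_notMem_notMem hi hj]; simp [limBr, mixFactor, hi, hj]

/-- A factor `η` arises for each pair lying outside `S`; under `h` numerator and denominator contain
equally many. -/
theorem cr_glue_same (hη : η ≠ 0) {i j k l : Fin n} (h : (i ∈ S ↔ j ∈ S) ∨ (k ∈ S ↔ l ∈ S)) :
    cr (glue S w η) i j k l =
      (limBr S w i k * limBr S w j l) / (limBr S w i l * limBr S w j k) *
        crFactor S w η i j k l := by
  unfold cr crFactor
  rw [br_glue_eq, br_glue_eq, br_glue_eq, br_glue_eq, div_mul_div_comm]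
  have key : ∀ a b c d p q r s x y z t : ℝ*, a * b = c * d → c * d ≠ 0 →
      (a * p * x * (b * q * y)) / (c * r * z * (d * s * t)) = (p * q * (x * y)) / (r * s * (z * t)) := by
    intro a b c d p q r s x y z t h1 h2
    rw [← mul_div_mul_left (p * q * (x * y)) _ h2]
    congr 1
    · rw [← h1]; ring
    · ring
  apply key
  · by_cases hi : i ∈ S <;> by_cases hj : j ∈ S <;> by_cases hk : k ∈ S <;> by_cases hl : l ∈ S <;>
      simp_all
  · split_ifs <;> simp [hη]

/-- Exactly one pair of the numerator and none of the denominator lies outside `S`, so one factor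
`η` remains. The two limiting determinants in the denominator have product `-1`. -/
theorem cr_glue_split {i j k l : Fin n} (h1 : i ∈ S ↔ k ∈ S) (h2 : j ∈ S ↔ l ∈ S)
    (h3 : ¬ (i ∈ S ↔ j ∈ S)) :
    cr (glue S w η) i j k l = η * (-(limBr S w i k * limBr S w j l) * crFactor S w η i j k l) := by
  unfold cr crFactor
  rw [br_glue_eq, br_glue_eq, br_glue_eq, br_glue_eq]
  by_cases hi : i ∈ S <;> by_cases hj : j ∈ S <;> by_cases hk : k ∈ S <;> by_cases hl : l ∈ S <;>
    simp_all [limBr] <;> ring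

theorem IsGlue.abs_limBr_le (h : IsGlue S w) (i j : Fin n) : |limBr S w i j| ≤ 1 := by
  have h1 := h.nonneg i
  have h2 := h.nonneg j
  have h3 := h.le_one i
  have h4 := h.le_one j
  unfold limBr
  split_ifs
  · rw [abs_le]; constructor <;> linarith
  · simp
  · simp
  · rw [abs_le]; constructor <;> linarith

theorem IsGlue.nearOne_crFactor (h : IsGlue S w) (hη : Negl η) (i j k l : Fin n) :
    NearOne (crFactor S w η i j k l) := by
  have : ∀ i j, NearOne (mixFactor S w η i j) := by
    intro i j
    unfold mixFactor
    split_ifs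
    · exact nearOne_one
    · exact nearOne_one_sub ((hη.mul_bdd (h.bdd i)).mul_bdd (h.bdd j))
  exact ((this _ _).mul (this _ _)).div ((this _ _).mul (this _ _))

theorem IsGlue.posUnit_crFactor (h : IsGlue S w) (hη : GoodParam η) (i j k l : Fin n) :
    PosUnit (crFactor S w η i j k l) := by
  have : ∀ i j, PosUnit (mixFactor S w η i j) := by
    intro i j
    unfold mixFactor
    split_ifs
    · exact posUnit_one
    · exact h.posUnit hη i j
  exact ((this _ _).mul (this _ _)).div ((this _ _).mul (this _ _))

/-- The four factors lie within `δ = |t|` of `1`. So numerator and denominator differ by at most `4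
* δ`, and the denominator is at least `1 / 4`; hence the constant `16`. -/
theorem IsGlue.abs_crFactor_sub_one_le (h : IsGlue S w) {t : ℝ} (ht : |t| ≤ 1 / 2)
    (i j k l : Fin n) : |crFactor S w (t : ℝ*) i j k l - 1| ≤ ((16 * |t| : ℝ) : ℝ*) := by
  set δ : ℝ* := |(t : ℝ*)| with hδ
  have hδ0 : 0 ≤ δ := abs_nonneg _
  have hδ1 : 2 * δ ≤ 1 := by
    have : ((|t| : ℝ) : ℝ*) ≤ ((1 / 2 : ℝ) : ℝ*) := by exact_mod_cast ht
    rw [coe_abs] at this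
    have h6 : ((1 / 2 : ℝ) : ℝ*) + ((1 / 2 : ℝ) : ℝ*) = 1 := by
      rw [← coe_add, ← coe_one]; norm_num
    linarith
  have hm : ∀ i j, 1 - δ ≤ mixFactor S w t i j ∧ mixFactor S w t i j ≤ 1 + δ := by
    intro i j
    unfold mixFactor
    split_ifs
    · constructor <;> linarith
    · have := abs_le.1 (h.abs_mul_le (t : ℝ*) i j)
      constructor <;> linarith [this.1, this.2]
  unfold crFactor
  obtain ⟨a1, a2⟩ := hm i k
  obtain ⟨b1, b2⟩ := hm j l
  obtain ⟨c1, c2⟩ := hm i l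
  obtain ⟨d1, d2⟩ := hm j k
  generalize mixFactor S w t i k = a at *
  generalize mixFactor S w t j l = b at *
  generalize mixFactor S w t i l = c at *
  generalize mixFactor S w t j k = d at *
  have hc : 0 < c := by linarith
  have hd : 0 < d := by linarith
  have e : ((16 * |t| : ℝ) : ℝ*) = 16 * δ := by
    rw [coe_mul, coe_abs]; rfl
  rw [e, div_sub_one (mul_pos hc hd).ne', abs_div, abs_of_pos (mul_pos hc hd),
    div_le_iff₀ (mul_pos hc hd)]
  have h1 : (1 - δ) * (1 - δ) ≤ c * d := mul_le_mul c1 d1 (by linarith) hc.le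
  have h2 : c * d ≤ (1 + δ) * (1 + δ) := mul_le_mul c2 d2 hd.le (by linarith)
  have h3 : (1 - δ) * (1 - δ) ≤ a * b := mul_le_mul a1 b1 (by linarith) (by linarith)
  have h4 : a * b ≤ (1 + δ) * (1 + δ) := mul_le_mul a2 b2 (by linarith) (by linarith)
  have h5 : 1 ≤ 4 * (c * d) := by nlinarith
  have h6 : 4 * δ ≤ 16 * δ * (c * d) := by nlinarith
  rw [abs_le]
  constructor <;> nlinarith

/-- As the gluing parameter tends to zero, the reductions of the cross-ratios tend to those for an
infinitesimal parameter. -/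
theorem IsGlue.tendsto_red_cr (h : IsGlue S w) (hη0 : η ≠ 0) (hη : Negl η) (i j k l : Fin n)
    (hik : i ≠ k) (hil : i ≠ l) (hjk : j ≠ k) (hjl : j ≠ l) :
    Tendsto (fun t : ℝ => red (cr (glue S w (t : ℝ*)) i j k l)) (𝓝[≠] 0)
      (𝓝 (red (cr (glue S w η) i j k l))) := by
  have hsmall : ∀ᶠ t : ℝ in 𝓝[≠] 0, t ≠ 0 ∧ |t| ≤ 1 / 2 := by
    have h1 : ∀ᶠ t : ℝ in 𝓝[≠] 0, t ≠ 0 := self_mem_nhdsWithin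
    have h2 : ∀ᶠ t : ℝ in 𝓝[≠] 0, |t| < 1 / 2 := by
      apply nhdsWithin_le_nhds
      have : Tendsto (fun t : ℝ => |t|) (𝓝 0) (𝓝 |0|) := continuous_abs.tendsto 0
      rw [abs_zero] at this
      exact this.eventually (gt_mem_nhds (by norm_num))
    filter_upwards [h1, h2] with t h1 h2 using ⟨h1, h2.le⟩
  have hδ : Tendsto (fun t : ℝ => 16 * |t|) (𝓝[≠] 0) (𝓝 0) := by
    have : Tendsto (fun t : ℝ => 16 * |t|) (𝓝 0) (𝓝 (16 * |0|)) :=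
      (continuous_abs.tendsto 0).const_mul 16
    rw [abs_zero, mul_zero] at this
    exact this.mono_left nhdsWithin_le_nhds
  have hsplit : ∀ i j k l, (i ∈ S ↔ k ∈ S) → (j ∈ S ↔ l ∈ S) → ¬ (i ∈ S ↔ j ∈ S) →
      Negl (cr (glue S w η) i j k l) ∧ ∀ t : ℝ, t ≠ 0 → |t| ≤ 1 / 2 →
        |cr (glue S w (t : ℝ*)) i j k l| ≤ ((16 * |t| : ℝ) : ℝ*) := by
    intro i j k l h1 h2 h3
    constructor
    · rw [cr_glue_split h1 h2 h3]
      refine hη.mul_bdd (Bdd.mul (Bdd.neg (Bdd.mul ?_ ?_)) (h.nearOne_crFactor hη _ _ _ _).bdd)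
      · exact bdd_of_abs_le_coe (C := 1) (by simpa using h.abs_limBr_le i k)
      · exact bdd_of_abs_le_coe (C := 1) (by simpa using h.abs_limBr_le j l)
    · intro t ht0 ht
      rw [cr_glue_split h1 h2 h3, abs_mul, abs_mul, abs_neg, abs_mul]
      have e1 := h.abs_crFactor_sub_one_le ht i j k l
      have e2 : |crFactor S w (t : ℝ*) i j k l| ≤ 16 := by
        have h8 : ((16 * |t| : ℝ) : ℝ*) ≤ ((8 : ℝ) : ℝ*) := by
          have : 16 * |t| ≤ 8 := by linarith
          exact_mod_cast this
        have h9 : ((8 : ℝ) : ℝ*) = 8 := rfl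
        have := abs_sub_abs_le_abs_sub (crFactor S w (t : ℝ*) i j k l) 1
        rw [abs_one] at this
        linarith
      have e3 : |limBr S w i k| * |limBr S w j l| ≤ 1 :=
        mul_le_one₀ (h.abs_limBr_le i k) (abs_nonneg _) (h.abs_limBr_le j l)
      have e4 : |limBr S w i k| * |limBr S w j l| * |crFactor S w (t : ℝ*) i j k l| ≤ 1 * 16 :=
        mul_le_mul e3 e2 (abs_nonneg _) zero_le_one
      have e5 : ((16 * |t| : ℝ) : ℝ*) = |(t : ℝ*)| * (1 * 16) := by
        rw [coe_mul, coe_abs]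
        have : ((16 : ℝ) : ℝ*) = 16 := rfl
        rw [this]; ring
      rw [e5]
      exact mul_le_mul_of_nonneg_left e4 (abs_nonneg _)
  -- Either the powers of the parameter cancel, or the cross-ratio or its inverse is the parameter
  -- times something bounded; the limits are then `0` and infinity.
  by_cases hsame : (i ∈ S ↔ j ∈ S) ∨ (k ∈ S ↔ l ∈ S)
  · rw [cr_glue_same hη0 hsame, red_congr_mul (h.nearOne_crFactor hη _ _ _ _)]
    refine (tendsto_red_mul hδ (μ := fun t : ℝ => crFactor S w (t : ℝ*) i j k l) ?_).congr' ?_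
    · filter_upwards [hsmall] with t ht
      exact h.abs_crFactor_sub_one_le ht.2 i j k l
    · filter_upwards [hsmall] with t ht
      rw [cr_glue_same (by exact_mod_cast ht.1) hsame]
  have hi : ¬ (i ∈ S ↔ j ∈ S) := fun h => hsame (Or.inl h)
  have hk : ¬ (k ∈ S ↔ l ∈ S) := fun h => hsame (Or.inr h)
  by_cases hik' : i ∈ S ↔ k ∈ S
  · have hjl' : j ∈ S ↔ l ∈ S := by tauto
    obtain ⟨h1, h2⟩ := hsplit i j k l hik' hjl' hi
    rw [red_eq_zero.2 h1]
    apply tendsto_red_zero hδ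
    filter_upwards [hsmall] with t ht using h2 t ht.1 ht.2
  · have hil' : i ∈ S ↔ l ∈ S := by tauto
    have hjk' : j ∈ S ↔ k ∈ S := by tauto
    obtain ⟨h1, h2⟩ := hsplit i j l k hil' hjk' hi
    have h3 : red (cr (glue S w η) i j k l) = OnePoint.infty := by
      rw [red_eq_infty, cr_swap_right]
      intro hb
      have hne : cr (glue S w η) i j l k ≠ 0 :=
        cr_ne_zero (h.nondeg (hη.goodParam hη0)) hil hik hjl hjk
      exact (bdd_inv_iff hne).1 hb h1
    rw [h3]
    apply tendsto_red_infty hδ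
    filter_upwards [hsmall] with t ht
    have hg : GoodParam (t : ℝ*) := goodParam_coe ht.1 (by linarith [ht.2])
    refine ⟨cr_ne_zero (h.nondeg hg) hik hil hjk hjl, ?_⟩
    rw [← cr_swap_right]
    exact h2 t ht.1 ht.2

/-! ### Cyclic orders of glued configurations and the twist at a node -/

/-- The coordinates of a glued configuration are in the order given by a labelling. -/
structure GlueOrder (σ : Equiv.Perm (Fin n)) (S : Set (Fin n)) (w : Fin n → ℝ*) : Prop where
  initial : IsInitial σ S
  mono : ∀ a b, a < b → σ a ∈ S → σ b ∈ S → w (σ a) < w (σ b)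
  anti : ∀ a b, a < b → σ a ∉ S → σ b ∉ S → w (σ b) < w (σ a)

theorem IsInitial.mem_of_lt {σ : Equiv.Perm (Fin n)} (h : IsInitial σ S) {a b : Fin n}
    (hab : a < b) (hb : σ b ∈ S) : σ a ∈ S := by
  rw [h] at *
  exact lt_trans hab hb

theorem GlueOrder.agree {σ : Equiv.Perm (Fin n)} (ho : GlueOrder σ S w) (h : IsGlue S w)
    (hη : GoodParam η) (hpos : 0 < η) : Agree (glue S w η) σ := by
  refine (agree_of_sign (-1) (fun _ => 1) ?_).2
  intro a b hab
  rw [mul_one, mul_one, neg_one_mul, neg_pos]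
  by_cases hb : σ b ∈ S
  · have ha := ho.initial.mem_of_lt hab hb
    rw [br_glue_mem_mem ha hb]
    linarith [ho.mono a b hab ha hb]
  by_cases ha : σ a ∈ S
  · rw [br_glue_mem_notMem ha hb]
    linarith [(h.posUnit hη (σ a) (σ b)).1]
  · rw [br_glue_notMem_notMem ha hb]
    exact mul_neg_of_pos_of_neg hpos (by linarith [ho.anti a b hab ha hb])

/-- The permutation reversing an initial segment of length `s`. -/
def revInitial (n s : ℕ) : Equiv.Perm (Fin n) :=
  Function.Involutive.toPerm
    (fun a => if h : a.val < s ∧ s ≤ n then ⟨s - 1 - a.val, by omega⟩ else a) (by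
      intro a
      by_cases h : a.val < s ∧ s ≤ n
      · have : s - 1 - a.val < s ∧ s ≤ n := by omega
        simp only [h, and_self, dif_pos, this]
        ext
        simp only
        omega
      · simp only [h, dif_neg, not_false_iff])

theorem revInitial_of_lt {s : ℕ} (hs : s ≤ n) {a : Fin n} (h : a.val < s) :
    (revInitial n s a).val = s - 1 - a.val := by
  simp [revInitial, h, hs]

theorem revInitial_of_le {s : ℕ} {a : Fin n} (h : s ≤ a.val) : revInitial n s a = a :=
  dif_neg fun h' => not_lt.2 h h'.1

theorem ncard_le_of_fin (S : Set (Fin n)) : S.ncard ≤ n := by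
  have := Set.ncard_add_ncard_compl S
  rw [Nat.card_eq_fintype_card, Fintype.card_fin] at this
  omega

theorem IsInitial.twist {σ : Equiv.Perm (Fin n)} (h : IsInitial σ S) :
    IsInitial (σ * revInitial n S.ncard) S := by
  intro a
  rw [Equiv.Perm.mul_apply, h]
  by_cases ha : a.val < S.ncard
  · rw [revInitial_of_lt (ncard_le_of_fin S) ha]; omega
  · rw [revInitial_of_le (not_lt.1 ha)]

/-- A negative `η` changes the sign of the determinants outside `S`, and reversing `S` changes it
inside. The remaining sign, across the node, is absorbed by negating the vectors outside `S`. -/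
theorem GlueOrder.agree_twist {σ : Equiv.Perm (Fin n)} (ho : GlueOrder σ S w) (h : IsGlue S w)
    (hη : GoodParam η) (hneg : η < 0) : Agree (glue S w η) (σ * revInitial n S.ncard) := by
  classical
  set τ := σ * revInitial n S.ncard with hτ
  have hi : IsInitial τ S := ho.initial.twist
  have hmono : ∀ a b, a < b → τ a ∈ S → τ b ∈ S → w (τ b) < w (τ a) := by
    intro a b hab ha hb
    refine ho.mono _ _ ?_ hb ha
    rw [hi] at ha hb
    have hab' : a.val < b.val := hab
    rw [Fin.lt_def, revInitial_of_lt (ncard_le_of_fin S) ha,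
      revInitial_of_lt (ncard_le_of_fin S) hb]
    omega
  have hanti : ∀ a b, a < b → τ a ∉ S → τ b ∉ S → w (τ b) < w (τ a) := by
    intro a b hab ha hb
    refine ho.anti _ _ ?_ ha hb
    rw [hi] at ha hb
    rwa [revInitial_of_le (not_lt.1 ha), revInitial_of_le (not_lt.1 hb)]
  refine (agree_of_sign 1 (fun a => if τ a ∈ S then 1 else -1) ?_).2
  intro a b hab
  by_cases hb : τ b ∈ S
  · have ha := hi.mem_of_lt hab hb
    rw [br_glue_mem_mem ha hb]
    simp only [ha, hb, if_true, one_mul]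
    linarith [hmono a b hab ha hb]
  by_cases ha : τ a ∈ S
  · rw [br_glue_mem_notMem ha hb]
    simp only [ha, hb, if_true, if_false, one_mul]
    linarith [(h.posUnit hη (τ a) (τ b)).1]
  · rw [br_glue_notMem_notMem ha hb]
    simp only [ha, hb, if_false, one_mul]
    have := mul_pos_of_neg_of_neg hneg (show w (τ b) - w (τ a) < 0 by linarith [hanti a b hab ha hb])
    linarith

end

/-- A configuration in cyclic order is a glued configuration with respect to every initial
segment. -/
theorem Agree.exists_glue {m : ℕ} {X : HConf (m + 1)} (hX : Nondeg X)
    {σ : Equiv.Perm (Fin (m + 1))} (hσ : Agree X σ) {S : Set (Fin (m + 1))} (hS : IsInitial σ S)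
    (h2 : 2 ≤ S.ncard) (h3 : S.ncard + 2 ≤ m + 1) :
    ∃ w η, IsGlue S w ∧ GlueOrder σ S w ∧ 0 < η ∧ η < 1 ∧
      ∀ i j k l, cr (glue S w η) i j k l = cr X i j k l := by
  classical
  obtain ⟨x, hx, hxc⟩ := hσ.exists_strictMono hX
  set s := S.ncard with hs
  set pa : Fin (m + 1) := ⟨0, by omega⟩
  set pb : Fin (m + 1) := ⟨s - 1, by omega⟩
  set pc : Fin (m + 1) := ⟨s, by omega⟩
  set pe : Fin (m + 1) := ⟨m, by omega⟩
  have haS : σ pa ∈ S := by rw [hS]; change 0 < s; omega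
  have hbS : σ pb ∈ S := by rw [hS]; change s - 1 < s; omega
  have hcS : σ pc ∉ S := by rw [hS]; change ¬ s < s; omega
  have heS : σ pe ∉ S := by rw [hS]; change ¬ m < s; omega
  have hmono : ∀ {i j}, i < j → x (σ i) < x (σ j) := fun h => hx h
  have hmono' : ∀ {i j}, i ≤ j → x (σ i) ≤ x (σ j) := fun h => hx.monotone h
  have hab : x (σ pa) < x (σ pb) := hmono (show 0 < s - 1 by omega)
  have hbc : x (σ pb) < x (σ pc) := hmono (show s - 1 < s by omega)
  have hce : x (σ pc) < x (σ pe) := hmono (show s < m by omega)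
  have hSle : ∀ i ∈ S, x (σ pa) ≤ x i ∧ x i ≤ x (σ pb) := by
    intro i hi
    obtain ⟨p, rfl⟩ := σ.surjective i
    rw [hS] at hi
    exact ⟨hmono' (show 0 ≤ p.val by omega), hmono' (show p.val ≤ s - 1 by omega)⟩
  have hSle' : ∀ i, i ∉ S → x (σ pc) ≤ x i ∧ x i ≤ x (σ pe) := by
    intro i hi
    obtain ⟨p, rfl⟩ := σ.surjective i
    rw [hS] at hi
    exact ⟨hmono' (show s ≤ p.val by omega), hmono' (show p.val ≤ m by omega)⟩
  set a := x (σ pa) with ha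
  set b := x (σ pb) with hb
  set c := x (σ pc) with hc
  set e := x (σ pe) with he
  have h1 : 0 < b - a := by linarith
  have h2' : 0 < e - b := by linarith
  have h3' : 0 < c - a := by linarith
  have h4 : 0 < e - c := by linarith
  have h5 : 0 < e - a := by linarith
  -- Here `a`, `b` are the extreme points of `S` and `c`, `e` those of its complement. On `S` the
  -- Möbius coordinate sends `a`, `b`, `e` to `0`, `1`, infinity; on the complement `e`, `c`, `a`
  -- are sent there. The two coordinates of one point have product `η⁻¹`.
  set w : Fin (m + 1) → ℝ* := fun i => if i ∈ S then ((x i - a) * (e - b)) / ((e - x i) * (b - a))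
    else ((e - x i) * (c - a)) / ((x i - a) * (e - c)) with hw
  set η : ℝ* := ((b - a) * (e - c)) / ((c - a) * (e - b)) with hη
  have hwS : ∀ i ∈ S, w i = ((x i - a) * (e - b)) / ((e - x i) * (b - a)) := fun i hi => if_pos hi
  have hwS' : ∀ i, i ∉ S → w i = ((e - x i) * (c - a)) / ((x i - a) * (e - c)) :=
    fun i hi => if_neg hi
  have hSpos : ∀ i ∈ S, 0 < e - x i := fun i hi => by linarith [(hSle i hi).2]
  have hSpos' : ∀ i, i ∉ S → 0 < x i - a := fun i hi => by linarith [(hSle' i hi).1]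
  have hlt : ∀ i ∈ S, ∀ j ∈ S, x i < x j → w i < w j := by
    intro i hi j hj hij
    rw [hwS i hi, hwS j hj, div_lt_div_iff₀ (mul_pos (hSpos i hi) h1) (mul_pos (hSpos j hj) h1)]
    have : 0 < (e - b) * (b - a) * ((e - a) * (x j - x i)) :=
      mul_pos (mul_pos h2' h1) (mul_pos h5 (by linarith))
    linear_combination this
  have hlt' : ∀ i, i ∉ S → ∀ j, j ∉ S → x i < x j → w j < w i := by
    intro i hi j hj hij
    rw [hwS' i hi, hwS' j hj, div_lt_div_iff₀ (mul_pos (hSpos' j hj) h4) (mul_pos (hSpos' i hi) h4)]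
    have : 0 < (c - a) * (e - c) * ((e - a) * (x j - x i)) :=
      mul_pos (mul_pos h3' h4) (mul_pos h5 (by linarith))
    linear_combination this
  have hxinj : Function.Injective x := by
    intro i j hij
    have := hx.injective (a₁ := σ.symm i) (a₂ := σ.symm j) (by simpa using hij)
    exact σ.symm.injective this
  have hwa : w (σ pa) = 0 := by rw [hwS _ haS, ← ha, sub_self, zero_mul, zero_div]
  have hwb : w (σ pb) = 1 := by
    rw [hwS _ hbS, ← hb, mul_comm]
    exact div_self (mul_pos h2' h1).ne'
  have hwe : w (σ pe) = 0 := by rw [hwS' _ heS, ← he, sub_self, zero_mul, zero_div]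
  have hwc : w (σ pc) = 1 := by
    rw [hwS' _ hcS, ← hc, mul_comm]
    exact div_self (mul_pos h3' h4).ne'
  have hle : ∀ i ∈ S, ∀ j ∈ S, x i ≤ x j → w i ≤ w j := by
    intro i hi j hj hij
    rcases hij.eq_or_lt with h | h
    · rw [hxinj h]
    · exact (hlt i hi j hj h).le
  have hle' : ∀ i, i ∉ S → ∀ j, j ∉ S → x i ≤ x j → w j ≤ w i := by
    intro i hi j hj hij
    rcases hij.eq_or_lt with h | h
    · rw [hxinj h]
    · exact (hlt' i hi j hj h).le
  have hη0 : 0 < η := div_pos (mul_pos h1 h4) (mul_pos h3' h2')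
  have hη1 : η < 1 := by
    rw [hη, div_lt_one (mul_pos h3' h2')]
    have : 0 < (e - a) * (c - b) := mul_pos h5 (by linarith)
    linear_combination this
  refine ⟨w, η, ⟨?_, ?_, ?_, ?_, ⟨_, haS, hwa⟩, ⟨_, hbS, hwb⟩, ⟨_, heS, hwe⟩, ⟨_, hcS, hwc⟩⟩,
    ⟨hS, ?_, ?_⟩, hη0, hη1, ?_⟩
  · intro i
    by_cases hi : i ∈ S
    · rw [← hwa]; exact hle _ haS _ hi (hSle i hi).1
    · rw [← hwe]; exact hle' _ hi _ heS (hSle' i hi).2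
  · intro i
    by_cases hi : i ∈ S
    · rw [← hwb]; exact hle _ hi _ hbS (hSle i hi).2
    · rw [← hwc]; exact hle' _ hcS _ hi (hSle' i hi).1
  · intro i hi j hj hij
    rcases lt_trichotomy (x i) (x j) with h | h | h
    · exact absurd hij (hlt i hi j hj h).ne
    · exact hxinj h
    · exact absurd hij (hlt j hj i hi h).ne'
  · intro i hi j hj hij
    rcases lt_trichotomy (x i) (x j) with h | h | h
    · exact absurd hij (hlt' i hi j hj h).ne'
    · exact hxinj h
    · exact absurd hij (hlt' j hj i hi h).ne
  · exact fun p q hpq hp hq => hlt _ hp _ hq (hmono hpq)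
  · exact fun p q hpq hp hq => hlt' _ hp _ hq (hmono hpq)
  · intro i j k l
    rw [← hxc]
    -- `κ` is the determinant of the Möbius map used on `S`, and `f` normalises one homogeneous
    -- coordinate to `1`: the second on `S`, the first outside.
    apply cr_eq_of_scale (κ := (e - b) * (b - a) * (e - a))
      (f := fun i => if i ∈ S then ((e - x i) * (b - a))⁻¹ else ((x i - a) * (e - b))⁻¹)
      (mul_pos (mul_pos h2' h1) h5).ne'
    · intro i
      by_cases hi : i ∈ S
      · simp only [hi, if_true]; exact inv_ne_zero (mul_pos (hSpos i hi) h1).ne'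
      · simp only [hi, if_false]; exact inv_ne_zero (mul_pos (hSpos' i hi) h2').ne'
    have h1n := h1.ne'
    have h2n := h2'.ne'
    have h3n := h3'.ne'
    have h4n := h4.ne'
    intro i j
    by_cases hi : i ∈ S <;> by_cases hj : j ∈ S
    · have hin := (hSpos i hi).ne'
      have hjn := (hSpos j hj).ne'
      rw [br_glue_mem_mem hi hj, hwS i hi, hwS j hj]
      simp only [hi, hj, if_true, br]
      field_simp
      ring
    · have hin := (hSpos i hi).ne'
      have hjn := (hSpos' j hj).ne'
      rw [br_glue_mem_notMem hi hj, hwS i hi, hwS' j hj, hη]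
      simp only [hi, hj, if_true, if_false, br]
      field_simp
      ring
    · have hin := (hSpos' i hi).ne'
      have hjn := (hSpos j hj).ne'
      rw [br_glue_notMem_mem hi hj, hwS' i hi, hwS j hj, hη]
      simp only [hi, hj, if_true, if_false, br]
      field_simp
      ring
    · have hin := (hSpos' i hi).ne'
      have hjn := (hSpos' j hj).ne'
      rw [br_glue_notMem_notMem hi hj, hwS' i hi, hwS' j hj, hη]
      simp only [hi, hj, if_false, br]
      field_simp
      ring

/-! ### Smoothing a node -/

theorem exists_mem_Icc_of_wNonneg {d : ℝ*} (h0 : WNonneg d) (h1 : WNonneg (1 - d)) :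
    ∃ r : ℝ, 0 ≤ r ∧ r ≤ 1 ∧ Negl (d - r) := by
  have hb : Bdd d := by
    rcases h0 with h0 | h0
    · rcases h1 with h1 | h1
      · exact bdd_of_mem_Icc h0 (by linarith)
      · have := bdd_one.sub h1.bdd
        rwa [sub_sub_cancel] at this
    · exact h0.bdd
  obtain ⟨r, hr⟩ := hb.exists_st
  refine ⟨r, (wNonneg_iff hr).1 h0, ?_, hr⟩
  have : Negl (1 - d - ((1 - r : ℝ) : ℝ*)) := by
    rw [← negl_neg_iff, coe_sub, coe_one]; convert hr using 1; ring
  have := (wNonneg_iff this).1 h1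
  linarith

theorem wNonneg_one_sub {d : ℝ*} {r : ℝ} (hr : Negl (d - r)) (h1 : r ≤ 1) : WNonneg (1 - d) := by
  have : Negl (1 - d - ((1 - r : ℝ) : ℝ*)) := by
    rw [← negl_neg_iff, coe_sub, coe_one]; convert hr using 1; ring
  exact (wNonneg_iff this).2 (by linarith)

/-- Ties are allowed, since labels separated only by infinitesimals have equal standard parts. -/
theorem monotoneOn_or_antitoneOn_of_between {α : Type*} [LinearOrder α] {f : α → ℝ} {P : Set α}
    (h : ∀ a ∈ P, ∀ b ∈ P, ∀ c ∈ P, a < b → b < c →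
      ∃ r : ℝ, 0 ≤ r ∧ r ≤ 1 ∧ f b - f c = r * (f a - f c)) :
    MonotoneOn f P ∨ AntitoneOn f P := by
  by_contra hcon
  rw [not_or] at hcon
  obtain ⟨a, ha, b, hb, c, hc, hab, hbc, hh⟩ :=
    Set.not_monotoneOn_not_antitoneOn_iff_exists_lt_lt.1 hcon
  obtain ⟨r, h0, h1, hr⟩ := h a ha b hb c hc hab hbc
  rcases hh with ⟨h2, h3⟩ | ⟨h2, h3⟩
  · rcases le_or_gt 0 (f a - f c) with h4 | h4
    · nlinarith
    · nlinarith
  · rcases le_or_gt 0 (f a - f c) with h4 | h4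
    · nlinarith
    · nlinarith

section

variable {n : ℕ} {S : Set (Fin n)} {w : Fin n → ℝ*} {η : ℝ*}

/-- Without a surviving power of the parameter, changing it only multiplies the cross-ratio by a
positive unit. -/
theorem IsGlue.wNonneg_cr (h : IsGlue S w) {η' : ℝ*} (hη : GoodParam η) (hη' : GoodParam η')
    {i j k l : Fin n} (hs : (i ∈ S ↔ j ∈ S) ∨ (k ∈ S ↔ l ∈ S))
    (hw : WNonneg (cr (glue S w η) i j k l)) : WNonneg (cr (glue S w η') i j k l) := by
  rw [cr_glue_same hη.1 hs] at hw
  rw [cr_glue_same hη'.1 hs]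
  have hp := h.posUnit_crFactor hη i j k l
  have := hw.mul_posUnit hp.inv
  rw [mul_assoc, mul_inv_cancel₀ hp.1.ne', mul_one] at this
  exact this.mul_posUnit (h.posUnit_crFactor hη' i j k l)

/-- Seen from one side of the node, every label of the other side is at infinity. The cross-ratio of
three labels with such a label is, up to a factor near `1`, a ratio of differences of coordinates.
-/
theorem IsGlue.between (h : IsGlue S w) (hη0 : η ≠ 0) (hη : Negl η) {τ : Equiv.Perm (Fin n)}
    (hτ : WeakAgree (glue S w η) τ) (hS : IsInitial τ S) {U : Fin n → ℝ}
    (hU : ∀ i, Negl (w i - U i)) :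
    (∀ i j k, i < j → j < k → τ k ∈ S →
      ∃ r : ℝ, 0 ≤ r ∧ r ≤ 1 ∧ U (τ j) - U (τ k) = r * (U (τ i) - U (τ k))) ∧
    (∀ i j k, i < j → j < k → τ i ∉ S →
      ∃ r : ℝ, 0 ≤ r ∧ r ≤ 1 ∧ U (τ j) - U (τ k) = r * (U (τ i) - U (τ k))) := by
  have hlim : ∀ i j, Negl (w i - w j - ((U i - U j : ℝ) : ℝ*)) := by
    intro i j
    have := (hU i).sub (hU j)
    rw [coe_sub]; convert this using 1; ring
  have hratio : ∀ {p q p' q' : Fin n} {r : ℝ}, w p' - w q' ≠ 0 →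
      Negl ((w p - w q) / (w p' - w q') - r) → U p - U q = r * (U p' - U q') := by
    intro p q p' q' r hne hr
    have h1 := hr.mul_bdd ((h.bdd p').sub (h.bdd q'))
    rw [sub_mul, div_mul_cancel₀ _ hne] at h1
    have h2 := (h1.sub (hlim p q)).add ((bdd_coe r).mul_negl (hlim p' q'))
    have h3 : Negl (((U p - U q - r * (U p' - U q') : ℝ)) : ℝ*) := by
      rw [coe_sub, coe_mul]; convert h2 using 1; ring
    have := negl_coe_iff.1 h3
    linarith
  have hne' : ∀ {a b}, a < b → τ a ≠ τ b := fun hab e => hab.ne (τ.injective e)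
  have hdiv : ∀ {A M : ℝ*} {r : ℝ}, NearOne M → Negl (A * M - r) → Negl (A - r) := by
    intro A M r hM hr
    have hb := bdd_of_negl_sub hr
    have h1 := hb.mul_negl (show Negl (M⁻¹ - 1) from hM.inv)
    have h2 := hr.add h1
    convert h2 using 1
    have := hM.ne_zero
    field_simp
    ring
  obtain ⟨e₀, he₀, -⟩ := h.zero_compl
  obtain ⟨a₀, ha₀, -⟩ := h.zero
  obtain ⟨pe, rfl⟩ := τ.surjective e₀
  obtain ⟨pa, rfl⟩ := τ.surjective a₀
  constructor
  · intro i j k hij hjk hk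
    have hj := hS.mem_of_lt hjk hk
    have hi := hS.mem_of_lt hij hj
    have hke : k < pe := by
      by_contra hcon
      rcases (not_lt.1 hcon).eq_or_lt with e | e
      · exact he₀ (e ▸ hk)
      · exact he₀ (hS.mem_of_lt e hk)
    obtain ⟨r, h0, h1, hr⟩ := hτ i j k pe hij hjk hke
    refine ⟨r, h0, h1, hratio ?_ ?_⟩
    · exact sub_ne_zero.2 fun e => hne' (hij.trans hjk) (h.injOn hi hk e)
    · rw [cr_glue_same hη0 (Or.inl (by simp [hi, hj]))] at hr
      have := hdiv (h.nearOne_crFactor hη _ _ _ _) hr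
      have he₀' : τ pe ∉ S := he₀
      simp only [limBr, hi, hj, hk, he₀', if_true, if_false] at this
      convert this using 2
      rw [mul_neg_one, neg_one_mul, neg_div_neg_eq]
  · intro i j k hij hjk hi
    have hj : τ j ∉ S := fun hj => hi (hS.mem_of_lt hij hj)
    have hk : τ k ∉ S := fun hk => hj (hS.mem_of_lt hjk hk)
    have hai : pa < i := by
      by_contra hcon
      rcases (not_lt.1 hcon).eq_or_lt with e | e
      · exact hi (e ▸ ha₀)
      · exact hi (hS.mem_of_lt e ha₀)
    obtain ⟨r, h0, h1, hr⟩ := hτ pa i j k hai hij hjk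
    have h2 : U (τ j) - U (τ i) = r * (U (τ k) - U (τ i)) := by
      apply hratio
      · exact sub_ne_zero.2 fun e => hne' (hij.trans hjk) (h.injOn_compl hk hi e).symm
      · rw [cr_glue_same hη0 (Or.inr (by simp [hj, hk]))] at hr
        have := hdiv (h.nearOne_crFactor hη _ _ _ _) hr
        simp only [limBr, hi, hj, hk, ha₀, if_true, if_false] at this
        convert this using 2
        rw [neg_one_mul, neg_one_mul, neg_div_neg_eq]
    -- On this side the label at infinity precedes the other three, so the ratio is measured from
    -- `i` and has to be turned around.
    exact ⟨1 - r, by linarith, by linarith, by linear_combination h2⟩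

/-- On each side of the node the standard parts `U` run monotonically along `τ`. Only cross-ratios
with two labels on each side feel the sign of `t`. Opposite directions of the two sides are
compatible with `t > 0`, equal directions with `t < 0`. -/
theorem IsGlue.weakAgree_smoothing (h : IsGlue S w) (hη0 : η ≠ 0) (hη : Negl η)
    {τ : Equiv.Perm (Fin n)} (hτ : WeakAgree (glue S w η) τ) (hS : IsInitial τ S) :
    (∀ t : ℝ, 0 < t → t < 1 → WeakAgree (glue S w (t : ℝ*)) τ) ∨
      (∀ t : ℝ, -1 < t → t < 0 → WeakAgree (glue S w (t : ℝ*)) τ) := by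
  choose U hU using fun i => (h.bdd i).exists_st
  obtain ⟨hb1, hb2⟩ := h.between hη0 hη hτ hS hU
  have hm1 : MonotoneOn (U ∘ τ) {a | τ a ∈ S} ∨ AntitoneOn (U ∘ τ) {a | τ a ∈ S} :=
    monotoneOn_or_antitoneOn_of_between fun a _ b _ c hc hab hbc => hb1 a b c hab hbc hc
  have hm2 : MonotoneOn (U ∘ τ) {a | τ a ∉ S} ∨ AntitoneOn (U ∘ τ) {a | τ a ∉ S} :=
    monotoneOn_or_antitoneOn_of_between fun a ha b _ c _ hab hbc => hb2 a b c hab hbc ha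
  have main : ∀ t : ℝ, t ≠ 0 → |t| < 1 →
      (∀ i j k l, i < j → k < l → τ i ∈ S → τ j ∈ S → τ k ∉ S → τ l ∉ S →
        0 ≤ t * ((U (τ i) - U (τ j)) * (U (τ l) - U (τ k)))) →
      WeakAgree (glue S w (t : ℝ*)) τ := by
    intro t ht0 ht1 hsign i j k l hij hjk hkl
    have hg := goodParam_coe ht0 ht1
    have hgη := hη.goodParam hη0
    have hne : ∀ {a b}, a < b → τ a ≠ τ b := fun hab e => hab.ne (τ.injective e)
    obtain ⟨r, h0, h1, hr⟩ := hτ i j k l hij hjk hkl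
    have hs1 : (τ i ∈ S ↔ τ j ∈ S) ∨ (τ l ∈ S ↔ τ k ∈ S) := by
      have := @IsInitial.mem_of_lt _ _ _ hS _ _ hij
      have := @IsInitial.mem_of_lt _ _ _ hS _ _ hjk
      have := @IsInitial.mem_of_lt _ _ _ hS _ _ hkl
      tauto
    have hd0 := h.wNonneg_cr hgη hg hs1 ((wNonneg_iff hr).2 h0)
    refine exists_mem_Icc_of_wNonneg hd0 ?_
    rw [one_sub_cr (h.nondeg hg) (hne (hij.trans hjk)) (hne (hjk.trans hkl))]
    -- In the second case `i`, `j` are in `S` and `k`, `l` are not, because `S` is initial; there `1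
    -- - cr` carries the factor `t`.
    by_cases hs2 : (τ i ∈ S ↔ τ l ∈ S) ∨ (τ j ∈ S ↔ τ k ∈ S)
    · refine h.wNonneg_cr hgη hg hs2 ?_
      rw [← one_sub_cr (h.nondeg hgη) (hne (hij.trans hjk)) (hne (hjk.trans hkl))]
      exact wNonneg_one_sub hr h1
    · have hjS : τ j ∈ S := by
        have := @IsInitial.mem_of_lt _ _ _ hS _ _ hjk
        tauto
      have hiS := hS.mem_of_lt hij hjS
      have hkS : τ k ∉ S := by tauto
      have hlS : τ l ∉ S := by tauto
      rw [cr_glue_split (by simp [hiS, hjS]) (by simp [hlS, hkS]) (by simp [hiS, hlS]),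
        ← mul_assoc]
      refine WNonneg.mul_posUnit ?_ (h.posUnit_crFactor hg _ _ _ _)
      simp only [limBr, hiS, hjS, hkS, hlS, if_true, if_false]
      refine (wNonneg_iff (r := t * ((U (τ i) - U (τ j)) * (U (τ l) - U (τ k)))) ?_).2
        (hsign i j k l hij hkl hiS hjS hkS hlS)
      have e1 := (hU (τ i)).sub (hU (τ j))
      have e2 := (hU (τ l)).sub (hU (τ k))
      have e3 := (bdd_coe t).mul_negl (e1.mul_bdd ((h.bdd (τ l)).sub (h.bdd (τ k))))
      have e4 := (bdd_coe t).mul_negl (((bdd_coe (U (τ i))).sub (bdd_coe (U (τ j)))).mul_negl e2)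
      have e5 := e3.add e4
      convert e5 using 1
      simp only [coe_mul, coe_sub]
      ring
  rcases hm1 with hm1 | hm1 <;> rcases hm2 with hm2 | hm2
  · right
    intro t ht ht0
    refine main t ht0.ne (abs_lt.2 ⟨ht, by linarith⟩) ?_
    intro i j k l hij hkl hi hj hk hl
    have e1 : U (τ i) ≤ U (τ j) := hm1 hi hj hij.le
    have e2 : U (τ k) ≤ U (τ l) := hm2 hk hl hkl.le
    exact mul_nonneg_of_nonpos_of_nonpos ht0.le
      (mul_nonpos_of_nonpos_of_nonneg (by linarith) (by linarith))
  · left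
    intro t ht0 ht
    refine main t ht0.ne' (abs_lt.2 ⟨by linarith, ht⟩) ?_
    intro i j k l hij hkl hi hj hk hl
    have e1 : U (τ i) ≤ U (τ j) := hm1 hi hj hij.le
    have e2 : U (τ l) ≤ U (τ k) := hm2 hk hl hkl.le
    exact mul_nonneg ht0.le (mul_nonneg_of_nonpos_of_nonpos (by linarith) (by linarith))
  · left
    intro t ht0 ht
    refine main t ht0.ne' (abs_lt.2 ⟨by linarith, ht⟩) ?_
    intro i j k l hij hkl hi hj hk hl
    have e1 : U (τ j) ≤ U (τ i) := hm1 hi hj hij.le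
    have e2 : U (τ k) ≤ U (τ l) := hm2 hk hl hkl.le
    exact mul_nonneg ht0.le (mul_nonneg (by linarith) (by linarith))
  · right
    intro t ht ht0
    refine main t ht0.ne (abs_lt.2 ⟨ht, by linarith⟩) ?_
    intro i j k l hij hkl hi hj hk hl
    have e1 : U (τ j) ≤ U (τ i) := hm1 hi hj hij.le
    have e2 : U (τ l) ≤ U (τ k) := hm2 hk hl hkl.le
    exact mul_nonneg_of_nonpos_of_nonpos ht0.le
      (mul_nonpos_of_nonneg_of_nonpos (by linarith) (by linarith))

/-- In the twisted order, the labels with coordinates `1`, `0` in `S` and `1`, `0` outside have the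
cross-ratio `(1 - t)⁻¹ > 1`. -/
theorem GlueOrder.not_weakAgree_twist {σ : Equiv.Perm (Fin n)} (ho : GlueOrder σ S w)
    (h : IsGlue S w) {t : ℝ} (ht0 : 0 < t) (ht1 : t < 1) :
    ¬ WeakAgree (glue S w (t : ℝ*)) (σ * revInitial n S.ncard) := by
  intro hw
  obtain ⟨a, ha, hwa⟩ := h.zero
  obtain ⟨b, hb, hwb⟩ := h.one
  obtain ⟨e, he, hwe⟩ := h.zero_compl
  obtain ⟨c, hc, hwc⟩ := h.one_compl
  set τ := σ * revInitial n S.ncard with hτ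
  have hi : IsInitial τ S := ho.initial.twist
  obtain ⟨pa, rfl⟩ := τ.surjective a
  obtain ⟨pb, rfl⟩ := τ.surjective b
  obtain ⟨pc, rfl⟩ := τ.surjective c
  obtain ⟨pe, rfl⟩ := τ.surjective e
  have hba : pb < pa := by
    by_contra hcon
    rcases (not_lt.1 hcon).eq_or_lt with h1 | h1
    · rw [h1, hwb] at hwa; exact one_ne_zero hwa
    have := ho.mono (revInitial n S.ncard pb) (revInitial n S.ncard pa) ?_ hb ha
    · change w (τ pb) < w (τ pa) at this
      rw [hwa, hwb] at this
      exact absurd this (by norm_num)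
    · rw [hi] at ha hb
      have h1' : pa.val < pb.val := h1
      rw [Fin.lt_def, revInitial_of_lt (ncard_le_of_fin S) ha,
        revInitial_of_lt (ncard_le_of_fin S) hb]
      omega
  have hac : pa < pc := by
    by_contra hcon
    rcases (not_lt.1 hcon).eq_or_lt with h1 | h1
    · exact hc (h1 ▸ ha)
    · exact hc (hi.mem_of_lt h1 ha)
  have hce : pc < pe := by
    by_contra hcon
    rcases (not_lt.1 hcon).eq_or_lt with h1 | h1
    · rw [h1, hwc] at hwe; exact one_ne_zero hwe
    have h2 : ∀ p, τ p ∉ S → revInitial n S.ncard p = p := by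
      intro p hp
      rw [hi] at hp
      exact revInitial_of_le (not_lt.1 hp)
    have := ho.anti (revInitial n S.ncard pe) (revInitial n S.ncard pc)
      (by rw [h2 _ he, h2 _ hc]; exact h1) he hc
    change w (τ pc) < w (τ pe) at this
    rw [hwc, hwe] at this
    exact absurd this (by norm_num)
  obtain ⟨r, h0, h1, hr⟩ := hw pb pa pc pe hba hac hce
  have he' : τ pe ∉ S := he
  have hc' : τ pc ∉ S := hc
  have e1 : cr (glue S w (t : ℝ*)) (τ pb) (τ pa) (τ pe) (τ pc) = (((1 - t)⁻¹ : ℝ) : ℝ*) := by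
    unfold cr
    rw [br_glue_mem_notMem hb he', br_glue_mem_notMem ha hc', br_glue_mem_notMem hb hc',
      br_glue_mem_notMem ha he', hwa, hwb, hwc, hwe]
    simp [coe_inv, coe_sub]
  rw [e1] at hr
  have h2 : Negl ((((1 - t)⁻¹ : ℝ) : ℝ*) - ((1 - t)⁻¹ : ℝ)) := by
    rw [sub_self]; exact negl_zero
  have h3 := eq_of_negl_sub h2 hr
  have h4 : 1 < (1 - t)⁻¹ := (one_lt_inv₀ (by linarith)).2 (by linarith)
  linarith

end

/-! ### Smoothings and the description of associahedra by weak agreement -/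

/-- A node of a point of an associahedron can be smoothed in two ways. -/
structure Smoothing {m : ℕ} (σ : Equiv.Perm (Fin (m + 1))) (S : Set (Fin (m + 1)))
    (p : ModuliBar (m + 1)) (q : ℝ → ModuliBar (m + 1)) : Prop where
  tendsto : Tendsto q (𝓝[≠] 0) (𝓝 p)
  pos : ∀ t, 0 < t → t < 1 → q t ∈ associahedron σ
  neg : ∀ t, -1 < t → t < 0 → q t ∈ associahedron (σ * revInitial (m + 1) S.ncard)
  nodes : ∀ t, t ≠ 0 → |t| < 1 → nodes (q t) = nodes p \ {S, Sᶜ}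
  weak : ∀ τ, p.WeakAgree τ → IsInitial τ S → (∀ t, 0 < t → t < 1 → (q t).WeakAgree τ) ∨
    (∀ t, -1 < t → t < 0 → (q t).WeakAgree τ)
  not_twist : ∀ t, 0 < t → t < 1 → q t ∉ associahedron (σ * revInitial (m + 1) S.ncard)

/-- In the glued form of a representative the infinitesimal parameter is replaced by the real number
`t`. -/
theorem exists_smoothing {m : ℕ} {σ : Equiv.Perm (Fin (m + 1))} {S : Set (Fin (m + 1))}
    {p : ModuliBar (m + 1)} (hp : p ∈ associahedron σ) (hS : S ∈ nodes p) (hi : IsInitial σ S) :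
    ∃ q, Smoothing σ S p q := by
  classical
  obtain ⟨X, hXp, hX⟩ := exists_rep_of_mem_associahedron hp
  have hSX : NodeX X S := (hXp.hasNode_iff S).1 hS
  obtain ⟨h2, h3⟩ := hSX.ncard_bounds
  obtain ⟨w, η, hg, ho, hη0, hη1, hc⟩ := hX.exists_glue hXp.1 hi h2 h3
  have hη : Negl η := hg.nodeX_self_iff.1 ((NodeX.congr hc).2 hSX)
  have hgood := hη.goodParam hη0.ne'
  have hrep : Rep (glue S w η) p := ⟨hg.nondeg hgood, fun Q => by rw [hc]; exact hXp.2 Q⟩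
  have hex : ∀ t : ℝ, ∃ q, t ≠ 0 → |t| < 1 → Rep (glue S w (t : ℝ*)) q ∧
      (0 < t → q ∈ associahedron σ) ∧
      (t < 0 → q ∈ associahedron (σ * revInitial (m + 1) S.ncard)) := by
    intro t
    by_cases h : t ≠ 0 ∧ |t| < 1
    · have hgt := goodParam_coe h.1 h.2
      rcases lt_or_gt_of_ne h.1 with ht | ht
      · obtain ⟨q, hq, hqr⟩ := (ho.agree_twist hg hgt (by exact_mod_cast ht)).exists_point
          (hg.nondeg hgt)
        exact ⟨q, fun _ _ => ⟨hqr, fun h => absurd h (not_lt.2 ht.le), fun _ => hq⟩⟩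
      · obtain ⟨q, hq, hqr⟩ := (ho.agree hg hgt (by exact_mod_cast ht)).exists_point
          (hg.nondeg hgt)
        exact ⟨q, fun _ _ => ⟨hqr, fun _ => hq, fun h => absurd h (not_lt.2 ht.le)⟩⟩
    -- For parameters outside the admissible range any point will do.
    · exact ⟨p, fun h1 h2 => absurd ⟨h1, h2⟩ h⟩
  choose q hq using hex
  have hpos : ∀ t : ℝ, 0 < t → t < 1 → t ≠ 0 ∧ |t| < 1 := fun t h0 h1 =>
    ⟨h0.ne', abs_lt.2 ⟨by linarith, h1⟩⟩
  have hneg : ∀ t : ℝ, -1 < t → t < 0 → t ≠ 0 ∧ |t| < 1 := fun t h0 h1 =>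
    ⟨h1.ne, abs_lt.2 ⟨h0, by linarith⟩⟩
  refine ⟨q, ⟨?_, fun t h0 h1 => ?_, fun t h0 h1 => ?_, fun t h0 h1 => ?_, fun τ hτ hτS => ?_,
    fun t h0 h1 => ?_⟩⟩
  · rw [tendsto_moduliBar]
    intro Q
    have hQ : ∀ {a b}, a ≠ b → Q a ≠ Q b := fun hab e => hab (Q.injective e)
    have := hg.tendsto_red_cr hη0.ne' hη (Q 0) (Q 1) (Q 2) (Q 3) (hQ (by decide)) (hQ (by decide))
      (hQ (by decide)) (hQ (by decide))
    rw [hrep.2]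
    refine this.congr' ?_
    have h1 : ∀ᶠ t : ℝ in 𝓝[≠] 0, t ≠ 0 := self_mem_nhdsWithin
    have h2 : ∀ᶠ t : ℝ in 𝓝[≠] 0, |t| < 1 := by
      apply nhdsWithin_le_nhds
      have : Tendsto (fun t : ℝ => |t|) (𝓝 0) (𝓝 |0|) := continuous_abs.tendsto 0
      rw [abs_zero] at this
      exact this.eventually (gt_mem_nhds one_pos)
    filter_upwards [h1, h2] with t h1 h2
    rw [(hq t h1 h2).1.2]
  · have := hpos t h0 h1
    exact (hq t this.1 this.2).2.1 h0
  · have := hneg t h0 h1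
    exact (hq t this.1 this.2).2.2 h1
  · ext T
    have hgt := goodParam_coe h0 h1
    have e1 : T ∈ RealModuli.nodes (q t) ↔ NodeX (glue S w (t : ℝ*)) T :=
      (hq t h0 h1).1.hasNode_iff T
    have e2 : T ∈ RealModuli.nodes p ↔ NodeX (glue S w η) T := hrep.hasNode_iff T
    have hnS : ¬ NodeX (glue S w (t : ℝ*)) S := by
      rw [hg.nodeX_self_iff, negl_coe_iff]; exact h0
    rw [Set.mem_sdiff, e1, e2, Set.mem_insert_iff, Set.mem_singleton_iff, not_or]
    constructor
    · intro hT
      have hT1 : T ≠ S := by rintro rfl; exact hnS hT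
      have hT2 : T ≠ Sᶜ := by
        rintro rfl
        have := hT.compl
        rw [compl_compl] at this
        exact hnS this
      exact ⟨hg.nodeX_of_nodeX hgt hgood hT1 hT2 hT, hT1, hT2⟩
    · rintro ⟨hT, hT1, hT2⟩
      exact hg.nodeX_of_nodeX hgood hgt hT1 hT2 hT
  · rw [hrep.weakAgree_iff] at hτ
    refine (hg.weakAgree_smoothing hη0.ne' hη hτ hτS).imp (fun H t h0 h1 => ?_)
      (fun H t h0 h1 => ?_)
    · have := hpos t h0 h1
      exact (hq t this.1 this.2).1.weakAgree_iff.2 (H t h0 h1)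
    · have := hneg t h0 h1
      exact (hq t this.1 this.2).1.weakAgree_iff.2 (H t h0 h1)
  · intro hmem
    have := hpos t h0 h1
    exact ho.not_weakAgree_twist hg h0 h1
      ((hq t this.1 this.2).1.weakAgree_iff.1 (weakAgree_of_mem_associahedron hmem))

theorem Smoothing.mem_closure_pos {m : ℕ} {σ : Equiv.Perm (Fin (m + 1))} {S : Set (Fin (m + 1))}
    {p : ModuliBar (m + 1)} {q : ℝ → ModuliBar (m + 1)} (h : Smoothing σ S p q)
    {A : Set (ModuliBar (m + 1))} (hA : ∀ t, 0 < t → t < 1 → q t ∈ A) : p ∈ closure A := by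
  have h1 : Tendsto q (𝓝[>] 0) (𝓝 p) :=
    h.tendsto.mono_left (nhdsWithin_mono _ fun t ht => (ne_of_gt ht : t ≠ 0))
  refine mem_closure_of_tendsto h1 ?_
  filter_upwards [Ioo_mem_nhdsGT (show (0 : ℝ) < 1 from one_pos)] with t ht using hA t ht.1 ht.2

theorem Smoothing.mem_closure_neg {m : ℕ} {σ : Equiv.Perm (Fin (m + 1))} {S : Set (Fin (m + 1))}
    {p : ModuliBar (m + 1)} {q : ℝ → ModuliBar (m + 1)} (h : Smoothing σ S p q)
    {A : Set (ModuliBar (m + 1))} (hA : ∀ t, -1 < t → t < 0 → q t ∈ A) : p ∈ closure A := by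
  have h1 : Tendsto q (𝓝[<] 0) (𝓝 p) :=
    h.tendsto.mono_left (nhdsWithin_mono _ fun t ht => (ne_of_lt ht : t ≠ 0))
  refine mem_closure_of_tendsto h1 ?_
  filter_upwards [Ioo_mem_nhdsLT (show (-1 : ℝ) < 0 by norm_num)] with t ht using hA t ht.1 ht.2

theorem exists_rotate_isInitial {m : ℕ} {τ : Equiv.Perm (Fin (m + 1))} {p : ModuliBar (m + 1)}
    {σ : Equiv.Perm (Fin (m + 1))} (hp : p ∈ associahedron σ) (hτ : p.WeakAgree τ)
    {S : Set (Fin (m + 1))} (hS : S ∈ nodes p) :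
    ∃ r : ℕ, IsInitial (τ * finRotate (m + 1) ^ r) S ∧
      p.WeakAgree (τ * finRotate (m + 1) ^ r) := by
  obtain ⟨X, hXp, -⟩ := exists_rep_of_mem_associahedron hp
  have hw := hXp.weakAgree_iff.1 hτ
  obtain ⟨r, hr⟩ := NodeX.exists_rotate hXp.1 hw ((hXp.hasNode_iff S).1 hS)
  exact ⟨r, hr, hXp.weakAgree_iff.2 (hw.rotate hXp.1 r)⟩

/-- Without nodes no cross-ratio is infinitely close to `0` or `1` (`exists_nodeX`), so the weak
inequalities hold strictly for the representative. -/
theorem mem_associahedron_of_nodes_empty {m : ℕ} {p : ModuliBar (m + 1)}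
    {σ τ : Equiv.Perm (Fin (m + 1))} (hp : p ∈ associahedron σ) (hn : nodes p = ∅)
    (hτ : p.WeakAgree τ) : p ∈ associahedron τ := by
  obtain ⟨X, hXp, -⟩ := exists_rep_of_mem_associahedron hp
  have hw := hXp.weakAgree_iff.1 hτ
  have hno : ∀ T, ¬ NodeX X T := by
    intro T hT
    have : T ∈ nodes p := (hXp.hasNode_iff T).2 hT
    rw [hn] at this
    exact this
  refine Agree.mem_associahedron hXp ?_
  intro i j k l hij hjk hkl
  have hne : ∀ {a b}, a < b → τ a ≠ τ b := fun hab e => hab.ne (τ.injective e)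
  have nij := hne hij
  have njk := hne hjk
  have nkl := hne hkl
  have nik := hne (hij.trans hjk)
  have njl := hne (hjk.trans hkl)
  have nil := hne (hij.trans (hjk.trans hkl))
  obtain ⟨r, h0, h1, hr⟩ := hw i j k l hij hjk hkl
  have e1 : 1 - cr X (τ i) (τ j) (τ l) (τ k) = cr X (τ i) (τ l) (τ j) (τ k) :=
    one_sub_cr hXp.1 nik njl
  constructor
  · rcases (wNonneg_iff hr).2 h0 with h2 | h2
    · exact lt_of_le_of_ne h2 (cr_ne_zero hXp.1 nil nik njl njk).symm
    · have h3 := nearOne_one_sub h2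
      rw [e1] at h3
      obtain ⟨T, hT, -⟩ := exists_nodeX hXp.1 nil nij nik njl.symm nkl.symm njk h3
      exact absurd hT (hno T)
  · rw [← sub_pos]
    rcases wNonneg_one_sub hr h1 with h2 | h2
    · rw [e1] at h2 ⊢
      exact lt_of_le_of_ne h2 (cr_ne_zero hXp.1 nij nik njl.symm nkl.symm).symm
    · have h3 := nearOne_one_sub h2
      rw [sub_sub_cancel] at h3
      obtain ⟨T, hT, -⟩ := exists_nodeX hXp.1 nij nil nik njl njk nkl.symm h3
      exact absurd hT (hno T)

/-- An associahedron consists of the points that weakly agree with its cyclic order. -/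
theorem mem_associahedron_of_weakAgree {m : ℕ} {p : ModuliBar (m + 1)}
    {σ τ : Equiv.Perm (Fin (m + 1))} (hp : p ∈ associahedron σ) (hτ : p.WeakAgree τ) :
    p ∈ associahedron τ := by
  induction hN : (nodes p).ncard using Nat.strong_induction_on generalizing p σ τ with
  | _ N ih =>
  rcases (nodes p).eq_empty_or_nonempty with he | ⟨S, hS⟩
  · exact mem_associahedron_of_nodes_empty hp he hτ
  obtain ⟨r₁, hi₁, -⟩ := exists_rotate_isInitial hp (weakAgree_of_mem_associahedron hp) hS
  obtain ⟨r₂, hi₂, hw₂⟩ := exists_rotate_isInitial hp hτ hS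
  rw [← associahedron_rotate r₁] at hp
  rw [← associahedron_rotate r₂]
  set σ₁ := σ * finRotate (m + 1) ^ r₁
  set τ₁ := τ * finRotate (m + 1) ^ r₂
  obtain ⟨q, hq⟩ := exists_smoothing hp hS hi₁
  have hcard : ∀ t, t ≠ 0 → |t| < 1 → (nodes (q t)).ncard < N := by
    intro t h0 h1
    rw [← hN, hq.nodes t h0 h1]
    refine Set.ncard_lt_ncard ⟨Set.sdiff_subset, fun h => ?_⟩ (Set.toFinite _)
    exact (h hS).2 (Or.inl rfl)
  have hcl : closure (associahedron τ₁) = associahedron τ₁ := isClosed_closure.closure_eq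
  rw [← hcl]
  -- One of the two families of smoothings still weakly agrees with `τ₁`. Its points have fewer
  -- nodes, so they lie in the associahedron by induction, and it is closed.
  rcases hq.weak τ₁ hw₂ hi₂ with hw | hw
  · refine hq.mem_closure_pos fun t h0 h1 => ?_
    exact ih _ (hcard t h0.ne' (abs_lt.2 ⟨by linarith, h1⟩)) (hq.pos t h0 h1) (hw t h0 h1) rfl
  · refine hq.mem_closure_neg fun t h0 h1 => ?_
    exact ih _ (hcard t h1.ne (abs_lt.2 ⟨h0, by linarith⟩)) (hq.neg t h0 h1) (hw t h0 h1) rfl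

/-! ### Open faces -/

/-- The points of an associahedron with a given set of nodes. -/
def face {n : ℕ} (σ : Equiv.Perm (Fin n)) (N : Set (Set (Fin n))) : Set (ModuliBar n) :=
  {p | p ∈ associahedron σ ∧ nodes p = N}

/-- Within the associahedron of `σ`, membership in that of `τ` depends on the nodes alone. -/
theorem face_subset_of_mem {m : ℕ} {σ τ : Equiv.Perm (Fin (m + 1))} {N : Set (Set (Fin (m + 1)))}
    {p : ModuliBar (m + 1)} (hσ : p ∈ face σ N) (hτ : p ∈ associahedron τ) :
    face σ N ⊆ face τ N := by
  rintro q ⟨hq, hqN⟩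
  refine ⟨mem_associahedron_of_weakAgree hq ?_, hqN⟩
  exact weakAgree_of_nodes_eq hσ.1 hq (hσ.2.trans hqN.symm) (weakAgree_of_mem_associahedron hτ)

theorem face_eq_of_mem {m : ℕ} {σ τ : Equiv.Perm (Fin (m + 1))} {N : Set (Set (Fin (m + 1)))}
    {p : ModuliBar (m + 1)} (hσ : p ∈ face σ N) (hτ : p ∈ associahedron τ) :
    face σ N = face τ N :=
  subset_antisymm (face_subset_of_mem hσ hτ) (face_subset_of_mem ⟨hτ, hσ.2⟩ hσ.1)

theorem face_rotate {m : ℕ} {σ : Equiv.Perm (Fin (m + 1))} {N : Set (Set (Fin (m + 1)))} (r : ℕ) :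
    face (σ * finRotate (m + 1) ^ r) N = face σ N := by
  unfold face; rw [associahedron_rotate]

theorem continuous_cr {n : ℕ} (Q : Quad n) : Continuous fun p : ModuliBar n => p.cr Q :=
  (continuous_apply Q).comp continuous_subtype_val

theorem isClosed_hasNode {n : ℕ} (S : Set (Fin n)) : IsClosed {p : ModuliBar n | p.HasNode S} := by
  unfold ModuliBar.HasNode
  simp only [Set.ofPred_and]
  refine isClosed_const.inter (isClosed_const.inter ?_)
  simp only [Set.ofPred_forall]
  refine isClosed_iInter fun Q => isClosed_iInter fun _ => isClosed_iInter fun _ =>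
    isClosed_iInter fun _ => isClosed_iInter fun _ => ?_
  exact isClosed_eq (continuous_cr Q) continuous_const

/-- Having a given node is a closed condition, so nodes can only be gained in a limit. -/
theorem closure_face_subset {n : ℕ} {σ : Equiv.Perm (Fin n)} {N : Set (Set (Fin n))} :
    closure (face σ N) ⊆ {p | p ∈ associahedron σ ∧ N ⊆ nodes p} := by
  have hc : IsClosed {p : ModuliBar n | p ∈ associahedron σ ∧ N ⊆ nodes p} := by
    have e : {p : ModuliBar n | p ∈ associahedron σ ∧ N ⊆ nodes p} =
        associahedron σ ∩ ⋂ S ∈ N, {p | p.HasNode S} := by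
      ext p
      simp [nodes, Set.subset_def]
    rw [e]
    exact isClosed_closure.inter (isClosed_iInter fun S => isClosed_iInter fun _ =>
      isClosed_hasNode S)
  exact closure_minimal (fun p hp => ⟨hp.1, hp.2.symm.subset⟩) hc

theorem compl_mem_nodes {n : ℕ} {σ : Equiv.Perm (Fin n)} {p : ModuliBar n}
    (hp : p ∈ associahedron σ) {S : Set (Fin n)} (hS : S ∈ nodes p) : Sᶜ ∈ nodes p := by
  obtain ⟨X, hXp, -⟩ := exists_rep_of_mem_associahedron hp
  exact (hXp.hasNode_iff _).2 ((hXp.hasNode_iff S).1 hS).compl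

/-- Two labellings between which the smoothings of a node can choose. -/
theorem exists_twist {m : ℕ} {σ : Equiv.Perm (Fin (m + 1))} {N : Set (Set (Fin (m + 1)))}
    {S : Set (Fin (m + 1))} {p : ModuliBar (m + 1)} (hp : p ∈ face σ N) (hS : S ∈ N) :
    ∃ σ' : Equiv.Perm (Fin (m + 1)), p ∈ associahedron σ' ∧
      p ∈ closure (face σ (N \ {S, Sᶜ})) ∧
      face σ (N \ {S, Sᶜ}) ≠ face σ' (N \ {S, Sᶜ}) ∧
      ∀ τ, p ∈ associahedron τ → face τ (N \ {S, Sᶜ}) = face σ (N \ {S, Sᶜ}) ∨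
        face τ (N \ {S, Sᶜ}) = face σ' (N \ {S, Sᶜ}) := by
  obtain ⟨hpσ, rfl⟩ := hp
  obtain ⟨r, hi, -⟩ := exists_rotate_isInitial hpσ (weakAgree_of_mem_associahedron hpσ) hS
  rw [← associahedron_rotate r] at hpσ
  rw [← face_rotate r]
  set σ₁ := σ * finRotate (m + 1) ^ r
  obtain ⟨q, hq⟩ := exists_smoothing hpσ hS hi
  have hpos : ∀ t, 0 < t → t < 1 → q t ∈ face σ₁ (nodes p \ {S, Sᶜ}) := fun t h0 h1 =>
    ⟨hq.pos t h0 h1, hq.nodes t h0.ne' (abs_lt.2 ⟨by linarith, h1⟩)⟩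
  have hneg : ∀ t, -1 < t → t < 0 →
      q t ∈ face (σ₁ * revInitial (m + 1) S.ncard) (nodes p \ {S, Sᶜ}) := fun t h0 h1 =>
    ⟨hq.neg t h0 h1, hq.nodes t h1.ne (abs_lt.2 ⟨h0, by linarith⟩)⟩
  refine ⟨σ₁ * revInitial (m + 1) S.ncard, ?_, hq.mem_closure_pos hpos, ?_, ?_⟩
  · have h := hq.mem_closure_neg hneg
    exact (closure_face_subset h).1
  · intro e
    have h1 := hpos (1 / 2) (by norm_num) (by norm_num)
    have h2 := h1
    rw [e] at h2
    exact hq.not_twist (1 / 2) (by norm_num) (by norm_num) h2.1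
  -- Weak agreement of `p` with `τ` extends to one of the two families. A sample point, at `1 / 2`
  -- or `-1 / 2`, then lies in both associahedra and identifies the faces.
  · intro τ hτ
    obtain ⟨r₂, hi₂, hw₂⟩ := exists_rotate_isInitial hpσ (weakAgree_of_mem_associahedron hτ) hS
    rw [← face_rotate r₂]
    rcases hq.weak _ hw₂ hi₂ with hw | hw
    · left
      have h1 := hpos (1 / 2) (by norm_num) (by norm_num)
      exact (face_eq_of_mem h1 (mem_associahedron_of_weakAgree h1.1
        (hw (1 / 2) (by norm_num) (by norm_num)))).symm
    · right
      have h1 := hneg (-1 / 2) (by norm_num) (by norm_num)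
      exact (face_eq_of_mem h1 (mem_associahedron_of_weakAgree h1.1
        (hw (-1 / 2) (by norm_num) (by norm_num)))).symm

/-! ### Creating nodes -/

theorem negl_epsilon : Negl Hyperreal.epsilon := archimedeanClassMk_epsilon_pos

/-- A splitting of the labels that crosses no node of a point can be turned into a node. -/
theorem exists_pinch {m : ℕ} {σ : Equiv.Perm (Fin (m + 1))} {S : Set (Fin (m + 1))}
    {p : ModuliBar (m + 1)} (hp : p ∈ associahedron σ) (hi : IsInitial σ S) (h2 : 2 ≤ S.ncard)
    (h3 : S.ncard + 2 ≤ m + 1) (hS : S ∉ nodes p)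
    (hcross : ∀ T ∈ nodes p, ∀ a b c d, a ∈ S ∧ a ∈ T → b ∈ S ∧ b ∉ T → c ∉ S ∧ c ∈ T →
      d ∉ S ∧ d ∉ T → False) :
    ∃ q ∈ associahedron σ, nodes q = nodes p ∪ {S, Sᶜ} := by
  obtain ⟨X, hXp, hX⟩ := exists_rep_of_mem_associahedron hp
  obtain ⟨w, η, hg, ho, hη0, hη1, hc⟩ := hX.exists_glue hXp.1 hi h2 h3
  have hnode : ∀ T, T ∈ nodes p ↔ NodeX (glue S w η) T := fun T =>
    (hXp.hasNode_iff T).trans (NodeX.congr hc).symm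
  -- `η` is itself a cross-ratio of `X`; were it near `1`, `exists_nodeX` would produce a node
  -- crossing `S`.
  have hη : ¬ NearOne η := by
    intro hη
    obtain ⟨a, ha, hwa⟩ := hg.zero
    obtain ⟨b, hb, hwb⟩ := hg.one
    obtain ⟨e, he, hwe⟩ := hg.zero_compl
    obtain ⟨c, hc', hwc⟩ := hg.one_compl
    have hne : ∀ {a b}, a ∈ S → b ∉ S → a ≠ b := fun ha hb e => hb (e ▸ ha)
    have e1 : cr X a e b c = η := by
      rw [← hc]
      unfold cr
      rw [br_glue_mem_mem ha hb, br_glue_notMem_notMem he hc', br_glue_mem_notMem ha hc',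
        br_glue_notMem_mem he hb, hwa, hwb, hwc, hwe]
      simp
    rw [← e1] at hη
    obtain ⟨T, hT, hTa, hTe, hTb, hTc⟩ := exists_nodeX hXp.1 (hne ha he)
      (by rintro rfl; rw [hwa] at hwb; exact zero_ne_one hwb) (hne ha hc') (hne hb he).symm
      (by rintro rfl; rw [hwe] at hwc; exact zero_ne_one hwc) (hne hb hc') hη
    exact hcross T ((hXp.hasNode_iff T).2 hT) a b e c ⟨ha, hTa⟩ ⟨hb, hTb⟩ ⟨he, hTe⟩ ⟨hc', hTc⟩
  have hgood := goodParam_of_not_nearOne hη0 hη1 hη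
  have hgε := negl_epsilon.goodParam epsilon_ne_zero
  -- Making the parameter infinitesimal creates the node `S` and keeps all other nodes.
  obtain ⟨q, hq, hqr⟩ := (ho.agree hg hgε epsilon_pos).exists_point (hg.nondeg hgε)
  refine ⟨q, hq, ?_⟩
  have hSq : S ∈ nodes q := (hqr.hasNode_iff S).2 (hg.nodeX_self_iff.2 negl_epsilon)
  have hSp' : Sᶜ ∉ nodes p := by
    intro h
    have := compl_mem_nodes hp h
    rw [compl_compl] at this
    exact hS this
  ext T
  rw [Set.mem_union, Set.mem_insert_iff, Set.mem_singleton_iff]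
  by_cases h1 : T = S
  · subst h1; simp [hSq]
  by_cases h2 : T = Sᶜ
  · subst h2; simp [compl_mem_nodes hq hSq]
  simp only [h1, h2, or_false]
  rw [hnode]
  exact (hqr.hasNode_iff T).trans ⟨hg.nodeX_of_nodeX hgε hgood h1 h2,
    hg.nodeX_of_nodeX hgood hgε h1 h2⟩

/-- Labels at distinct standard positions have standard cross-ratios different from `1`. -/
theorem exists_nodes_empty {m : ℕ} (σ : Equiv.Perm (Fin (m + 1))) :
    ∃ p ∈ associahedron σ, nodes p = ∅ := by
  set y : Fin (m + 1) → ℝ := fun i => ((σ.symm i).val : ℝ) with hy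
  set X : HConf (m + 1) := fun i => ((y i : ℝ*), 1) with hX
  have hbr : ∀ i j, br (X i) (X j) = ((y i - y j : ℝ) : ℝ*) := by
    intro i j; simp [br, hX, coe_sub]
  have hsig : Nondeg X ∧ Agree X σ := by
    apply agree_of_sign (-1) (fun _ => 1)
    intro i j hij
    rw [hbr]
    have : y (σ i) < y (σ j) := by simp [hy, hij]
    have h2 : ((y (σ i) - y (σ j) : ℝ) : ℝ*) < 0 := by
      have : y (σ i) - y (σ j) < 0 := by linarith
      exact_mod_cast this
    linarith
  obtain ⟨p, hp, hrep⟩ := hsig.2.exists_point hsig.1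
  refine ⟨p, hp, ?_⟩
  ext S
  simp only [Set.mem_empty_iff_false, iff_false]
  intro hS
  have hN := (hrep.hasNode_iff S).1 hS
  obtain ⟨i, hi, j, hj, hij⟩ := Set.one_lt_ncard_iff_nontrivial.1 hN.1
  obtain ⟨k, hk, l, hl, hkl⟩ := Set.one_lt_ncard_iff_nontrivial.1 hN.2.1
  have hne : ∀ {a b}, a ∈ S → b ∉ S → a ≠ b := fun ha hb e => hb (e ▸ ha)
  have h1 := hN.2.2 i hi j hj k hk l hl
  unfold NearOne at h1
  rw [cr_sub_one hsig.1 (hne hi hl) (hne hj hk)] at h1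
  have h2 : ∀ {i j}, i ≠ j → y i - y j ≠ 0 := by
    intro i j hij h
    apply hsig.1 i j hij
    rw [hbr, h, coe_zero]
  rw [hbr, hbr, hbr, hbr, ← coe_mul, ← coe_mul, ← coe_div, negl_coe_iff] at h1
  exact div_ne_zero (mul_ne_zero (h2 hij) (h2 hkl)) (mul_ne_zero (h2 (hne hi hl))
    (h2 (hne hj hk))) h1

/-! ### Diagonals and nodes -/

theorem Diagonal.last_notMem_sides {m : ℕ} (d : Diagonal (m + 1)) : Fin.last m ∉ d.sides :=
  fun h => absurd h.2 (Fin.le_last _).not_gt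

theorem Diagonal.fst_lt_snd {n : ℕ} (d : Diagonal n) : d.fst < d.snd := by
  have := d.gap
  rw [Fin.lt_def]
  omega

theorem Diagonal.fst_mem_sides {n : ℕ} (d : Diagonal n) : d.fst ∈ d.sides :=
  ⟨le_rfl, d.fst_lt_snd⟩

theorem Diagonal.sides_injective (n : ℕ) : Function.Injective (Diagonal.sides (n := n)) := by
  intro d e h
  have h1 : d.fst = e.fst :=
    le_antisymm (h.symm ▸ e.fst_mem_sides : e.fst ∈ d.sides).1
      (h ▸ d.fst_mem_sides : d.fst ∈ e.sides).1
  have key : ∀ {d e : Diagonal n}, d.sides = e.sides → d.fst = e.fst → d.snd ≤ e.snd := by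
    intro d e h h1
    by_contra! hlt
    have : e.snd ∈ d.sides := ⟨h1.trans_le e.fst_lt_snd.le, hlt⟩
    rw [h] at this
    exact this.2.false
  have h2 : d.snd = e.snd := le_antisymm (key h h1) (key h.symm h1.symm)
  cases d
  cases e
  subst h1 h2
  rfl

instance (n : ℕ) : Finite (Diagonal n) := Finite.of_injective _ (Diagonal.sides_injective n)

theorem Diagonal.cross_of_mem {n : ℕ} {d e : Diagonal n} {x y z : Fin n} (hx : x ∈ d.sides)
    (hx' : x ∈ e.sides) (hy : y ∈ d.sides) (hy' : y ∉ e.sides) (hz : z ∈ e.sides)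
    (hz' : z ∉ d.sides) : d.Cross e := by
  unfold Diagonal.Cross
  simp only [Diagonal.sides, Set.mem_ofPred_eq, Fin.le_def, Fin.lt_def] at *
  omega

/-- The splittings of the labels by a set of diagonals of a labelled polygon. -/
def splittings {n : ℕ} (σ : Equiv.Perm (Fin n)) (D : Set (Diagonal n)) : Set (Set (Fin n)) :=
  {S | ∃ d ∈ D, S = σ '' d.sides ∨ S = (σ '' d.sides)ᶜ}

theorem image_sides_injective {n : ℕ} (σ : Equiv.Perm (Fin n)) :
    Function.Injective fun d : Diagonal n => σ '' d.sides :=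
  σ.injective.image_injective.comp (Diagonal.sides_injective n)

/-- `sides` always selects the part without the last side, so one representative of each
complementary pair. -/
theorem image_sides_ne_compl {m : ℕ} (σ : Equiv.Perm (Fin (m + 1))) (d e : Diagonal (m + 1)) :
    σ '' d.sides ≠ (σ '' e.sides)ᶜ := by
  intro h
  have h1 : σ (Fin.last m) ∈ (σ '' e.sides)ᶜ := by
    rw [Set.mem_compl_iff, σ.injective.mem_set_image]
    exact e.last_notMem_sides
  rw [← h, σ.injective.mem_set_image] at h1
  exact d.last_notMem_sides h1

theorem image_sides_mem_splittings {m : ℕ} {σ : Equiv.Perm (Fin (m + 1))}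
    {D : Set (Diagonal (m + 1))} {d : Diagonal (m + 1)} :
    σ '' d.sides ∈ splittings σ D ↔ d ∈ D := by
  constructor
  · rintro ⟨e, he, h | h⟩
    · rwa [image_sides_injective σ h]
    · exact absurd h (image_sides_ne_compl σ d e)
  · exact fun h => ⟨d, h, Or.inl rfl⟩

theorem compl_mem_splittings {n : ℕ} {σ : Equiv.Perm (Fin n)} {D : Set (Diagonal n)}
    {S : Set (Fin n)} (h : S ∈ splittings σ D) : Sᶜ ∈ splittings σ D := by
  obtain ⟨d, hd, rfl | rfl⟩ := h
  · exact ⟨d, hd, Or.inr rfl⟩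
  · exact ⟨d, hd, Or.inl (compl_compl _)⟩

theorem splittings_mono {n : ℕ} {σ : Equiv.Perm (Fin n)} {D E : Set (Diagonal n)} (h : D ⊆ E) :
    splittings σ D ⊆ splittings σ E := fun _ ⟨d, hd, h'⟩ => ⟨d, h hd, h'⟩

theorem splittings_injective {m : ℕ} (σ : Equiv.Perm (Fin (m + 1))) :
    Function.Injective (splittings σ) := by
  intro D E h
  ext d
  rw [← image_sides_mem_splittings (σ := σ), h, image_sides_mem_splittings]

theorem splittings_insert {n : ℕ} (σ : Equiv.Perm (Fin n)) (d : Diagonal n)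
    (D : Set (Diagonal n)) :
    splittings σ (insert d D) = splittings σ D ∪ {σ '' d.sides, (σ '' d.sides)ᶜ} := by
  ext S
  simp only [splittings, Set.mem_ofPred_eq, Set.mem_insert_iff, exists_eq_or_imp, Set.mem_union,
    Set.mem_singleton_iff]
  rw [or_comm]

theorem splittings_insert_diff {m : ℕ} (σ : Equiv.Perm (Fin (m + 1))) {d : Diagonal (m + 1)}
    {D : Set (Diagonal (m + 1))} (hd : d ∉ D) :
    splittings σ (insert d D) \ {σ '' d.sides, (σ '' d.sides)ᶜ} = splittings σ D := by
  rw [splittings_insert, Set.union_sdiff_right, sdiff_eq_left, Set.disjoint_right]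
  rintro S (rfl | rfl) h
  · exact hd (image_sides_mem_splittings.1 h)
  · have := compl_mem_splittings h
    rw [compl_compl] at this
    exact hd (image_sides_mem_splittings.1 this)

/-- Counting splittings recovers the number of diagonals, that is, the codimension, independently of
the labelling. -/
theorem ncard_splittings {m : ℕ} (σ : Equiv.Perm (Fin (m + 1)))
    (D : Finset (Diagonal (m + 1))) : (splittings σ (D : Set _)).ncard = 2 * D.card := by
  have e : splittings σ (D : Set (Diagonal (m + 1))) =
      (fun d : Diagonal (m + 1) => σ '' d.sides) '' D ∪
        (fun d : Diagonal (m + 1) => (σ '' d.sides)ᶜ) '' D := by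
    ext S
    simp only [splittings, Set.mem_ofPred_eq, Set.mem_union, Set.mem_image, Finset.mem_coe]
    constructor
    · rintro ⟨d, hd, h | h⟩
      exacts [Or.inl ⟨d, hd, h.symm⟩, Or.inr ⟨d, hd, h.symm⟩]
    · rintro (⟨d, hd, h⟩ | ⟨d, hd, h⟩)
      exacts [⟨d, hd, Or.inl h.symm⟩, ⟨d, hd, Or.inr h.symm⟩]
  rw [e, Set.ncard_union_eq, Set.ncard_image_of_injective _ (image_sides_injective σ),
    Set.ncard_image_of_injective (f := fun d : Diagonal (m + 1) => (σ '' d.sides)ᶜ) _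
      (compl_injective.comp (image_sides_injective σ)), Set.ncard_coe_finset, two_mul]
  rw [Set.disjoint_left]
  rintro _ ⟨d, -, rfl⟩ ⟨f, -, h⟩
  exact image_sides_ne_compl σ d f h.symm

theorem val_finRotate_pow {m : ℕ} (r : ℕ) (a : Fin (m + 1)) :
    ((finRotate (m + 1) ^ r) a).val = (a.val + r) % (m + 1) := by
  induction r with
  | zero => simp [Nat.mod_eq_of_lt a.isLt]
  | succ r ih =>
    rw [pow_succ', Equiv.Perm.mul_apply, finRotate_apply, Fin.val_add, ih]
    rcases m with _ | m
    · simp [Nat.mod_one]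
    · rw [Fin.val_one, Nat.mod_add_mod, add_assoc]

theorem isInitial_image_sides {m : ℕ} (σ : Equiv.Perm (Fin (m + 1))) (d : Diagonal (m + 1)) :
    IsInitial (σ * finRotate (m + 1) ^ d.fst.val) (σ '' d.sides) ∧ 2 ≤ (σ '' d.sides).ncard ∧
      (σ '' d.sides).ncard + 2 ≤ m + 1 := by
  have h1 := d.gap
  have h2 := d.not_last
  have h3 := d.snd.isLt
  have key : ∀ a, (σ * finRotate (m + 1) ^ d.fst.val) a ∈ σ '' d.sides ↔
      a.val < d.snd.val - d.fst.val := by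
    intro a
    have ha := a.isLt
    rw [Equiv.Perm.mul_apply, σ.injective.mem_set_image]
    change _ ≤ _ ∧ _ < _ ↔ _
    rw [Fin.le_def, Fin.lt_def, val_finRotate_pow]
    rcases lt_or_ge (a.val + d.fst.val) (m + 1) with h | h
    · rw [Nat.mod_eq_of_lt h]
      omega
    · rw [Nat.mod_eq_sub_mod h, Nat.mod_eq_of_lt (by omega)]
      omega
  have hi := isInitial_of_iff (by omega) key
  have hc : ∀ a : Fin (m + 1), a.val < (σ '' d.sides).ncard ↔ a.val < d.snd.val - d.fst.val :=
    fun a => (hi a).symm.trans (key a)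
  have h4 := hc ⟨d.snd.val - d.fst.val, by omega⟩
  have h5 := hc ⟨d.snd.val - d.fst.val - 1, by omega⟩
  simp only at h4 h5
  exact ⟨hi, by omega, by omega⟩

theorem nodes_not_cross {n : ℕ} {σ : Equiv.Perm (Fin n)} {p : ModuliBar n}
    (hp : p ∈ associahedron σ) {d e : Diagonal n} (hd : σ '' d.sides ∈ nodes p)
    (he : σ '' e.sides ∈ nodes p) : ¬ d.Cross e := by
  obtain ⟨X, hXp, -⟩ := exists_rep_of_mem_associahedron hp
  have hd' := (hXp.hasNode_iff _).1 hd
  have he' := (hXp.hasNode_iff _).1 he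
  have key : ∀ {d e : Diagonal n}, NodeX X (σ '' d.sides) → NodeX X (σ '' e.sides) →
      ¬ (d.fst < e.fst ∧ e.fst < d.snd ∧ d.snd < e.snd) := by
    rintro d e hd he ⟨h1, h2, h3⟩
    have hmem : ∀ (f : Diagonal n) a, σ a ∈ σ '' f.sides ↔ f.fst ≤ a ∧ a < f.snd :=
      fun f a => σ.injective.mem_set_image
    -- The sides that begin at the four endpoints of the two diagonals realise all four
    -- combinations.
    refine NodeX.not_cross hXp.1 hd he (i := σ e.fst) (j := σ d.fst) (k := σ d.snd)
      (l := σ e.snd) ?_ ?_ ?_ ?_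
    all_goals simp only [hmem]
    · exact ⟨⟨h1.le, h2⟩, le_rfl, e.fst_lt_snd⟩
    · exact ⟨⟨le_rfl, d.fst_lt_snd⟩, fun h => h1.not_ge h.1⟩
    · exact ⟨fun h => h.2.false, h2.le, h3⟩
    · exact ⟨fun h => h3.not_gt h.2, fun h => h.2.false⟩
  rintro (h | h)
  · exact key hd' he' h
  · exact key he' hd' h

/-- Every node of a point of an associahedron comes from a diagonal of the polygon. -/
theorem exists_diagonal_of_mem_nodes {m : ℕ} {σ : Equiv.Perm (Fin (m + 1))}
    {p : ModuliBar (m + 1)} (hp : p ∈ associahedron σ) {S : Set (Fin (m + 1))}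
    (hS : S ∈ nodes p) : ∃ d : Diagonal (m + 1), S = σ '' d.sides ∨ S = (σ '' d.sides)ᶜ := by
  obtain ⟨X, hXp, hX⟩ := exists_rep_of_mem_associahedron hp
  have main : ∀ {S}, NodeX X S → σ (Fin.last m) ∉ S →
      ∃ d : Diagonal (m + 1), S = σ '' d.sides := by
    intro S hS hl
    obtain ⟨h2, h2'⟩ := hS.ncard_bounds
    obtain ⟨u, hu, v, hv, huv⟩ := Set.one_lt_ncard_iff_nontrivial.1 hS.1
    set P : Set (Fin (m + 1)) := σ ⁻¹' S with hP
    have hne : P.Nonempty := ⟨σ.symm u, by simp [hP, hu]⟩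
    obtain ⟨i, hi, hmin⟩ := Set.exists_min_image P id P.toFinite hne
    obtain ⟨k, hk, hmax⟩ := Set.exists_max_image P id P.toFinite hne
    simp only [id] at hmin hmax
    have hkl : k < Fin.last m := lt_of_le_of_ne (Fin.le_last _) (fun e => hl (e ▸ hk))
    have hkl' : k.val < m := hkl
    -- A gap in `P` together with the last side, which is not in `P`, would give an alternating
    -- quadruple.
    have hPe : ∀ a, a ∈ P ↔ i ≤ a ∧ a ≤ k := by
      intro a
      refine ⟨fun h => ⟨hmin a h, hmax a h⟩, fun ⟨h1, h2⟩ => ?_⟩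
      by_contra ha
      have hia : i < a := lt_of_le_of_ne h1 (fun e => ha (e ▸ hi))
      have hak : a < k := lt_of_le_of_ne h2 (fun e => ha (e ▸ hk))
      exact NodeX.not_alternate hXp.1 hX.weakAgree hS hia hak hkl hi ha hk hl
    have hik : i.val + 1 ≤ k.val := by
      by_contra! hlt
      have : ∀ a ∈ P, a = i := fun a ha => by
        have h1 := (hPe a).1 ha
        rw [Fin.le_def, Fin.le_def] at h1
        exact Fin.ext (by omega)
      apply huv
      have h1 := this (σ.symm u) (by simp [hP, hu])
      have h2 := this (σ.symm v) (by simp [hP, hv])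
      exact σ.symm.injective (h1.trans h2.symm)
    -- The end vertex is `k + 1` because side `k` ends there.
    refine ⟨⟨i, ⟨k.val + 1, by omega⟩, by simpa using hik, ?_⟩, ?_⟩
    · rintro ⟨h1, h3⟩
      obtain ⟨x, hx, y, hy, hxy⟩ := Set.one_lt_ncard_iff_nontrivial.1 hS.2.1
      have : ∀ x ∉ S, σ.symm x = Fin.last m := by
        intro x hx
        have h4 : σ.symm x ∉ P := by simpa [hP] using hx
        rw [hPe, Fin.le_def, Fin.le_def, h1] at h4
        simp only at h3
        have := (σ.symm x).isLt
        exact Fin.ext (by rw [Fin.val_last]; omega)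
      exact hxy (σ.symm.injective ((this x hx).trans (this y hy).symm))
    · ext x
      obtain ⟨a, rfl⟩ := σ.surjective x
      rw [σ.injective.mem_set_image]
      refine (hPe a).trans ?_
      simp only [Diagonal.sides, Set.mem_ofPred_eq, Fin.le_def, Fin.lt_def]
      omega
  have hN := (hXp.hasNode_iff S).1 hS
  by_cases hl : σ (Fin.last m) ∈ S
  · obtain ⟨d, hd⟩ := main hN.compl (by simpa using hl)
    exact ⟨d, Or.inr (by rw [← hd, compl_compl])⟩
  · obtain ⟨d, hd⟩ := main hN hl
    exact ⟨d, Or.inl hd⟩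

/-- Complement-closed sets of nodes of a point of an associahedron are the splittings by
non-crossing diagonals. -/
theorem exists_splittings_eq {m : ℕ} {σ : Equiv.Perm (Fin (m + 1))} {p : ModuliBar (m + 1)}
    (hp : p ∈ associahedron σ) {N : Set (Set (Fin (m + 1)))} (hN : N ⊆ nodes p)
    (hc : ∀ S ∈ N, Sᶜ ∈ N) :
    ∃ D : Finset (Diagonal (m + 1)), (∀ d ∈ D, ∀ e ∈ D, ¬ d.Cross e) ∧
      splittings σ (D : Set _) = N := by
  refine ⟨(Set.toFinite {d : Diagonal (m + 1) | σ '' d.sides ∈ N}).toFinset, ?_, ?_⟩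
  · intro d hd e he
    rw [Set.Finite.mem_toFinset] at hd he
    exact nodes_not_cross hp (hN hd) (hN he)
  · rw [Set.Finite.coe_toFinset]
    ext S
    constructor
    · rintro ⟨d, hd, rfl | rfl⟩
      exacts [hd, hc _ hd]
    · intro hS
      obtain ⟨d, rfl | rfl⟩ := exists_diagonal_of_mem_nodes hp (hN hS)
      · exact ⟨d, hS, Or.inl rfl⟩
      · exact ⟨d, by simpa using hc _ hS, Or.inr rfl⟩

/-- Starting from a point without nodes, the diagonals are pinched one at a time; since they do not
cross, `exists_pinch` applies. -/
theorem face_splittings_nonempty {m : ℕ} (σ : Equiv.Perm (Fin (m + 1)))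
    (D : Finset (Diagonal (m + 1))) (hD : ∀ d ∈ D, ∀ e ∈ D, ¬ d.Cross e) :
    (face σ (splittings σ (D : Set _))).Nonempty := by
  classical
  induction D using Finset.induction_on with
  | empty =>
    obtain ⟨p, hp, h⟩ := exists_nodes_empty σ
    exact ⟨p, hp, by simp [h, splittings]⟩
  | insert d D hd ih =>
    obtain ⟨p, hp, hpn⟩ := ih fun d hd e he =>
      hD d (Finset.mem_insert_of_mem hd) e (Finset.mem_insert_of_mem he)
    obtain ⟨hi, h2, h3⟩ := isInitial_image_sides σ d
    rw [← associahedron_rotate d.fst.val] at hp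
    have hmem : ∀ {f : Diagonal (m + 1)} {a}, a ∈ σ '' f.sides ↔ σ.symm a ∈ f.sides := by
      intro f a
      rw [← σ.injective.mem_set_image (s := f.sides), σ.apply_symm_apply]
    obtain ⟨q, hq, hqn⟩ := exists_pinch hp hi h2 h3
      (by rw [hpn, image_sides_mem_splittings]; simpa using hd) (by
        rw [hpn]
        rintro _ ⟨e, he, rfl | rfl⟩ a b c x ha hb hc hx
        · simp only [hmem] at ha hb hc
          exact hD d (by simp) e (Finset.mem_insert_of_mem he)
            (Diagonal.cross_of_mem ha.1 ha.2 hb.1 hb.2 hc.2 hc.1)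
        · simp only [Set.mem_compl_iff, hmem, not_not] at ha hb hx
          exact hD d (by simp) e (Finset.mem_insert_of_mem he)
            (Diagonal.cross_of_mem hb.1 hb.2 ha.1 ha.2 hx.2 hx.1))
    rw [associahedron_rotate] at hq
    exact ⟨q, hq, by rw [hqn, hpn, Finset.coe_insert, splittings_insert]⟩

theorem MarkedPolygon.openFace_eq {n k : ℕ} (G : MarkedPolygon n k) :
    G.openFace = face G.label (splittings G.label (G.diagonals : Set _)) := by
  ext p
  simp only [openFace, face, nodes, splittings, Set.mem_ofPred_eq, Set.ext_iff, Finset.mem_coe]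

/-! ### Counting the cells around a cell -/

/-- The values of `g` refine those of `f`, and every fibre of the induced map `φ` has exactly two
elements. -/
theorem card_image_eq_two_mul {α β γ : Type*} [DecidableEq β] [DecidableEq γ] (A : Finset α)
    (f : α → β) (g : α → γ) (hgf : ∀ a ∈ A, ∀ b ∈ A, g a = g b → f a = f b)
    (htwo : ∀ a ∈ A, ∃ a' ∈ A, f a' = f a ∧ g a ≠ g a' ∧
      ∀ b ∈ A, f b = f a → g b = g a ∨ g b = g a') :
    (A.image g).card = (A.image f).card * 2 := by
  rcases A.eq_empty_or_nonempty with rfl | ⟨a₀, -⟩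
  · simp
  have : Nonempty α := ⟨a₀⟩
  have hex : ∃ φ : γ → β, ∀ a ∈ A, φ (g a) = f a := by
    classical
    refine ⟨fun c => if h : ∃ a ∈ A, g a = c then f h.choose else f a₀, fun a ha => ?_⟩
    have h : ∃ b ∈ A, g b = g a := ⟨a, ha, rfl⟩
    simp only [h, dite_true]
    exact hgf _ h.choose_spec.1 a ha h.choose_spec.2
  obtain ⟨φ, hφ⟩ := hex
  rw [Finset.card_eq_sum_card_fiberwise (f := φ) (t := A.image f), Finset.sum_const_nat]
  · intro b hb
    obtain ⟨a, ha, rfl⟩ := Finset.mem_image.1 hb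
    obtain ⟨a', ha', hf, hne, hall⟩ := htwo a ha
    rw [← Finset.card_pair hne]
    congr 1
    ext c
    simp only [Finset.mem_filter, Finset.mem_image, Finset.mem_insert, Finset.mem_singleton]
    constructor
    · rintro ⟨⟨b, hb, rfl⟩, hc⟩
      exact hall b hb ((hφ b hb).symm.trans hc)
    · rintro (rfl | rfl)
      · exact ⟨⟨a, ha, rfl⟩, hφ a ha⟩
      · exact ⟨⟨a', ha', rfl⟩, (hφ a' ha').trans hf⟩
  · intro c hc
    obtain ⟨a, ha, rfl⟩ := Finset.mem_image.1 hc
    rw [hφ a ha]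
    exact Finset.mem_coe.2 (Finset.mem_image_of_mem f ha)

/-- The diagonals in `D \ E` are smoothed one at a time by `exists_twist`. -/
theorem face_subset_closure_face {m : ℕ} {σ τ : Equiv.Perm (Fin (m + 1))}
    {D E : Finset (Diagonal (m + 1))} (hE : E ⊆ D) :
    face τ (splittings σ (D : Set _)) ⊆ closure (face τ (splittings σ (E : Set _))) := by
  classical
  have key : ∀ F : Finset (Diagonal (m + 1)), Disjoint E F →
      face τ (splittings σ ((E ∪ F : Finset _) : Set _)) ⊆
        closure (face τ (splittings σ (E : Set _))) := by
    intro F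
    induction F using Finset.induction_on with
    | empty =>
      intro _
      rw [Finset.union_empty]
      exact subset_closure
    | insert d F hd ih =>
      intro hdis
      rw [Finset.disjoint_insert_right] at hdis
      have hnot : d ∉ ((E ∪ F : Finset _) : Set (Diagonal (m + 1))) := by
        simp [hdis.1, hd]
      intro p hp
      rw [Finset.union_insert, Finset.coe_insert] at hp
      obtain ⟨-, -, h, -⟩ := exists_twist hp
        (image_sides_mem_splittings.2 (Set.mem_insert d _))
      rw [splittings_insert_diff σ hnot] at h
      exact closure_minimal (ih hdis.2) isClosed_closure h
  have := key (D \ E) Finset.disjoint_sdiff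
  rwa [Finset.union_sdiff_of_subset hE] at this

open scoped Classical in
/-- The faces with the nodes given by `E` that lie in the associahedra through `p`. -/
def facesAt {m : ℕ} (p : ModuliBar (m + 1)) (σ : Equiv.Perm (Fin (m + 1)))
    (E : Finset (Diagonal (m + 1))) : Finset (Set (ModuliBar (m + 1))) :=
  (Finset.univ.filter fun τ => p ∈ associahedron τ).image fun τ =>
    face τ (splittings σ (E : Set _))

theorem mem_facesAt {m : ℕ} {p : ModuliBar (m + 1)} {σ : Equiv.Perm (Fin (m + 1))}
    {E : Finset (Diagonal (m + 1))} {C : Set (ModuliBar (m + 1))} :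
    C ∈ facesAt p σ E ↔ ∃ τ, p ∈ associahedron τ ∧ face τ (splittings σ (E : Set _)) = C := by
  simp [facesAt]

/-- Diagonals that are nodes of a point can be transported to every associahedron through it. -/
theorem exists_diagonals {m : ℕ} {p : ModuliBar (m + 1)} {σ τ : Equiv.Perm (Fin (m + 1))}
    {D E : Finset (Diagonal (m + 1))} (hp : nodes p = splittings σ (D : Set _)) (hE : E ⊆ D)
    (hτ : p ∈ associahedron τ) :
    ∃ F : Finset (Diagonal (m + 1)), (∀ d ∈ F, ∀ e ∈ F, ¬ d.Cross e) ∧ F.card = E.card ∧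
      splittings τ (F : Set _) = splittings σ (E : Set _) := by
  obtain ⟨F, hF, h⟩ := exists_splittings_eq hτ
    (hp ▸ splittings_mono (Finset.coe_subset.2 hE)) (fun S => compl_mem_splittings)
  refine ⟨F, hF, ?_, h⟩
  have := congrArg Set.ncard h
  rw [ncard_splittings, ncard_splittings] at this
  omega

theorem face_nonempty {m : ℕ} {p : ModuliBar (m + 1)} {σ τ : Equiv.Perm (Fin (m + 1))}
    {D E : Finset (Diagonal (m + 1))} (hp : nodes p = splittings σ (D : Set _)) (hE : E ⊆ D)
    (hτ : p ∈ associahedron τ) : (face τ (splittings σ (E : Set _))).Nonempty := by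
  obtain ⟨F, hF, -, h⟩ := exists_diagonals hp hE hτ
  rw [← h]
  exact face_splittings_nonempty τ F hF

theorem mem_closure_face {m : ℕ} {p : ModuliBar (m + 1)} {σ τ : Equiv.Perm (Fin (m + 1))}
    {D E : Finset (Diagonal (m + 1))} (hp : nodes p = splittings σ (D : Set _)) (hE : E ⊆ D)
    (hτ : p ∈ associahedron τ) : p ∈ closure (face τ (splittings σ (E : Set _))) :=
  face_subset_closure_face hE ⟨hτ, hp⟩

/-- The face for `E` determines the one for `E'`: the latter lies in the closure of the former,
hence in every associahedron giving the former. By `exists_twist`, every face for `E'` borders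
exactly two faces for `E`. The hypothesis `hE'` compares sets, so no decidability instance enters.
-/
theorem card_facesAt_of_insert {m : ℕ} {p : ModuliBar (m + 1)} {σ : Equiv.Perm (Fin (m + 1))}
    {D E E' : Finset (Diagonal (m + 1))} (hp : nodes p = splittings σ (D : Set _)) (hE : E' ⊆ D)
    {d : Diagonal (m + 1)} (hd : d ∉ E)
    (hE' : (E' : Set (Diagonal (m + 1))) = insert d (E : Set _)) :
    (facesAt p σ E).card = (facesAt p σ E').card * 2 := by
  classical
  have hdiff := splittings_insert_diff σ (Finset.mem_coe.not.2 hd)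
  rw [← hE'] at hdiff
  have hdE' : σ '' d.sides ∈ splittings σ (E' : Set (Diagonal (m + 1))) :=
    image_sides_mem_splittings.2 (hE' ▸ Set.mem_insert d _)
  have hEE' : E ⊆ E' := by
    rw [← Finset.coe_subset, hE']
    exact Set.subset_insert _ _
  unfold facesAt
  convert card_image_eq_two_mul (Finset.univ.filter fun τ => p ∈ associahedron τ)
    (fun τ => face τ (splittings σ (E' : Set _))) (fun τ => face τ (splittings σ (E : Set _)))
    ?_ ?_
  · intro τ hτ τ' hτ' h
    simp only [Finset.mem_filter, Finset.mem_univ, true_and] at hτ hτ' h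
    obtain ⟨q, hq⟩ := face_nonempty hp hE hτ
    have hqc := face_subset_closure_face hEE' hq
    rw [h] at hqc
    exact face_eq_of_mem hq (closure_face_subset hqc).1
  · intro τ hτ
    simp only [Finset.mem_filter, Finset.mem_univ, true_and] at hτ
    obtain ⟨q, hq⟩ := face_nonempty hp hE hτ
    obtain ⟨τ', hqτ', -, hne, hall⟩ := exists_twist hq hdE'
    rw [hdiff] at hne hall
    have heq := face_eq_of_mem hq hqτ'
    -- `τ'` is only known to pass through `q`; it passes through `p` because `p` is in the closure
    -- of the common face.
    have hpτ' : p ∈ associahedron τ' := by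
      have := mem_closure_face hp hE hτ
      rw [heq] at this
      exact (closure_face_subset this).1
    refine ⟨τ', by simpa using hpτ', heq.symm, hne, fun υ _ hf => hall υ ?_⟩
    rw [← hf] at hq
    exact hq.1

/-- For `E = D` all labellings through `p` give the same face; each diagonal removed from `E`
doubles the count. -/
theorem card_facesAt {m : ℕ} {p : ModuliBar (m + 1)} {σ : Equiv.Perm (Fin (m + 1))}
    {D E : Finset (Diagonal (m + 1))} (hσ : p ∈ associahedron σ)
    (hp : nodes p = splittings σ (D : Set _)) (hE : E ⊆ D) :
    (facesAt p σ E).card = 2 ^ (D.card - E.card) := by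
  classical
  obtain ⟨j, hj⟩ : ∃ j, D.card - E.card = j := ⟨_, rfl⟩
  rw [hj]
  induction j generalizing E with
  | zero =>
    have hcard := Finset.card_le_card hE
    obtain rfl : E = D := Finset.eq_of_subset_of_card_le hE (by omega)
    rw [pow_zero, Finset.card_eq_one]
    refine ⟨face σ (splittings σ (E : Set _)), ?_⟩
    ext C
    rw [mem_facesAt, Finset.mem_singleton]
    constructor
    · rintro ⟨τ, hτ, rfl⟩
      exact (face_eq_of_mem ⟨hσ, hp⟩ hτ).symm
    · rintro rfl
      exact ⟨σ, hσ, rfl⟩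
  | succ j ih =>
    obtain ⟨d, hdD, hdE⟩ := Finset.exists_mem_notMem_of_card_lt_card
      (show E.card < D.card by omega)
    have hsub : insert d E ⊆ D := Finset.insert_subset hdD hE
    rw [card_facesAt_of_insert hp hsub hdE (Finset.coe_insert d E), ih hsub, pow_succ]
    rw [Finset.card_insert_of_notMem hdE]
    omega

/-- A cell with `p` in its closure has nodes among those of `p`, which determine `E`. Conversely, `t
≥ 1` makes `E` smaller than `D`, so the smaller face lies in the closure of the larger one but is
disjoint from it. -/
theorem mem_codimCells_and_subset_cellBoundary_iff {m k t : ℕ} (ht : 1 ≤ t) (htk : t ≤ k)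
    {p : ModuliBar (m + 1)} {σ : Equiv.Perm (Fin (m + 1))} {D : Finset (Diagonal (m + 1))}
    (hD : D.card = k) (hp : p ∈ face σ (splittings σ (D : Set _)))
    (C' : Set (ModuliBar (m + 1))) :
    (C' ∈ codimCells (m + 1) (k - t) ∧
      face σ (splittings σ (D : Set _)) ⊆ cellBoundary C') ↔
      ∃ E ∈ Finset.powersetCard (k - t) D, C' ∈ facesAt p σ E := by
  classical
  constructor
  · rintro ⟨⟨G, rfl⟩, hsub⟩
    rw [G.openFace_eq] at hsub ⊢
    obtain ⟨hτ, hN⟩ := closure_face_subset (hsub hp).1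
    rw [hp.2] at hN
    have hE : splittings σ ((D.filter fun d => σ '' d.sides ∈
        splittings G.label (G.diagonals : Set _) : Finset _) : Set (Diagonal (m + 1))) =
        splittings G.label (G.diagonals : Set _) := by
      ext S
      constructor
      · rintro ⟨d, hd, rfl | rfl⟩
        · exact (Finset.mem_filter.1 hd).2
        · exact compl_mem_splittings (Finset.mem_filter.1 hd).2
      · intro hS
        obtain ⟨d, hd, rfl | rfl⟩ := hN hS
        · exact ⟨d, Finset.mem_filter.2 ⟨hd, hS⟩, Or.inl rfl⟩
        · refine ⟨d, Finset.mem_filter.2 ⟨hd, ?_⟩, Or.inr rfl⟩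
          simpa using compl_mem_splittings hS
    have hc := congrArg Set.ncard hE
    rw [ncard_splittings, ncard_splittings, G.card_diagonals] at hc
    refine ⟨_, Finset.mem_powersetCard.2 ⟨Finset.filter_subset _ _, Nat.eq_of_mul_eq_mul_left two_pos hc⟩,
      mem_facesAt.2 ⟨G.label, hτ, by rw [hE]⟩⟩
  · rintro ⟨E, hE, hC⟩
    obtain ⟨hED, hEc⟩ := Finset.mem_powersetCard.1 hE
    obtain ⟨τ, hτ, rfl⟩ := mem_facesAt.1 hC
    obtain ⟨F, hF, hFc, hFE⟩ := exists_diagonals hp.2 hED hτ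
    refine ⟨⟨⟨τ, F, hFc.trans hEc, hF⟩, ?_⟩, ?_⟩
    · rw [MarkedPolygon.openFace_eq, hFE]
    · intro q hq
      rw [face_eq_of_mem hp hτ] at hq
      refine ⟨face_subset_closure_face hED hq, fun h => ?_⟩
      have hDE := Finset.coe_injective (splittings_injective σ (hq.2.symm.trans h.2))
      rw [hDE] at hD
      omega

/-- A cell of codimension `k` is in the boundary of `2 ^ t * k.choose t` cells of codimension
`k - t`. -/
theorem encard_codimCells_around (n k t : ℕ) (hn : 3 ≤ n) (ht : 1 ≤ t) (htk : t ≤ k)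
    (C : Set (ModuliBar n)) (hC : C ∈ codimCells n k) :
    {C' : Set (ModuliBar n) |
        C' ∈ codimCells n (k - t) ∧ C ⊆ cellBoundary C'}.encard =
      ((2 ^ t * Nat.choose k t : ℕ) : ℕ∞) := by
  classical
  obtain ⟨m, rfl⟩ : ∃ m, n = m + 1 := ⟨n - 1, by omega⟩
  obtain ⟨⟨σ, D, hD, hcross⟩, rfl⟩ := hC
  simp only [MarkedPolygon.openFace_eq]
  -- One point suffices: all adjacent cells are seen from the associahedra through it.
  obtain ⟨p, hp⟩ := face_splittings_nonempty σ D hcross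
  have e : {C' : Set (ModuliBar (m + 1)) | C' ∈ codimCells (m + 1) (k - t) ∧
      face σ (splittings σ (D : Set _)) ⊆ cellBoundary C'} =
      (((Finset.powersetCard (k - t) D).biUnion (facesAt p σ) : Finset _) : Set _) := by
    ext C'
    rw [Finset.mem_coe, Finset.mem_biUnion]
    exact mem_codimCells_and_subset_cellBoundary_iff ht htk hD hp C'
  rw [e, Set.encard_coe_eq_coe_finsetCard, Finset.card_biUnion, Finset.sum_const_nat (m := 2 ^ t),
    Finset.card_powersetCard, hD, Nat.choose_symm htk, mul_comm]
  · intro E hE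
    obtain ⟨hED, hEc⟩ := Finset.mem_powersetCard.1 hE
    rw [card_facesAt hp.1 hp.2 hED, hD, hEc, Nat.sub_sub_self htk]
  -- A nonempty face knows its nodes, so different `E` contribute different cells.
  · intro E hE F hF hne
    refine Finset.disjoint_left.2 fun C' h1 h2 => ?_
    obtain ⟨τ, hτ, rfl⟩ := mem_facesAt.1 h1
    obtain ⟨υ, hυ, h⟩ := mem_facesAt.1 h2
    obtain ⟨q, hq⟩ := face_nonempty hp.2 (Finset.mem_powersetCard.1 hE).1 hτ
    have hq' := h ▸ hq
    exact hne (Finset.coe_injective (splittings_injective σ (hq.2.symm.trans hq'.2)))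

end RealModuli

end

theorem lemma3p2p2 (n k t : ℕ) (hn : 3 ≤ n) (ht : 1 ≤ t) (htk : t ≤ k)
    (C : Set (RealModuli.ModuliBar n)) (hC : C ∈ RealModuli.codimCells n k) :
    {C' : Set (RealModuli.ModuliBar n) |
        C' ∈ RealModuli.codimCells n (k - t) ∧ C ⊆ RealModuli.cellBoundary C'}.encard =
      ((2 ^ t * Nat.choose k t : ℕ) : ℕ∞) :=
  RealModuli.encard_codimCells_around n k t hn ht htk C hC
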